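/- Let $|H\rangle=\cos(\pi/8)|0\rangle+\sin(\pi/8)|1\rangle$. A Pauli-based computation (PBC) on $n$ qubits starts in the state $|H\rangle^{\otimes n}$ and consists of $n$ steps; at step $t$ one performs a non-destructive measurement of a Hermitian Pauli operator $P_t$ (a tensor product of $n$ single-qubit operators from $\{I,X,Y,Z\}$ with a sign $\pm1$), with outcome $\sigma_t=\pm1$. The operator $P_t$ may depend on $\sigma_1,\dots,\sigma_{t-1}$, and after the last step an output bit $b_{out}$ is computed from $\sigma_1,\dots,\sigma_n$. The operators $P_t$ and the bit $b_{out}$ are computed, from a description $d$ of the computation, the number $n$ and the outcomes obtained so far, by a classical algorithm $L$ in time polynomial in $n$. Let $\alpha=\log_2(7)/3\approx 0.94$. (i) Any PBC on $n$ qubits can be simulated classically in time $2^{\alpha n}\,\mathrm{poly}(n)$. Precisely: for every classical algorithm $L$ there are a randomized classical algorithm $S$ and a polynomial $r$ such that for every polynomial $p$ there is a polynomial $q$ with the following property. For every $n\ge 0$, every PBC on $n$ qubits, every description $d$ from which $L$ computes each $P_t$ and $b_{out}$ of this PBC (for all sequences of outcomes) in time at most $p(n)$, and every integer $k\ge1$,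 the algorithm $S$, on input $d,n,k$ and using $r(n+k)$ fair coin flips, always halts in time at most $2^{\alpha n}q(n+k)$ and with probability at least $1-2^{-k}$ outputs a rational number that differs from $\Pr[b_{out}=1]$ by at most $1/k$. (Classical algorithms are programs of a pure-LISP machine: data are binary trees, numbers $n,k$ are written in unary, and taking a component, pairing, testing for the empty tree and each control instruction cost one time step.) (ii) The stabilizer rank of $|H\rangle^{\otimes 6}$ is at most $7$: $|H\rangle^{\otimes 6}$ is a complex linear combination of seven six-qubit stabilizer states, that is, states obtained from $|0\rangle^{\otimes 6}$ by products of the gates $\begin{pmatrix}1&1\\1&-1\end{pmatrix}/\sqrt2$, $\mathrm{diag}(1,i)$ and CNOT. -/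

import Mathlib

open scoped Matrix BigOperators

/-! ## Classical computation: a pure-LISP machine with unit-cost operations -/

/-- Data are binary trees: `nil`, or a pair `cons a b`. -/
inductive Tree2 : Type
  | nil : Tree2
  | cons : Tree2 → Tree2 → Tree2

/-- Programs transform one datum into one datum. -/
inductive Prog : Type
  /-- return the input unchanged -/
  | ident : Prog
  /-- return `nil` -/
  | empty : Prog
  /-- first component (`nil` on `nil`) -/
  | fst : Prog
  /-- second component (`nil` on `nil`) -/
  | snd : Prog
  /-- run both programs on the input and pair their results -/
  | pair : Prog → Prog → Prog
  /-- `seq f g`: run `f`, then run `g` on the result -/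
  | seq : Prog → Prog → Prog
  /-- `cond c f g`: run `c` on the input; if the result is not `nil` run `f` on the input,
  otherwise run `g` on the input -/
  | cond : Prog → Prog → Prog → Prog
  /-- `loop c f`: as long as the result of `c` on the current datum is not `nil`,
  replace the current datum by the result of `f` on it -/
  | loop : Prog → Prog → Prog

/-- `Runs f x y t`: on input `x` the program `f` halts with output `y` after exactly `t`
elementary steps. Every executed instruction costs one step (a pair is a record of two pointers,
so that no operation copies data). -/
inductive Runs : Prog → Tree2 → Tree2 → ℕ → Prop
  | ident (x : Tree2) : Runs Prog.ident x x 1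
  | empty (x : Tree2) : Runs Prog.empty x Tree2.nil 1
  | fst_nil : Runs Prog.fst Tree2.nil Tree2.nil 1
  | fst_cons (a b : Tree2) : Runs Prog.fst (Tree2.cons a b) a 1
  | snd_nil : Runs Prog.snd Tree2.nil Tree2.nil 1
  | snd_cons (a b : Tree2) : Runs Prog.snd (Tree2.cons a b) b 1
  | pair {f g : Prog} {x y z : Tree2} {s t : ℕ} :
      Runs f x y s → Runs g x z t → Runs (Prog.pair f g) x (Tree2.cons y z) (s + t + 1)
  | seq {f g : Prog} {x y z : Tree2} {s t : ℕ} :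
      Runs f x y s → Runs g y z t → Runs (Prog.seq f g) x z (s + t + 1)
  | cond_true {c f g : Prog} {x a b y : Tree2} {s t : ℕ} :
      Runs c x (Tree2.cons a b) s → Runs f x y t → Runs (Prog.cond c f g) x y (s + t + 1)
  | cond_false {c f g : Prog} {x y : Tree2} {s t : ℕ} :
      Runs c x Tree2.nil s → Runs g x y t → Runs (Prog.cond c f g) x y (s + t + 1)
  | loop_stop {c f : Prog} {x : Tree2} {s : ℕ} :
      Runs c x Tree2.nil s → Runs (Prog.loop c f) x x (s + 1)
  | loop_step {c f : Prog} {x a b y z : Tree2} {s t u : ℕ} :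
      Runs c x (Tree2.cons a b) s → Runs f x y t → Runs (Prog.loop c f) y z u →
        Runs (Prog.loop c f) x z (s + t + u + 1)

/-- Programs are deterministic: output and running time are determined by the input. -/
theorem Runs.unique {f : Prog} {x y y' : Tree2} {t t' : ℕ}
    (h : Runs f x y t) (h' : Runs f x y' t') : y = y' ∧ t = t' := by
  induction h generalizing y' t' with
  | ident | empty | fst_nil | fst_cons | snd_nil | snd_cons => cases h'; exact ⟨rfl, rfl⟩
  | pair _ _ ih₁ ih₂ =>
    cases h' with
    | pair k₁ k₂ =>
      obtain ⟨rfl, rfl⟩ := ih₁ k₁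
      obtain ⟨rfl, rfl⟩ := ih₂ k₂
      exact ⟨rfl, rfl⟩
  | seq _ _ ih₁ ih₂ =>
    cases h' with
    | seq k₁ k₂ =>
      obtain ⟨rfl, rfl⟩ := ih₁ k₁
      obtain ⟨rfl, rfl⟩ := ih₂ k₂
      exact ⟨rfl, rfl⟩
  | cond_true _ _ ih₁ ih₂ =>
    cases h' with
    | cond_true k₁ k₂ =>
      obtain ⟨_, rfl⟩ := ih₁ k₁
      obtain ⟨rfl, rfl⟩ := ih₂ k₂
      exact ⟨rfl, rfl⟩
    | cond_false k₁ _ => exact absurd (ih₁ k₁).1 (by simp)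
  | cond_false _ _ ih₁ ih₂ =>
    cases h' with
    | cond_true k₁ _ => exact absurd (ih₁ k₁).1 (by simp)
    | cond_false k₁ k₂ =>
      obtain ⟨_, rfl⟩ := ih₁ k₁
      obtain ⟨rfl, rfl⟩ := ih₂ k₂
      exact ⟨rfl, rfl⟩
  | loop_stop _ ih₁ =>
    cases h' with
    | loop_stop k₁ =>
      obtain ⟨_, rfl⟩ := ih₁ k₁
      exact ⟨rfl, rfl⟩
    | loop_step k₁ _ _ => exact absurd (ih₁ k₁).1 (by simp)
  | loop_step _ _ _ ih₁ ih₂ ih₃ =>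
    cases h' with
    | loop_stop k₁ => exact absurd (ih₁ k₁).1 (by simp)
    | loop_step k₁ k₂ k₃ =>
      obtain ⟨_, rfl⟩ := ih₁ k₁
      obtain ⟨rfl, rfl⟩ := ih₂ k₂
      obtain ⟨rfl, rfl⟩ := ih₃ k₃
      exact ⟨rfl, rfl⟩

/-- Natural numbers are written in unary. -/
def encNat : ℕ → Tree2
  | 0 => Tree2.nil
  | m + 1 => Tree2.cons Tree2.nil (encNat m)

def encBool : Bool → Tree2
  | false => Tree2.nil
  | true => Tree2.cons Tree2.nil Tree2.nil

def encList : List Tree2 → Tree2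
  | [] => Tree2.nil
  | a :: l => Tree2.cons a (encList l)

/-- A bit string as a list of bits. -/
def encBits {m : ℕ} (w : Fin m → Bool) : Tree2 :=
  encList (List.ofFn fun i => encBool (w i))

/-! ## Qubits, Pauli operators, stabilizer states -/

/-- (Not necessarily normalized) vectors of `n` qubits, by their amplitudes in the standard
basis. -/
abbrev QVec (n : ℕ) : Type := (Fin n → Fin 2) → ℂ

/-- The squared Euclidean norm. -/
noncomputable def QVec.sqNorm {n : ℕ} (ψ : QVec n) : ℝ := ∑ x, ‖ψ x‖ ^ 2

/-- The `n`-fold tensor power of `cos (π/8) |0⟩ + sin (π/8) |1⟩`. -/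
noncomputable def magicState (n : ℕ) : QVec n := fun x =>
  ∏ i, ((![Real.cos (Real.pi / 8), Real.sin (Real.pi / 8)] (x i) : ℝ) : ℂ)

/-- Names of the single-qubit Pauli operators. -/
inductive PauliLetter : Type
  | I | X | Y | Z

def PauliLetter.toMatrix : PauliLetter → Matrix (Fin 2) (Fin 2) ℂ
  | .I => !![1, 0; 0, 1]
  | .X => !![0, 1; 1, 0]
  | .Y => !![0, -Complex.I; Complex.I, 0]
  | .Z => !![1, 0; 0, -1]

/-- A hermitian Pauli operator on `n` qubits: a tensor product of single-qubit Pauli operators,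
with the sign `-1` if `neg` is `true`, and `+1` otherwise. -/
structure PauliOp (n : ℕ) : Type where
  neg : Bool
  letter : Fin n → PauliLetter

def PauliOp.toMatrix {n : ℕ} (P : PauliOp n) : Matrix (Fin n → Fin 2) (Fin n → Fin 2) ℂ :=
  fun x y => (if P.neg then -1 else 1) * ∏ i, (P.letter i).toMatrix (x i) (y i)

/-- A letter is written as two bits (its `X`-part and its `Z`-part). -/
def encLetter : PauliLetter → Tree2
  | .I => Tree2.cons (encBool false) (encBool false)
  | .X => Tree2.cons (encBool true) (encBool false)
  | .Y => Tree2.cons (encBool true) (encBool true)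
  | .Z => Tree2.cons (encBool false) (encBool true)

/-- A Pauli operator is written as its sign bit, followed by the list of its letters. -/
def encPauli {n : ℕ} (P : PauliOp n) : Tree2 :=
  Tree2.cons (encBool P.neg) (encList (List.ofFn fun i => encLetter (P.letter i)))

/-- The basis vector `|0 … 0⟩`. -/
noncomputable def zeroState (n : ℕ) : QVec n := fun x => if x = 0 then 1 else 0

/-- The Hadamard gate `(1/√2) [1, 1; 1, -1]` on qubit `i`. -/
noncomputable def hadamardGate {n : ℕ} (i : Fin n) (ψ : QVec n) : QVec n := fun x =>
  ∑ b : Fin 2, ((1 / Real.sqrt 2 : ℝ) : ℂ) * (!![1, 1; 1, -1] : Matrix (Fin 2) (Fin 2) ℂ) (x i) b *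
    ψ (Function.update x i b)

/-- The phase gate `[1, 0; 0, i]` on qubit `i`. -/
noncomputable def phaseGate {n : ℕ} (i : Fin n) (ψ : QVec n) : QVec n := fun x =>
  (if x i = 1 then Complex.I else 1) * ψ x

/-- The CNOT gate `|x⟩ ↦ |x with x_j replaced by x_j + x_i⟩` with control `i` and target `j`
(an involution). -/
def cnotGate {n : ℕ} (i j : Fin n) (ψ : QVec n) : QVec n := fun x =>
  ψ (Function.update x j (x j + x i))

/-- Stabilizer states: the images of `|0 … 0⟩` under products of Hadamard, phase and CNOT
gates. -/
inductive IsStabilizerState {n : ℕ} : QVec n → Prop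
  | zero : IsStabilizerState (zeroState n)
  | hadamard (i : Fin n) {ψ : QVec n} :
      IsStabilizerState ψ → IsStabilizerState (hadamardGate i ψ)
  | phase (i : Fin n) {ψ : QVec n} :
      IsStabilizerState ψ → IsStabilizerState (phaseGate i ψ)
  | cnot (i j : Fin n) (hij : i ≠ j) {ψ : QVec n} :
      IsStabilizerState ψ → IsStabilizerState (cnotGate i j ψ)

/-- `ψ` is a linear combination of `m` stabilizer states. -/
def HasStabilizerDecomposition {n : ℕ} (ψ : QVec n) (m : ℕ) : Prop :=
  ∃ (c : Fin m → ℂ) (φ : Fin m → QVec n),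
    (∀ a, IsStabilizerState (φ a)) ∧ ψ = ∑ a, c a • φ a

/-- The stabilizer rank: the least number of terms in a stabilizer decomposition. -/
noncomputable def stabilizerRank {n : ℕ} (ψ : QVec n) : ℕ∞ :=
  ⨅ (m : ℕ) (_ : HasStabilizerDecomposition ψ m), (m : ℕ∞)

/-! ## Pauli-based computations -/

/-- A Pauli-based computation on `n` qubits, with steps `t = 0, …, n - 1`. Measured eigenvalues
are recorded as bits, `false` for `+1` and `true` for `-1`. -/
structure PBC (n : ℕ) : Type where
  /-- the Pauli operator measured at step `t`, given the outcomes of the previous steps -/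
  pauli : (t : Fin n) → (Fin t → Bool) → PauliOp n
  /-- the final bit, given all outcomes -/
  out : (Fin n → Bool) → Bool

/-- The projector `(I + σ P) / 2`, where `σ = -1` if `b` is `true` and `σ = 1` otherwise. -/
noncomputable def PauliOp.proj {n : ℕ} (P : PauliOp n) (b : Bool) :
    Matrix (Fin n → Fin 2) (Fin n → Fin 2) ℂ :=
  (1 / 2 : ℂ) • (1 + (if b then (-1 : ℂ) else 1) • P.toMatrix)

/-- The unnormalized state after `t` steps when the outcomes are `σ`. -/
noncomputable def PBC.state {n : ℕ} (Q : PBC n) (σ : Fin n → Bool) :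
    (t : ℕ) → t ≤ n → QVec n
  | 0, _ => magicState n
  | t + 1, h =>
      ((Q.pauli ⟨t, h⟩ fun i => σ (Fin.castLE (Nat.le_of_succ_le h) i)).proj (σ ⟨t, h⟩)) *ᵥ
        Q.state σ t (Nat.le_of_succ_le h)

/-- The probability that the sequence of outcomes is `σ`. -/
noncomputable def PBC.prob {n : ℕ} (Q : PBC n) (σ : Fin n → Bool) : ℝ :=
  (Q.state σ n le_rfl).sqNorm

/-- The probability that the final bit is `1`. -/
noncomputable def PBC.probOne {n : ℕ} (Q : PBC n) : ℝ :=
  ∑ σ : Fin n → Bool, if Q.out σ then Q.prob σ else 0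

/-- The classical processing of `Q`: from a description `d` of the computation, from `n` and from
the outcomes obtained so far, the program `L` finds within `T` steps the next Pauli operator to be
measured or, when all `n` outcomes are there, the final bit. -/
def ComputesLabels {n : ℕ} (L : Prog) (d : Tree2) (Q : PBC n) (T : ℕ) : Prop :=
  (∀ (t : Fin n) (h : Fin t → Bool), ∃ s ≤ T,
    Runs L (Tree2.cons d (Tree2.cons (encNat n) (encBits h))) (encPauli (Q.pauli t h)) s) ∧
  (∀ σ : Fin n → Bool, ∃ s ≤ T,
    Runs L (Tree2.cons d (Tree2.cons (encNat n) (encBits σ))) (encBool (Q.out σ)) s)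

/-- The input of a simulation: the description of a computation on `n` qubits, the number `n`,
the precision `k`, and a string of coin flips. -/
def simInput (d : Tree2) (n k : ℕ) {m : ℕ} (w : Fin m → Bool) : Tree2 :=
  Tree2.cons d (Tree2.cons (encNat n) (Tree2.cons (encNat k) (encBits w)))

/-- The randomized program `S`, which uses `m` fair coins and is given the description `d` of `Q`
and the number `k`, always halts within `T` steps, and with probability at least `1 - 2 ^ (-k)`
(over the coins) it prints the numerator and the denominator of a rational number that differs from
the probability of the final bit `1` by at most `1 / k`. -/
def Simulates {n : ℕ} (S : Prog) (d : Tree2) (Q : PBC n) (k m : ℕ) (T : ℝ) : Prop :=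
  (∀ w : Fin m → Bool, ∃ (y : Tree2) (s : ℕ), (s : ℝ) ≤ T ∧ Runs S (simInput d n k w) y s) ∧
  1 - (1 / 2 : ℝ) ^ k ≤
    (Nat.card {w : Fin m → Bool // ∃ (a b s : ℕ), 0 < b ∧
        Runs S (simInput d n k w) (Tree2.cons (encNat a) (encNat b)) s ∧
        |(a : ℝ) / (b : ℝ) - Q.probOne| ≤ 1 / (k : ℝ)} : ℝ) / 2 ^ m

/-! The two halves are independent: the classical simulation does not use the stabilizer rank. It is
a Monte Carlo method based on signed mixtures of stabilizer states. As an operator, the square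
`|H⟩⟨H| ⊗ |H⟩⟨H|`, divided by `(4/3) √2`, is the mean of a random two-qubit stabilizer state with
random weight `1`, `-1` or `0`: products of eigenstates of `X` and `Z` get positive weight,
Bell-like states negative weight (`pairMean_approx`). The qubits are padded to `b = n / 12 + 1`
blocks of twelve, that is, `6 b` pairs. Rescaling by `R = ((4/3) √2) ^ (6 b)` makes the samples
unbiased up to truncation, and about `R ^ 2 = (32/9) ^ (6 b) ≤ 2 ^ (11 b)` samples, times a
polynomial, suffice. Since `2 ^ 11 ≤ 7 ^ 4`, this is `O(7 ^ (n/3)) = O(2 ^ (α n))`.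

A state enters only through the functional `g ↦ Re ⟨g⟩` on Pauli words. Measurements act linearly on
such functionals, so the output probability is linear in the initial functional
(`PBC.probOne_eq_adaptive`, `adaptive_add`) and a mixture may be inserted for the magic state. On a
stabilizer product state an adaptive run is sampled exactly in the Heisenberg picture
(`adaptive_eq_coinExp`): the measured word is pulled back through the conjugations made so far. If
the result stabilizes the state up to sign, the outcome is determined. Otherwise some stabilizer `G`
anticommutes with it; the outcome is a fair coin, and the projection acts, up to normalization, as
the Clifford operator `(G ± Q) / √2`.

Only polynomially many coins are allowed. The irrational weight comes from a truncated random walk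
that hits `0` with probability `9 - 6 √2`. The exponentially many rows of coins are subset sums of a
few random rows, shifted by another one; they are pairwise independent, so Chebyshev's inequality
applies (`rowsMoment_double`, `trial_chebyshev`). A median of `n + k` trials gives failure
probability at most `2 ^ (-k)` (`collect_chernoff`, `median_accurate`). Running times are composed
with the calculus of `InTime` and `ConstTime`.

For the rank, the amplitudes of six magic states are proportional to `t ^ |x|` with `t = tan (π/8)`,
so `t ^ 2 + 2 t = 1`. Seven stabilizer vectors, all permutation invariant once the pentagon and the
pentagram vector are added, match these amplitudes weight by weight (`pow_hammingWeight`). -/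

/-! ## Data types represented by trees -/

/-- Types whose elements are written as binary trees. -/
class Enc (α : Type) where
  enc : α → Tree2

open Enc

instance : Enc Tree2 := ⟨fun x => x⟩
instance : Enc Bool := ⟨encBool⟩
instance : Enc ℕ := ⟨encNat⟩
instance {α β : Type} [Enc α] [Enc β] : Enc (α × β) := ⟨fun p => Tree2.cons (enc p.1) (enc p.2)⟩
instance {α : Type} [Enc α] : Enc (List α) := ⟨fun l => encList (l.map enc)⟩

@[simp] theorem enc_list_cons {α : Type} [Enc α] (a : α) (l : List α) :
    enc (a :: l) = Tree2.cons (enc a) (enc l) := rfl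
@[simp] theorem enc_succ (m : ℕ) : enc (m + 1) = Tree2.cons Tree2.nil (enc m) := rfl

/-! ## Functions computed within a time bound -/

/-- On the domain `D`, the function `f` is computed by one program in time `O(T + 1)`. -/
def InTime {α β : Type} [Enc α] [Enc β] (D : α → Prop) (f : α → β) (T : α → ℕ) : Prop :=
  ∃ (P : Prog) (c : ℕ), ∀ a, D a → ∃ t ≤ c * (T a + 1), Runs P (enc a) (enc (f a)) t

/-- The function `f` is computed in constant time. -/
def ConstTime {α β : Type} [Enc α] [Enc β] (f : α → β) : Prop :=
  ∃ (P : Prog) (c : ℕ), ∀ a, ∃ t ≤ c, Runs P (enc a) (enc (f a)) t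

/-- `U = O(T + 1)` on the domain `D`. -/
def BigO {α : Type} (D : α → Prop) (U T : α → ℕ) : Prop :=
  ∃ C, ∀ a, D a → U a + 1 ≤ C * (T a + 1)

section ListLemmas

variable {α β : Type}

theorem BigO.of_le {D : α → Prop} {U T : α → ℕ} (C : ℕ) (h : ∀ a, D a → U a + 1 ≤ C * (T a + 1)) :
    BigO D U T := ⟨C, h⟩

theorem BigO.of_le_one {D : α → Prop} {U T : α → ℕ} (h : ∀ a, D a → U a ≤ T a) :
    BigO D U T := ⟨1, fun a ha => by have := h a ha; omega⟩

theorem foldl_replicate_eq_iterate (f : β → β) (m : ℕ) (b : β) (x : α) :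
    (List.replicate m x).foldl (fun b _ => f b) b = f^[m] b := by
  induction m generalizing b with
  | zero => rfl
  | succ m ih => rw [List.replicate_succ, List.foldl_cons, ih, Function.iterate_succ_apply]

theorem foldl_cons_eq (l r : List α) : l.foldl (fun r a => a :: r) r = l.reverse ++ r := by
  induction l generalizing r with
  | nil => rfl
  | cons a l ih => simp [ih]

theorem foldl_map_eq (f : α → β) (l : List α) (r : List β) :
    l.foldl (fun r a => f a :: r) r = (l.map f).reverse ++ r := by
  induction l generalizing r with
  | nil => rfl
  | cons a l ih => simp [ih]

/-- Simultaneous iteration along two lists. -/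
theorem foldl_zip_eq {σ : Type} (s : σ → α → β → σ) (d : β) (l : List α) (r : List β) (x : σ)
    (h : l.length ≤ r.length) :
    l.foldl (fun (p : σ × List β) a => (s p.1 a (p.2.headD d), p.2.tail)) (x, r) =
      ((l.zip r).foldl (fun x p => s x p.1 p.2) x, r.drop l.length) := by
  induction l generalizing r x with
  | nil => simp
  | cons a l ih =>
    cases r with
    | nil => simp at h
    | cons b r => simpa using ih r _ (by simpa using h)

end ListLemmas

section InTimeRules

variable {α β γ δ : Type} [Enc α] [Enc β] [Enc γ] [Enc δ]

theorem InTime.mono {D : α → Prop} {f : α → β} {T T' : α → ℕ} (h : InTime D f T)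
    (hT : BigO D T T') : InTime D f T' := by
  obtain ⟨P, c, hP⟩ := h
  obtain ⟨C, hC⟩ := hT
  refine ⟨P, c * C, fun a ha => ?_⟩
  obtain ⟨t, ht, hr⟩ := hP a ha
  refine ⟨t, ht.trans ?_, hr⟩
  rw [mul_assoc]
  exact Nat.mul_le_mul_left _ (hC a ha)

theorem InTime.restrict {D E : α → Prop} {f : α → β} {T : α → ℕ} (h : InTime D f T)
    (hE : ∀ a, E a → D a) : InTime E f T := by
  obtain ⟨P, c, hP⟩ := h
  exact ⟨P, c, fun a ha => hP a (hE a ha)⟩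

theorem InTime.congr {D : α → Prop} {f g : α → β} {T : α → ℕ} (h : InTime D f T)
    (hE : ∀ a, D a → f a = g a) : InTime D g T := by
  obtain ⟨P, c, hP⟩ := h
  exact ⟨P, c, fun a ha => by rw [← hE a ha]; exact hP a ha⟩

theorem ConstTime.inTime {f : α → β} (h : ConstTime f) {D : α → Prop} {T : α → ℕ} :
    InTime D f T := by
  obtain ⟨P, c, hP⟩ := h
  refine ⟨P, c, fun a _ => ?_⟩
  obtain ⟨t, ht, hr⟩ := hP a
  exact ⟨t, ht.trans (Nat.le_mul_of_pos_right _ (Nat.succ_pos _)), hr⟩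

theorem ConstTime.of_eq {f g : α → β} (h : ConstTime f) (e : ∀ a, f a = g a) : ConstTime g := by
  have : f = g := funext e
  rwa [← this]

/-- Change of the types without change of the trees. -/
theorem ConstTime.recode {α' β' : Type} [Enc α'] [Enc β'] {f : α → β} {g : α' → β'}
    (h : ConstTime f) (e : α' → α) (he : ∀ a, enc (e a) = enc a)
    (hf : ∀ a, enc (f (e a)) = enc (g a)) : ConstTime g := by
  obtain ⟨P, c, hP⟩ := h
  refine ⟨P, c, fun a => ?_⟩
  have := hP (e a)
  rwa [he, hf] at this

theorem constTime_id : ConstTime (fun a : α => a) :=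
  ⟨Prog.ident, 1, fun _ => ⟨1, le_rfl, Runs.ident _⟩⟩

theorem constTime_const_tree (x : Tree2) : ConstTime (fun _ : α => x) := by
  induction x with
  | nil => exact ⟨Prog.empty, 1, fun _ => ⟨1, le_rfl, Runs.empty _⟩⟩
  | cons a b iha ihb =>
    obtain ⟨P, c, hP⟩ := iha
    obtain ⟨P', c', hP'⟩ := ihb
    refine ⟨Prog.pair P P', c + c' + 1, fun x => ?_⟩
    obtain ⟨t, ht, hr⟩ := hP x
    obtain ⟨t', ht', hr'⟩ := hP' x
    exact ⟨t + t' + 1, by omega, Runs.pair hr hr'⟩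

theorem constTime_const (b : β) : ConstTime (fun _ : α => b) :=
  constTime_const_tree (α := α) (enc b)

theorem constTime_fst : ConstTime (fun p : α × β => p.1) :=
  ⟨Prog.fst, 1, fun _ => ⟨1, le_rfl, Runs.fst_cons _ _⟩⟩

theorem constTime_snd : ConstTime (fun p : α × β => p.2) :=
  ⟨Prog.snd, 1, fun _ => ⟨1, le_rfl, Runs.snd_cons _ _⟩⟩

theorem ConstTime.comp {g : β → γ} {f : α → β} (hg : ConstTime g) (hf : ConstTime f) :
    ConstTime (fun a => g (f a)) := by
  obtain ⟨P, c, hP⟩ := hf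
  obtain ⟨P', c', hP'⟩ := hg
  refine ⟨Prog.seq P P', c + c' + 1, fun x => ?_⟩
  obtain ⟨t, ht, hr⟩ := hP x
  obtain ⟨t', ht', hr'⟩ := hP' (f x)
  exact ⟨t + t' + 1, by omega, Runs.seq hr hr'⟩

theorem ConstTime.pair {f : α → β} {g : α → γ} (hf : ConstTime f) (hg : ConstTime g) :
    ConstTime (fun a => (f a, g a)) := by
  obtain ⟨P, c, hP⟩ := hf
  obtain ⟨P', c', hP'⟩ := hg
  refine ⟨Prog.pair P P', c + c' + 1, fun x => ?_⟩
  obtain ⟨t, ht, hr⟩ := hP x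
  obtain ⟨t', ht', hr'⟩ := hP' x
  exact ⟨t + t' + 1, by omega, Runs.pair hr hr'⟩

theorem ConstTime.fst {f : α → β × γ} (hf : ConstTime f) : ConstTime (fun a => (f a).1) :=
  constTime_fst.comp hf

theorem ConstTime.snd {f : α → β × γ} (hf : ConstTime f) : ConstTime (fun a => (f a).2) :=
  constTime_snd.comp hf

theorem InTime.comp {E : β → Prop} {D : α → Prop} {g : β → γ} {f : α → β} {U : β → ℕ} {T : α → ℕ}
    (hg : InTime E g U) (hf : InTime D f T) (hE : ∀ a, D a → E (f a))
    (hU : BigO D (fun a => U (f a)) T) : InTime D (fun a => g (f a)) T := by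
  obtain ⟨P, c, hP⟩ := hf
  obtain ⟨P', c', hP'⟩ := hg
  obtain ⟨C, hC⟩ := hU
  refine ⟨Prog.seq P P', c + c' * C + 1, fun a ha => ?_⟩
  obtain ⟨t, ht, hr⟩ := hP a ha
  obtain ⟨t', ht', hr'⟩ := hP' (f a) (hE a ha)
  refine ⟨t + t' + 1, ?_, Runs.seq hr hr'⟩
  have h1 : t' ≤ c' * C * (T a + 1) := by
    rw [mul_assoc]; exact ht'.trans (Nat.mul_le_mul_left _ (hC a ha))
  have : (c + c' * C + 1) * (T a + 1) = c * (T a + 1) + c' * C * (T a + 1) + (T a + 1) := by ring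
  omega

/-- Composition with a total function. -/
theorem InTime.comp' {D : α → Prop} {g : β → γ} {f : α → β} {U : β → ℕ} {T : α → ℕ}
    (hg : InTime (fun _ => True) g U) (hf : InTime D f T)
    (hU : BigO D (fun a => U (f a)) T) : InTime D (fun a => g (f a)) T :=
  hg.comp hf (fun _ _ => trivial) hU

theorem ConstTime.compIn {D : α → Prop} {g : β → γ} {f : α → β} {T : α → ℕ}
    (hg : ConstTime g) (hf : InTime D f T) : InTime D (fun a => g (f a)) T :=
  (hg.inTime (D := fun _ => True) (T := fun _ => 0)).comp' hf ⟨1, fun a _ => by simp⟩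

theorem InTime.pair {D : α → Prop} {f : α → β} {g : α → γ} {T : α → ℕ}
    (hf : InTime D f T) (hg : InTime D g T) : InTime D (fun a => (f a, g a)) T := by
  obtain ⟨P, c, hP⟩ := hf
  obtain ⟨P', c', hP'⟩ := hg
  refine ⟨Prog.pair P P', c + c' + 1, fun a ha => ?_⟩
  obtain ⟨t, ht, hr⟩ := hP a ha
  obtain ⟨t', ht', hr'⟩ := hP' a ha
  refine ⟨t + t' + 1, ?_, Runs.pair hr hr'⟩
  have : (c + c' + 1) * (T a + 1) = c * (T a + 1) + c' * (T a + 1) + (T a + 1) := by ring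
  omega

theorem InTime.fst {D : α → Prop} {f : α → β × γ} {T : α → ℕ} (hf : InTime D f T) :
    InTime D (fun a => (f a).1) T := constTime_fst.compIn hf

theorem InTime.snd {D : α → Prop} {f : α → β × γ} {T : α → ℕ} (hf : InTime D f T) :
    InTime D (fun a => (f a).2) T := constTime_snd.compIn hf

theorem InTime.cond {D : α → Prop} {b : α → Bool} {f g : α → β} {T : α → ℕ}
    (hb : InTime D b T) (hf : InTime (fun a => D a ∧ b a = true) f T)
    (hg : InTime (fun a => D a ∧ b a = false) g T) :
    InTime D (fun a => bif b a then f a else g a) T := by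
  obtain ⟨P, c, hP⟩ := hf
  obtain ⟨P', c', hP'⟩ := hg
  obtain ⟨P₀, c₀, hP₀⟩ := hb
  refine ⟨Prog.cond P₀ P P', c₀ + c + c' + 1, fun a ha => ?_⟩
  have e : (c₀ + c + c' + 1) * (T a + 1) =
    c₀ * (T a + 1) + c * (T a + 1) + c' * (T a + 1) + (T a + 1) := by ring
  obtain ⟨t₀, ht₀, hr₀⟩ := hP₀ a ha
  cases hb : b a with
  | true =>
    obtain ⟨t, ht, hr⟩ := hP a ⟨ha, hb⟩
    rw [hb] at hr₀
    exact ⟨t₀ + t + 1, by omega, by simpa [hb] using Runs.cond_true hr₀ hr⟩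
  | false =>
    obtain ⟨t, ht, hr⟩ := hP' a ⟨ha, hb⟩
    rw [hb] at hr₀
    exact ⟨t₀ + t + 1, by omega, by simpa [hb] using Runs.cond_false hr₀ hr⟩

theorem InTime.cond' {D : α → Prop} {b : α → Bool} {f g : α → β} {T : α → ℕ}
    (hb : InTime D b T) (hf : InTime D f T) (hg : InTime D g T) :
    InTime D (fun a => bif b a then f a else g a) T :=
  hb.cond (hf.restrict fun _ h => h.1) (hg.restrict fun _ h => h.1)

theorem ConstTime.cond {b : α → Bool} {f g : α → β}
    (hb : ConstTime b) (hf : ConstTime f) (hg : ConstTime g) :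
    ConstTime (fun a => bif b a then f a else g a) := by
  obtain ⟨P, c, hP⟩ := hf
  obtain ⟨P', c', hP'⟩ := hg
  obtain ⟨P₀, c₀, hP₀⟩ := hb
  refine ⟨Prog.cond P₀ P P', c₀ + c + c' + 1, fun a => ?_⟩
  obtain ⟨t₀, ht₀, hr₀⟩ := hP₀ a
  cases hb : b a with
  | true =>
    obtain ⟨t, ht, hr⟩ := hP a
    rw [hb] at hr₀
    exact ⟨t₀ + t + 1, by omega, by simpa [hb] using Runs.cond_true hr₀ hr⟩
  | false =>
    obtain ⟨t, ht, hr⟩ := hP' a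
    rw [hb] at hr₀
    exact ⟨t₀ + t + 1, by omega, by simpa [hb] using Runs.cond_false hr₀ hr⟩

/-! ### Booleans -/

/-- Case distinction on a Boolean. -/
theorem ConstTime.boolCases {f : Bool → α → β} {b : α → Bool} (hb : ConstTime b)
    (ht : ConstTime (f true)) (hf : ConstTime (f false)) : ConstTime (fun a => f (b a) a) :=
  (hb.cond ht hf).of_eq fun a => by cases b a <;> rfl

/-- After a case distinction on all bits every branch returns a constant tree, so an arbitrary
function of finitely many bits costs constant time. -/
theorem ConstTime.bool₁ (F : Bool → β) {a : α → Bool} (ha : ConstTime a) :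
    ConstTime (fun x => F (a x)) :=
  ha.boolCases (f := fun b _ => F b) (constTime_const _) (constTime_const _)

theorem ConstTime.bool₂ (F : Bool → Bool → β) {a b : α → Bool} (ha : ConstTime a)
    (hb : ConstTime b) : ConstTime (fun x => F (a x) (b x)) :=
  ha.boolCases (f := fun c x => F c (b x)) (hb.bool₁ _) (hb.bool₁ _)

theorem ConstTime.bool₃ (F : Bool → Bool → Bool → β) {a b c : α → Bool} (ha : ConstTime a)
    (hb : ConstTime b) (hc : ConstTime c) : ConstTime (fun x => F (a x) (b x) (c x)) :=
  ha.boolCases (f := fun d x => F d (b x) (c x)) (hb.bool₂ _ hc) (hb.bool₂ _ hc)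

theorem ConstTime.bool₄ (F : Bool → Bool → Bool → Bool → β) {a b c d : α → Bool} (ha : ConstTime a)
    (hb : ConstTime b) (hc : ConstTime c) (hd : ConstTime d) :
    ConstTime (fun x => F (a x) (b x) (c x) (d x)) :=
  ha.boolCases (f := fun e x => F e (b x) (c x) (d x)) (hb.bool₃ _ hc hd) (hb.bool₃ _ hc hd)

theorem ConstTime.bool₅ (F : Bool → Bool → Bool → Bool → Bool → β) {a b c d e : α → Bool}
    (ha : ConstTime a) (hb : ConstTime b) (hc : ConstTime c) (hd : ConstTime d)
    (he : ConstTime e) : ConstTime (fun x => F (a x) (b x) (c x) (d x) (e x)) :=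
  ha.boolCases (f := fun i x => F i (b x) (c x) (d x) (e x)) (hb.bool₄ _ hc hd he)
    (hb.bool₄ _ hc hd he)

theorem ConstTime.bool₇ (F : Bool → Bool → Bool → Bool → Bool → Bool → Bool → β)
    {a b c d e i j : α → Bool} (hi : ConstTime i) (hj : ConstTime j)
    (ha : ConstTime a) (hb : ConstTime b) (hc : ConstTime c) (hd : ConstTime d)
    (he : ConstTime e) : ConstTime (fun x => F (i x) (j x) (a x) (b x) (c x) (d x) (e x)) :=
  hi.boolCases (f := fun y x => F y (j x) (a x) (b x) (c x) (d x) (e x))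
    (hj.boolCases (f := fun y x => F true y (a x) (b x) (c x) (d x) (e x))
      (ha.bool₅ _ hb hc hd he) (ha.bool₅ _ hb hc hd he))
    (hj.boolCases (f := fun y x => F false y (a x) (b x) (c x) (d x) (e x))
      (ha.bool₅ _ hb hc hd he) (ha.bool₅ _ hb hc hd he))

/-! ### Numbers and lists -/

theorem ConstTime.succ {f : α → ℕ} (hf : ConstTime f) : ConstTime (fun a => f a + 1) := by
  have h := (constTime_const (α := α) Tree2.nil).pair hf
  exact h.recode (fun a => a) (fun _ => rfl) (fun _ => rfl)

theorem constTime_pred : ConstTime (fun m : ℕ => m - 1) := by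
  refine ⟨Prog.snd, 1, fun m => ⟨1, le_rfl, ?_⟩⟩
  cases m with
  | zero => exact Runs.snd_nil
  | succ m => exact Runs.snd_cons _ _

theorem ConstTime.cons {f : α → β} {g : α → List β} (hf : ConstTime f) (hg : ConstTime g) :
    ConstTime (fun a => f a :: g a) :=
  (hf.pair hg).recode (fun a => a) (fun _ => rfl) (fun _ => rfl)

theorem constTime_tail : ConstTime (fun l : List α => l.tail) := by
  refine ⟨Prog.snd, 1, fun l => ⟨1, le_rfl, ?_⟩⟩
  cases l with
  | nil => exact Runs.snd_nil
  | cons a l => exact Runs.snd_cons _ _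

theorem constTime_isCons : ConstTime (fun l : List α => !l.isEmpty) := by
  refine ⟨Prog.cond Prog.ident (Prog.pair Prog.empty Prog.empty) Prog.empty, 5, fun l => ?_⟩
  cases l with
  | nil => exact ⟨1 + 1 + 1, by omega, Runs.cond_false (Runs.ident _) (Runs.empty _)⟩
  | cons a l =>
    exact ⟨1 + (1 + 1 + 1) + 1, by omega,
      Runs.cond_true (Runs.ident _) (Runs.pair (Runs.empty _) (Runs.empty _))⟩

theorem constTime_isPos : ConstTime (fun m : ℕ => decide (0 < m)) := by
  refine ⟨Prog.cond Prog.ident (Prog.pair Prog.empty Prog.empty) Prog.empty, 5, fun l => ?_⟩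
  cases l with
  | zero => exact ⟨1 + 1 + 1, by omega, Runs.cond_false (Runs.ident _) (Runs.empty _)⟩
  | succ l =>
    refine ⟨1 + (1 + 1 + 1) + 1, by omega, ?_⟩
    simp only [Nat.succ_pos, decide_true]
    exact Runs.cond_true (Runs.ident _) (Runs.pair (Runs.empty _) (Runs.empty _))

theorem ConstTime.tail {f : α → List β} (hf : ConstTime f) : ConstTime (fun a => (f a).tail) :=
  constTime_tail.comp hf

/-- A list of empty trees is the same tree as its length. -/
theorem enc_list_unit_eq (l : List Tree2) (h : ∀ x ∈ l, x = Tree2.nil) : enc l = enc l.length := by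
  induction l with
  | nil => rfl
  | cons a l ih =>
    rw [List.length_cons, enc_list_cons, enc_succ, ih fun x hx => h x (List.mem_cons_of_mem _ hx),
      h a List.mem_cons_self]
    rfl

theorem enc_replicate_nil (m : ℕ) : enc (List.replicate m Tree2.nil) = enc m := by
  rw [enc_list_unit_eq _ fun x hx => List.eq_of_mem_replicate hx, List.length_replicate]

/-! ### Iteration along a list -/

/-- The loop state is the triple of remaining list, accumulator and fixed context. The summand 40
covers the instructions that unpack and rebuild this triple in one pass. -/
theorem runs_foldl_loop {s : γ → β → α → β} {P : Prog} {K : ℕ} (c : γ) (Inv : List α → β → Prop)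
    (hs : ∀ a l b, Inv (a :: l) b → Inv l (s c b a) ∧
      ∃ t ≤ K, Runs P (enc (c, b, a)) (enc (s c b a)) t) (l : List α) :
    ∀ b, Inv l b → ∃ t ≤ l.length * (K + 40) + 2,
      Runs (Prog.loop Prog.fst
        (Prog.pair (Prog.seq Prog.fst Prog.snd)
          (Prog.pair
            (Prog.seq (Prog.pair (Prog.seq Prog.snd Prog.snd)
              (Prog.pair (Prog.seq Prog.snd Prog.fst) (Prog.seq Prog.fst Prog.fst))) P)
            (Prog.seq Prog.snd Prog.snd))))
        (enc (l, b, c)) (enc (([] : List α), l.foldl (s c) b, c)) t := by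
  induction l with
  | nil =>
    intro b _
    exact ⟨2, by omega, Runs.loop_stop (Runs.fst_cons _ _)⟩
  | cons a l ih =>
    intro b hb
    obtain ⟨hi, t, ht, hr⟩ := hs a l b hb
    obtain ⟨u, hu, hru⟩ := ih _ hi
    refine ⟨_, ?_, Runs.loop_step (Runs.fst_cons _ _)
      (Runs.pair (Runs.seq (Runs.fst_cons _ _) (Runs.snd_cons _ _))
        (Runs.pair (Runs.seq (Runs.pair (Runs.seq (Runs.snd_cons _ _) (Runs.snd_cons _ _))
          (Runs.pair (Runs.seq (Runs.snd_cons _ _) (Runs.fst_cons _ _))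
            (Runs.seq (Runs.fst_cons _ _) (Runs.fst_cons _ _)))) hr)
          (Runs.seq (Runs.snd_cons _ _) (Runs.snd_cons _ _)))) hru⟩
    simp only [List.length_cons]
    have : (l.length + 1) * (K + 40) = l.length * (K + 40) + K + 40 := by ring
    omega

/-- Iteration along a list, with an invariant and a bound `B` for the time of one step. -/
theorem InTime.foldl {D : γ → Prop} {l : γ → List α} {b₀ : γ → β} {s : γ → β → α → β} {T : γ → ℕ}
    {E : γ × β × α → Prop} {V : γ × β × α → ℕ} {B : γ → ℕ}
    (hs : InTime E (fun x => s x.1 x.2.1 x.2.2) V)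
    (hl : InTime D l T) (hb : InTime D b₀ T) (Inv : γ → List α → β → Prop)
    (h0 : ∀ c, D c → Inv c (l c) (b₀ c))
    (hstep : ∀ c a r b, D c → Inv c (a :: r) b →
      Inv c r (s c b a) ∧ E (c, b, a) ∧ V (c, b, a) ≤ B c)
    (hB : BigO D (fun c => (l c).length * (B c + 1)) T) :
    InTime D (fun c => (l c).foldl (s c) (b₀ c)) T := by
  obtain ⟨P, k, hP⟩ := hs
  obtain ⟨Pl, kl, hPl⟩ := hl
  obtain ⟨Pb, kb, hPb⟩ := hb
  obtain ⟨C, hC⟩ := hB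
  refine ⟨Prog.seq (Prog.pair Pl (Prog.pair Pb Prog.ident)) (Prog.seq (Prog.loop Prog.fst
        (Prog.pair (Prog.seq Prog.fst Prog.snd)
          (Prog.pair
            (Prog.seq (Prog.pair (Prog.seq Prog.snd Prog.snd)
              (Prog.pair (Prog.seq Prog.snd Prog.fst) (Prog.seq Prog.fst Prog.fst))) P)
            (Prog.seq Prog.snd Prog.snd)))) (Prog.seq Prog.snd Prog.fst)),
    kl + kb + 10 + (k + 40) * C, fun c hc => ?_⟩
  obtain ⟨tl, htl, hrl⟩ := hPl c hc
  obtain ⟨tb, htb, hrb⟩ := hPb c hc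
  obtain ⟨t, ht, hr⟩ := runs_foldl_loop (s := s) (P := P) (K := k * (B c + 1)) c (Inv c)
    (fun a r b hb => by
      obtain ⟨h1, h2, h3⟩ := hstep c a r b hc hb
      obtain ⟨t, ht, hr⟩ := hP _ h2
      exact ⟨h1, t, ht.trans (Nat.mul_le_mul_left _ (by omega)), hr⟩) (l c) _ (h0 c hc)
  refine ⟨_, ?_, Runs.seq (Runs.pair hrl (Runs.pair hrb (Runs.ident _)))
    (Runs.seq hr (Runs.seq (Runs.snd_cons _ _) (Runs.fst_cons _ _)))⟩
  have h1 : (l c).length * (k * (B c + 1) + 40) ≤ (k + 40) * C * (T c + 1) := by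
    calc (l c).length * (k * (B c + 1) + 40) ≤ (l c).length * ((k + 40) * (B c + 1)) := by
          apply Nat.mul_le_mul_left; nlinarith [Nat.zero_le (B c)]
      _ = (k + 40) * ((l c).length * (B c + 1)) := by ring
      _ ≤ (k + 40) * (C * (T c + 1)) := Nat.mul_le_mul_left _ (le_trans (Nat.le_succ _) (hC c hc))
      _ = _ := by ring
  have h2 : (kl + kb + 10 + (k + 40) * C) * (T c + 1) =
    kl * (T c + 1) + kb * (T c + 1) + 10 * (T c + 1) + (k + 40) * C * (T c + 1) := by ring
  omega

/-- Iteration of a constant-time step. -/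
theorem InTime.foldl_const {D : γ → Prop} {l : γ → List α} {b₀ : γ → β} {s : γ → β → α → β}
    {T : γ → ℕ} (hs : ConstTime (fun x : γ × β × α => s x.1 x.2.1 x.2.2))
    (hl : InTime D l T) (hb : InTime D b₀ T)
    (hB : BigO D (fun c => (l c).length) T) :
    InTime D (fun c => (l c).foldl (s c) (b₀ c)) T :=
  InTime.foldl (B := fun _ => 0) (hs.inTime (D := fun _ => True) (T := fun _ => 0)) hl hb
    (fun _ _ _ => True) (fun _ _ => trivial) (fun _ _ _ _ _ _ => ⟨trivial, trivial, le_rfl⟩)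
    (by simpa using hB)

/-- A number as a list, over which one can iterate. -/
theorem InTime.toList {D : γ → Prop} {m : γ → ℕ} {T : γ → ℕ} (h : InTime D m T) :
    InTime D (fun c => List.replicate (m c) Tree2.nil) T := by
  obtain ⟨P, k, hP⟩ := h
  exact ⟨P, k, fun c hc => by rw [enc_replicate_nil]; exact hP c hc⟩

theorem InTime.length_replicate {D : γ → Prop} {m : γ → ℕ} {T : γ → ℕ}
    (h : InTime D (fun c => List.replicate (m c) Tree2.nil) T) : InTime D m T := by
  obtain ⟨P, k, hP⟩ := h
  exact ⟨P, k, fun c hc => by rw [← enc_replicate_nil]; exact hP c hc⟩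

/-- Iteration of a function a given number of times. -/
theorem InTime.iterate {D : γ → Prop} {m : γ → ℕ} {b₀ : γ → β} {s : γ → β → β} {T : γ → ℕ}
    {E : γ × β → Prop} {V : γ × β → ℕ} {B : γ → ℕ}
    (hs : InTime E (fun x => s x.1 x.2) V)
    (hm : InTime D m T) (hb : InTime D b₀ T) (Inv : γ → ℕ → β → Prop)
    (h0 : ∀ c, D c → Inv c (m c) (b₀ c))
    (hstep : ∀ c r b, D c → Inv c (r + 1) b → Inv c r (s c b) ∧ E (c, b) ∧ V (c, b) ≤ B c)
    (hB : BigO D (fun c => m c * (B c + 1)) T) :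
    InTime D (fun c => (s c)^[m c] (b₀ c)) T := by
  have hs' : InTime (fun x : γ × β × Tree2 => E (x.1, x.2.1)) (fun x => s x.1 x.2.1)
      (fun x => V (x.1, x.2.1)) :=
    hs.comp ((constTime_fst.pair constTime_snd.fst).inTime) (fun _ h => h)
      (BigO.of_le_one fun _ _ => le_rfl)
  have := InTime.foldl (s := fun c b _ => s c b) (B := B) hs' hm.toList hb
    (fun c r b => Inv c r.length b) (fun c hc => by simpa using h0 c hc)
    (fun c a r b hc hi => hstep c _ b hc hi) (by simpa using hB)
  exact this.congr fun c _ => foldl_replicate_eq_iterate _ _ _ _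

/-! ### List functions -/

theorem InTime.reverse {D : γ → Prop} {l : γ → List α} {T : γ → ℕ} (hl : InTime D l T)
    (hT : BigO D (fun c => (l c).length) T) : InTime D (fun c => (l c).reverse) T := by
  have := InTime.foldl_const (s := fun (_ : γ) (r : List α) a => a :: r) (b₀ := fun _ => [])
    (constTime_snd.snd.cons constTime_snd.fst) hl (constTime_const _).inTime hT
  exact this.congr fun c _ => by rw [foldl_cons_eq, List.append_nil]

theorem InTime.append {D : γ → Prop} {l r : γ → List α} {T : γ → ℕ} (hl : InTime D l T)
    (hr : InTime D r T) (hT : BigO D (fun c => (l c).length) T) :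
    InTime D (fun c => l c ++ r c) T := by
  have := InTime.foldl_const (s := fun (_ : γ) (r : List α) a => a :: r)
    (constTime_snd.snd.cons constTime_snd.fst) (hl.reverse hT) hr (by simpa using hT)
  exact this.congr fun c _ => by rw [foldl_cons_eq, List.reverse_reverse]

theorem InTime.map {D : γ → Prop} {l : γ → List α} {f : γ → α → β} {T : γ → ℕ}
    {E : γ × α → Prop} {V : γ × α → ℕ} {B : γ → ℕ} (hf : InTime E (fun x => f x.1 x.2) V)
    (hl : InTime D l T)
    (hstep : ∀ c, D c → ∀ a ∈ l c, E (c, a) ∧ V (c, a) ≤ B c)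
    (hB : BigO D (fun c => (l c).length * (B c + 1)) T) :
    InTime D (fun c => (l c).map (f c)) T := by
  have hs : InTime (fun x : γ × List β × α => E (x.1, x.2.2)) (fun x => f x.1 x.2.2 :: x.2.1)
      (fun x => V (x.1, x.2.2)) := by
    have h1 : InTime (fun x : γ × List β × α => E (x.1, x.2.2)) (fun x => f x.1 x.2.2)
        (fun x => V (x.1, x.2.2)) :=
      hf.comp ((constTime_fst.pair constTime_snd.snd).inTime) (fun _ h => h)
        (BigO.of_le_one fun _ _ => le_rfl)
    have h2 : ConstTime (fun x : β × List β => x.1 :: x.2) := constTime_fst.cons constTime_snd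
    exact h2.compIn (h1.pair constTime_snd.fst.inTime)
  have h1 := InTime.foldl (s := fun c r a => f c a :: r) (b₀ := fun _ => []) (B := B) hs hl
    (constTime_const _).inTime (fun c r _ => ∀ a ∈ r, E (c, a) ∧ V (c, a) ≤ B c)
    (fun c hc => hstep c hc)
    (fun c a r b _ hi => ⟨fun x hx => hi x (List.mem_cons_of_mem _ hx), hi a List.mem_cons_self⟩)
    hB
  have h2 : InTime D (fun c => ((l c).map (f c)).reverse) T :=
    h1.congr fun c _ => by rw [foldl_map_eq, List.append_nil]
  have h3 := h2.reverse (by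
    obtain ⟨C, hC⟩ := hB
    exact ⟨C, fun a ha => le_trans (by simp; nlinarith) (hC a ha)⟩)
  exact h3.congr fun c _ => List.reverse_reverse _

theorem InTime.map_const {D : γ → Prop} {l : γ → List α} {f : γ → α → β} {T : γ → ℕ}
    (hf : ConstTime (fun x : γ × α => f x.1 x.2)) (hl : InTime D l T)
    (hB : BigO D (fun c => (l c).length) T) : InTime D (fun c => (l c).map (f c)) T :=
  InTime.map (B := fun _ => 0) (hf.inTime (D := fun _ => True) (T := fun _ => 0)) hl
    (fun _ _ _ _ => ⟨trivial, le_rfl⟩) (by simpa using hB)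

theorem InTime.length {D : γ → Prop} {l : γ → List α} {T : γ → ℕ} (hl : InTime D l T)
    (hB : BigO D (fun c => (l c).length) T) : InTime D (fun c => (l c).length) T :=
  InTime.length_replicate ((hl.map_const (f := fun _ _ => Tree2.nil) (constTime_const _) hB).congr
    fun c _ => by simp)

theorem InTime.add {D : γ → Prop} {a b : γ → ℕ} {T : γ → ℕ} (ha : InTime D a T) (hb : InTime D b T)
    (hT : BigO D a T) : InTime D (fun c => a c + b c) T := by
  have := (ha.toList.append hb.toList (by simpa using hT)).congr
    (g := fun c => List.replicate (a c + b c) Tree2.nil) fun c _ => by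
      rw [List.replicate_append_replicate]
  exact this.length_replicate

theorem InTime.mul {D : γ → Prop} {a b : γ → ℕ} {T : γ → ℕ} (ha : InTime D a T) (hb : InTime D b T)
    (hT : BigO D (fun c => a c * (b c + 1)) T) : InTime D (fun c => a c * b c) T := by
  have hs : InTime (fun _ : (γ × ℕ) × ℕ => True) (fun x => x.1.2 + x.2) (fun x => x.1.2) :=
    InTime.add (constTime_fst.snd.inTime) constTime_snd.inTime (BigO.of_le_one fun _ _ => le_rfl)
  -- Multiplication is repeated addition. The context is enlarged by the value of `b`, which is thus
  -- computed once and not in every round.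
  have h := InTime.iterate (γ := γ × ℕ) (D := fun x => D x.1 ∧ x.2 = b x.1)
    (m := fun x => a x.1) (b₀ := fun _ => 0) (s := fun x m => x.2 + m) (T := fun x => T x.1)
    (B := fun x => b x.1) hs
    (ha.comp constTime_fst.inTime (fun _ h => h.1) (BigO.of_le_one fun _ _ => le_rfl))
    (constTime_const _).inTime (fun _ _ _ => True) (fun _ _ => trivial)
    (fun c r m hc _ => ⟨trivial, trivial, hc.2.le⟩)
    (by obtain ⟨C, hC⟩ := hT; exact ⟨C, fun x hx => hC _ hx.1⟩)
  have h2 := h.comp (f := fun c => (c, b c)) (D := D) (T := T) (constTime_id.inTime.pair hb)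
    (fun c hc => ⟨hc, rfl⟩) (BigO.of_le_one fun _ _ => le_rfl)
  refine h2.congr fun c _ => ?_
  show (fun m => b c + m)^[a c] 0 = a c * b c
  generalize a c = m
  induction m with
  | zero => simp
  | succ m ih => rw [Function.iterate_succ_apply', ih]; ring

/-- Comparison of two numbers. -/
theorem InTime.lt {D : γ → Prop} {a b : γ → ℕ} {T : γ → ℕ} (ha : InTime D a T) (hb : InTime D b T)
    (hT : BigO D a T) : InTime D (fun c => decide (a c < b c)) T := by
  have h := InTime.iterate (b₀ := b) (s := fun (_ : γ) m => m - 1) (B := fun _ => 0)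
    (V := fun _ => 0)
    (E := fun _ => True) ((constTime_pred.comp constTime_snd).inTime) ha hb (fun _ _ _ => True)
    (fun _ _ => trivial) (fun _ _ _ _ _ => ⟨trivial, trivial, le_rfl⟩) (by simpa using hT)
  refine (constTime_isPos.compIn h).congr fun c _ => ?_
  have : ∀ m k : ℕ, (fun m => m - 1)^[m] k = k - m := by
    intro m
    induction m with
    | zero => simp
    | succ m ih => intro k; rw [Function.iterate_succ_apply, ih]; omega
  rw [this]
  simp

end InTimeRules

/-! ## Adaptive measurements of self-adjoint involutions

A state is described by a real functional `f` on a monoid with a sign; measuring `P` with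
outcome `+1` turns `f` into `afterMeas f P`, and `-P` stands for the outcome `-1`. -/

section Abstract

set_option linter.unusedSectionVars false

variable {M : Type} [Monoid M] [HasDistribNeg M]

/-- The unnormalized functional after a measurement of `P` with outcome `+1`. -/
noncomputable def afterMeas (f : M → ℝ) (P : M) : M → ℝ := fun g =>
  (f g + f (P * g) + f (g * P) + f (P * g * P)) / 4

/-- The total weight of the outcome sequences of length `j` that are accepted by `O`, when the
operators are chosen by `W` from the outcomes obtained so far. -/
noncomputable def adaptive (W : List Bool → M) (O : List Bool → Bool) :
    ℕ → (M → ℝ) → List Bool → ℝ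
  | 0, f, h => if O h then f 1 else 0
  | j + 1, f, h => adaptive W O j (afterMeas f (W h)) (h ++ [false]) +
      adaptive W O j (afterMeas f (-W h)) (h ++ [true])

theorem afterMeas_add (f f' : M → ℝ) (P : M) :
    afterMeas (f + f') P = afterMeas f P + afterMeas f' P := by
  funext g; simp only [afterMeas, Pi.add_apply]; ring

theorem afterMeas_smul (c : ℝ) (f : M → ℝ) (P : M) : afterMeas (c • f) P = c • afterMeas f P := by
  funext g; simp only [afterMeas, Pi.smul_apply, smul_eq_mul]; ring

/-- Linearity in the functional is what allows a signed mixture of stabilizer states to replace the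
magic state inside an adaptive computation. -/
theorem adaptive_add (W : List Bool → M) (O : List Bool → Bool) (j : ℕ) (f f' : M → ℝ)
    (h : List Bool) : adaptive W O j (f + f') h = adaptive W O j f h + adaptive W O j f' h := by
  induction j generalizing f f' h with
  | zero => simp only [adaptive, Pi.add_apply]; split <;> simp
  | succ j ih => simp only [adaptive, afterMeas_add, ih]; ring

theorem adaptive_smul (W : List Bool → M) (O : List Bool → Bool) (j : ℕ) (c : ℝ) (f : M → ℝ)
    (h : List Bool) : adaptive W O j (c • f) h = c * adaptive W O j f h := by
  induction j generalizing f h with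
  | zero => simp only [adaptive, Pi.smul_apply, smul_eq_mul]; split <;> simp
  | succ j ih => simp only [adaptive, afterMeas_smul, ih]; ring

/-- A crude bound of the total weight by a bound of the functional. -/
theorem abs_adaptive_le (W : List Bool → M) (O : List Bool → Bool) (j : ℕ) (f : M → ℝ)
    (h : List Bool) {ε : ℝ} (hf : ∀ g, |f g| ≤ ε) : |adaptive W O j f h| ≤ 2 ^ j * ε := by
  have hε : 0 ≤ ε := (abs_nonneg _).trans (hf 1)
  -- A measurement takes the average of four values of the functional, so it preserves sup bounds;
  -- the factor `2 ^ j` is the number of branches.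
  have hm : ∀ (f : M → ℝ) (P : M), (∀ g, |f g| ≤ ε) → ∀ g, |afterMeas f P g| ≤ ε := by
    intro f P hf g
    have h1 := abs_le.1 (hf g)
    have h2 := abs_le.1 (hf (P * g))
    have h3 := abs_le.1 (hf (g * P))
    have h4 := abs_le.1 (hf (P * g * P))
    rw [afterMeas, abs_le]
    constructor <;> linarith
  induction j generalizing f h with
  | zero => simp only [adaptive]; split <;> simp [hf, hε]
  | succ j ih =>
    have h1 := abs_le.1 (ih (afterMeas f (W h)) (h ++ [false]) (hm _ _ hf))
    have h2 := abs_le.1 (ih (afterMeas f (-W h)) (h ++ [true]) (hm _ _ hf))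
    rw [adaptive, abs_le, pow_succ]
    constructor <;> linarith

/-! ### Conjugation by the Clifford operators `(A + B) / √2` -/

/-- Multiplication by `P` on either side multiplies `f` by `s`. -/
def IsEigen (f : M → ℝ) (P : M) (s : ℝ) : Prop := ∀ g, f (P * g) = s * f g ∧ f (g * P) = s * f g

/-- The functional obtained from `f` by conjugation with the operators `(A + B) / √2`, for the
pairs `(A, B)` of a list. -/
noncomputable def conjugated : List (M × M) → (M → ℝ) → M → ℝ
  | [], f => f
  | V :: U, f => fun g =>
      (conjugated U f (V.1 * g * V.1) + conjugated U f (V.1 * g * V.2) +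
        conjugated U f (V.2 * g * V.1) + conjugated U f (V.2 * g * V.2)) / 2

/-- `Q` is the image of `P` under conjugation with `(A + B) / √2`, where `V = (A, B)`. -/
def Intertwines (V : M × M) (P Q : M) : Prop :=
  (Q * V.1 = V.1 * P ∧ Q * V.2 = V.2 * P ∧ V.1 * Q = P * V.1 ∧ V.2 * Q = P * V.2) ∨
  (Q * V.1 = V.2 * P ∧ Q * V.2 = V.1 * P ∧ V.1 * Q = P * V.2 ∧ V.2 * Q = P * V.1)

/-- `Q` is the image of `P` under the conjugations of a list. -/
def IntertwinesList : List (M × M) → M → M → Prop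
  | [], P, Q => P = Q
  | V :: U, P, Q => ∃ R, Intertwines V P R ∧ IntertwinesList U R Q

theorem Intertwines.neg {V : M × M} {P Q : M} (h : Intertwines V P Q) :
    Intertwines V (-P) (-Q) := by
  rcases h with ⟨h1, h2, h3, h4⟩ | ⟨h1, h2, h3, h4⟩
  · left; simp [h1, h2, h3, h4]
  · right; simp [h1, h2, h3, h4]

theorem IntertwinesList.neg {U : List (M × M)} {P Q : M} (h : IntertwinesList U P Q) :
    IntertwinesList U (-P) (-Q) := by
  induction U generalizing P with
  | nil => exact congrArg _ h
  | cons V U ih =>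
    obtain ⟨R, h1, h2⟩ := h
    exact ⟨-R, h1.neg, ih h2⟩

/-- With `C = (A + B) / √2` one has `Q C = C P` and `C Q = P C`, so `P` can be moved through `C`
until it meets the state as `Q`. A monoid has no sums, so the identity is checked on the four terms;
the second kind of `Intertwines` merely permutes them. -/
theorem IntertwinesList.isEigen {U : List (M × M)} {f : M → ℝ} {P Q : M} {s : ℝ}
    (h : IntertwinesList U P Q) (hf : IsEigen f Q s) : IsEigen (conjugated U f) P s := by
  induction U generalizing P with
  | nil =>
    have : P = Q := h
    rw [this]; exact hf
  | cons V U ih =>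
    obtain ⟨R, h1, h2⟩ := h
    have hR := ih h2
    intro g
    simp only [conjugated]
    rcases h1 with ⟨k1, k2, k3, k4⟩ | ⟨k1, k2, k3, k4⟩
    · constructor
      · rw [← mul_assoc V.1 P g, ← mul_assoc V.2 P g, ← k1, ← k2]
        simp only [mul_assoc R]
        simp only [(hR _).1]; ring
      · simp only [← mul_assoc]
        simp only [mul_assoc _ P, ← k3, ← k4]
        simp only [← mul_assoc, (hR _).2]; ring
    · constructor
      · rw [← mul_assoc V.1 P g, ← mul_assoc V.2 P g, ← k1, ← k2]
        simp only [mul_assoc R]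
        simp only [(hR _).1]; ring
      · simp only [← mul_assoc]
        simp only [mul_assoc _ P, ← k3, ← k4]
        simp only [← mul_assoc, (hR _).2]; ring

/-- The projection `(1 + P) / 2` becomes `(1 + Q) / 2` next to the state; there `1` may be replaced
by the stabilizer `G`, which gives `(G + Q) / 2`, i.e. the conjugation by `(G + Q) / √2` with the
probability `1/2` split off. The new pair stands at the end of the list because it acts directly on
the state. -/
theorem IntertwinesList.afterMeas_eq {U : List (M × M)} {f : M → ℝ} {P Q G : M}
    (h : IntertwinesList U P Q) (hf : IsEigen f G 1) :
    afterMeas (conjugated U f) P = (1 / 2 : ℝ) • conjugated (U ++ [(G, Q)]) f := by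
  induction U generalizing P with
  | nil =>
    have : P = Q := h
    funext g
    have e1 : ∀ x, f (G * x) = f x := fun x => by simpa using (hf x).1
    have e2 : ∀ x, f (x * G) = f x := fun x => by simpa using (hf x).2
    simp only [afterMeas, conjugated, List.nil_append, Pi.smul_apply, smul_eq_mul, this, e2]
    rw [mul_assoc G, e1, e1]
    ring
  | cons V U ih =>
    obtain ⟨R, h1, h2⟩ := h
    have hR := ih h2
    funext g
    have hR' : ∀ x, conjugated (U ++ [(G, Q)]) f x =
        2 * afterMeas (conjugated U f) R x := fun x => by
      rw [hR]; simp
    simp only [List.cons_append, conjugated, Pi.smul_apply, smul_eq_mul, hR', afterMeas]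
    rcases h1 with ⟨k1, k2, k3, k4⟩ | ⟨k1, k2, k3, k4⟩
    · simp only [← mul_assoc, k1, k2]
      simp only [mul_assoc, k3, k4]
      ring
    · simp only [← mul_assoc, k1, k2]
      simp only [mul_assoc, k3, k4]
      ring

/-- For `s = 1` and `s = -1` the factor is `1` and `0`: the outcome is certain and the state does
not change. -/
theorem afterMeas_of_isEigen {f : M → ℝ} {P : M} {s : ℝ} (h : IsEigen f P s) :
    afterMeas f P = ((1 + s) ^ 2 / 4) • f := by
  funext g
  simp only [afterMeas, Pi.smul_apply, smul_eq_mul, (h _).1, (h _).2]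
  ring

theorem IsEigen.neg {f : M → ℝ} (hf : ∀ g, f (-g) = -f g) {P : M} {s : ℝ} (h : IsEigen f P s) :
    IsEigen f (-P) (-s) := by
  intro g
  rw [neg_mul, mul_neg, hf, hf, (h g).1, (h g).2]
  constructor <;> ring

/-- This is the unitarity of `(A + B) / √2`: the cross terms at `1` cancel because `A` and `B`
anticommute. The cancellation needs that the functional is odd, whence the joint induction. -/
theorem conjugated_one {U : List (M × M)} {f : M → ℝ} (hf : ∀ g, f (-g) = -f g)
    (hU : ∀ V ∈ U, V.1 * V.1 = 1 ∧ V.2 * V.2 = 1 ∧ V.1 * V.2 = -(V.2 * V.1)) :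
    conjugated U f 1 = f 1 ∧ ∀ g, conjugated U f (-g) = -conjugated U f g := by
  induction U with
  | nil => exact ⟨rfl, hf⟩
  | cons V U ih =>
    obtain ⟨h1, h2⟩ := ih fun V hV => hU V (List.mem_cons_of_mem _ hV)
    obtain ⟨k1, k2, k3⟩ := hU V List.mem_cons_self
    constructor
    · simp only [conjugated, mul_one, k1, k2, k3, h2, h1]; ring
    · intro g
      simp only [conjugated, mul_neg, neg_mul, h2]; ring

theorem intertwines_self {A B P : M} (hA : A * P = P * A) (hB : B * P = P * B) :
    Intertwines (A, B) P P :=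
  Or.inl ⟨hA.symm, hB.symm, hA, hB⟩

theorem intertwines_neg {A B P : M} (hA : A * P = -(P * A)) (hB : B * P = -(P * B)) :
    Intertwines (A, B) P (-P) :=
  Or.inl ⟨by simp [hA], by simp [hB], by simp [hA], by simp [hB]⟩

/-- `(A + B) P (A + B) / 2 = P (A - B) (A + B) / 2 = P A B`, because the squares cancel and `-B A =
A B`. -/
theorem intertwines_mul {A B P : M} (hA : A * P = P * A) (hB : B * P = -(P * B)) (hAA : A * A = 1)
    (hBB : B * B = 1) (hAB : A * B = -(B * A)) : Intertwines (A, B) P (P * A * B) := by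
  refine Or.inr ⟨?_, ?_, ?_, ?_⟩
  · show P * A * B * A = B * P
    rw [mul_assoc P, hAB, mul_neg, neg_mul, mul_assoc P, mul_assoc B, hAA, mul_one, hB]
  · show P * A * B * B = A * P
    rw [mul_assoc, hBB, mul_one, hA]
  · show A * (P * A * B) = P * B
    rw [← mul_assoc, ← mul_assoc, hA, mul_assoc P, hAA, mul_one]
  · show B * (P * A * B) = P * A
    rw [← mul_assoc, ← mul_assoc, hB, neg_mul, neg_mul, mul_assoc, mul_assoc, hAB, mul_neg,
      ← mul_assoc B, hBB, one_mul, mul_neg, neg_neg]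

theorem intertwines_mul' {A B P : M} (hA : A * P = -(P * A)) (hB : B * P = P * B) (hAA : A * A = 1)
    (hBB : B * B = 1) (hAB : A * B = -(B * A)) : Intertwines (A, B) P (P * B * A) := by
  have h := intertwines_mul (A := B) (B := A) hB hA hBB hAA (by rw [hAB, neg_neg])
  rcases h with ⟨h1, h2, h3, h4⟩ | ⟨h1, h2, h3, h4⟩
  · exact Or.inl ⟨h2, h1, h4, h3⟩
  · exact Or.inr ⟨h2, h1, h4, h3⟩

/-- Conjugates of involutions are involutions; this keeps the hypothesis on `P` alive along a list
of conjugations. -/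
theorem mul_self_of_conj {A B P : M} (hA : A * P = P * A) (hB : B * P = -(P * B)) (hAA : A * A = 1)
    (hBB : B * B = 1) (hAB : A * B = -(B * A)) (hP : P * P = 1) :
    (P * A * B) * (P * A * B) = 1 := by
  have h : B * (P * A * B) = P * A := by
    rw [← mul_assoc, ← mul_assoc, hB, neg_mul, neg_mul, mul_assoc, mul_assoc, hAB, mul_neg,
      ← mul_assoc B, hBB, one_mul, mul_neg, neg_neg]
  rw [mul_assoc, h, mul_assoc, ← mul_assoc A, hA, mul_assoc P A A, hAA, mul_one, hP]

end Abstract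

/-! ## Pauli words

The pair `(x, z)` of bits stands for the matrix `X ^ x * Z ^ z`, and `(e, s, w)` for the tensor
product of the letters of `w`, multiplied by `i ^ e * (-1) ^ s`. -/

/-- Single-qubit letters `X ^ x * Z ^ z`. -/
abbrev Letter : Type := Bool × Bool

/-- Pauli words with a phase. -/
abbrev PauliWord : Type := Bool × Bool × List Letter

def letterMul (a b : Letter) : Letter := (a.1 ^^ b.1, a.2 ^^ b.2)

/-- The sign bit that appears in the product of two words. -/
def cocycle : List Letter → List Letter → Bool
  | a :: u, b :: v => (a.2 && b.1) ^^ cocycle u v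
  | _, _ => false

def wordMul (u v : List Letter) : List Letter := List.zipWith letterMul u v

def pauliMul (P Q : PauliWord) : PauliWord :=
  (P.1 ^^ Q.1, (P.2.1 ^^ Q.2.1 ^^ (P.1 && Q.1) ^^ cocycle P.2.2 Q.2.2), wordMul P.2.2 Q.2.2)

def pauliNeg (P : PauliWord) : PauliWord := (P.1, !P.2.1, P.2.2)

def trivialWord (N : ℕ) : List Letter := List.replicate N (false, false)

/-- The words `P` and `Q` anticommute. -/
def anticommute (P Q : PauliWord) : Bool := (pauliMul P Q).2.1 ^^ (pauliMul Q P).2.1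

theorem letterMul_assoc (a b c : Letter) :
    letterMul (letterMul a b) c = letterMul a (letterMul b c) := by
  simp [letterMul]

theorem wordMul_length {N : ℕ} {u v : List Letter} (hu : u.length = N) (hv : v.length = N) :
    (wordMul u v).length = N := by
  simp [wordMul, hu, hv]

theorem wordMul_assoc (u v w : List Letter) :
    wordMul (wordMul u v) w = wordMul u (wordMul v w) := by
  induction u generalizing v w with
  | nil => simp [wordMul]
  | cons a u ih =>
    cases v with
    | nil => simp [wordMul]
    | cons b v =>
      cases w with
      | nil => simp [wordMul]
      | cons c w =>
        simp only [wordMul, List.zipWith_cons_cons] at ih ⊢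
        rw [ih, letterMul_assoc]

theorem wordMul_comm (u v : List Letter) : wordMul u v = wordMul v u := by
  rw [wordMul, List.zipWith_comm]
  congr 1
  funext a b
  simp [letterMul, Bool.xor_comm]

/-- The 2-cocycle identity, which amounts to associativity of `pauliMul`. It splits into one check
on six bits per position. -/
theorem cocycle_assoc {u v w : List Letter} (h : u.length = v.length) (h' : v.length = w.length) :
    (cocycle u v ^^ cocycle (wordMul u v) w) = (cocycle v w ^^ cocycle u (wordMul v w)) := by
  induction u generalizing v w with
  | nil =>
    cases v with
    | nil => cases w <;> rfl
    | cons b v => simp at h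
  | cons a u ih =>
    cases v with
    | nil => simp at h
    | cons b v =>
      cases w with
      | nil => simp at h'
      | cons c w =>
        have := ih (v := v) (w := w) (by simpa using h) (by simpa using h')
        simp only [cocycle, wordMul, List.zipWith_cons_cons, letterMul] at this ⊢
        revert this
        generalize cocycle u v = p
        generalize cocycle (List.zipWith letterMul u v) w = q
        generalize cocycle v w = r
        generalize cocycle u (List.zipWith letterMul v w) = s
        revert p q r s
        clear ih h h'
        obtain ⟨a1, a2⟩ := a
        obtain ⟨b1, b2⟩ := b
        obtain ⟨c1, c2⟩ := c
        revert a1 a2 b1 b2 c1 c2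
        decide

theorem trivialWord_mul (w : List Letter) : wordMul (trivialWord w.length) w = w := by
  induction w with
  | nil => rfl
  | cons a w ih =>
    simp only [wordMul, trivialWord, List.length_cons, List.replicate_succ,
      List.zipWith_cons_cons] at ih ⊢
    rw [ih]; simp [letterMul]

theorem cocycle_trivialWord (N : ℕ) (w : List Letter) :
    cocycle (trivialWord N) w = false ∧ cocycle w (trivialWord N) = false := by
  induction N generalizing w with
  | zero => cases w <;> exact ⟨rfl, rfl⟩
  | succ N ih =>
    cases w with
    | nil => exact ⟨rfl, rfl⟩
    | cons a w =>
      have := ih w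
      simp only [trivialWord] at this
      simp [trivialWord, List.replicate_succ, cocycle, this]

theorem wordMul_self (w : List Letter) : wordMul w w = trivialWord w.length := by
  induction w with
  | nil => rfl
  | cons a w ih =>
    simp only [wordMul, trivialWord, List.length_cons, List.replicate_succ,
      List.zipWith_cons_cons] at ih ⊢
    rw [ih]; simp [letterMul]

/-- Pauli words of length `N`. -/
abbrev PauliWordOn (N : ℕ) : Type := {P : PauliWord // P.2.2.length = N}

namespace PauliWordOn

variable {N : ℕ}

/-- The length is fixed because `zipWith` truncates, so that lists of arbitrary length have no
common unit. -/
instance : Monoid (PauliWordOn N) where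
  mul P Q := ⟨pauliMul P.1 Q.1, wordMul_length P.2 Q.2⟩
  one := ⟨(false, false, trivialWord N), by simp [trivialWord]⟩
  mul_assoc P Q R := by
    apply Subtype.ext
    show pauliMul (pauliMul P.1 Q.1) R.1 = pauliMul P.1 (pauliMul Q.1 R.1)
    have h := cocycle_assoc (u := P.1.2.2) (v := Q.1.2.2) (w := R.1.2.2) (P.2.trans Q.2.symm)
      (Q.2.trans R.2.symm)
    obtain ⟨⟨e, s, u⟩, hu⟩ := P
    obtain ⟨⟨e', s', v⟩, hv⟩ := Q
    obtain ⟨⟨e'', s'', w⟩, hw⟩ := R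
    simp only [pauliMul, Prod.mk.injEq, wordMul_assoc, and_true] at h ⊢
    revert h
    generalize cocycle u v = p
    generalize cocycle (wordMul u v) w = q
    generalize cocycle v w = r
    generalize cocycle u (wordMul v w) = t
    clear hu hv hw
    revert p q r t e s e' s' e'' s''
    decide
  one_mul P := by
    apply Subtype.ext
    show pauliMul (false, false, trivialWord N) P.1 = P.1
    obtain ⟨⟨e, s, w⟩, rfl⟩ := P
    simp [pauliMul, cocycle_trivialWord, trivialWord_mul]
  mul_one P := by
    apply Subtype.ext
    show pauliMul P.1 (false, false, trivialWord N) = P.1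
    obtain ⟨⟨e, s, w⟩, rfl⟩ := P
    simp [pauliMul, cocycle_trivialWord, wordMul_comm w, trivialWord_mul]

instance : HasDistribNeg (PauliWordOn N) where
  neg P := ⟨pauliNeg P.1, P.2⟩
  neg_neg P := by
    apply Subtype.ext
    show pauliNeg (pauliNeg P.1) = P.1
    simp [pauliNeg]
  neg_mul P Q := by
    apply Subtype.ext
    show pauliMul (pauliNeg P.1) Q.1 = pauliNeg (pauliMul P.1 Q.1)
    simp [pauliNeg, pauliMul]
  mul_neg P Q := by
    apply Subtype.ext
    show pauliMul P.1 (pauliNeg Q.1) = pauliNeg (pauliMul P.1 Q.1)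
    simp [pauliNeg, pauliMul]

theorem val_mul (P Q : PauliWordOn N) : (P * Q).1 = pauliMul P.1 Q.1 := rfl
theorem val_neg (P : PauliWordOn N) : (-P).1 = pauliNeg P.1 := rfl
theorem val_one : (1 : PauliWordOn N).1 = (false, false, trivialWord N) := rfl

theorem mul_comm_of_not_anticommute {P Q : PauliWordOn N} (h : anticommute P.1 Q.1 = false) :
    Q * P = P * Q := by
  apply Subtype.ext
  rw [val_mul, val_mul]
  simp only [anticommute, bne_eq_false_iff_eq] at h
  refine Prod.ext ?_ (Prod.ext h.symm ?_)
  · simp [pauliMul, Bool.xor_comm]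
  · simp [pauliMul, wordMul_comm]

theorem mul_eq_neg_of_anticommute {P Q : PauliWordOn N} (h : anticommute P.1 Q.1 = true) :
    Q * P = -(P * Q) := by
  apply Subtype.ext
  rw [val_neg, val_mul, val_mul]
  simp only [anticommute] at h
  refine Prod.ext ?_ (Prod.ext ?_ ?_)
  · simp [pauliMul, pauliNeg, Bool.xor_comm]
  · show (pauliMul Q.1 P.1).2.1 = !(pauliMul P.1 Q.1).2.1
    revert h
    cases (pauliMul Q.1 P.1).2.1 <;> cases (pauliMul P.1 Q.1).2.1 <;> decide
  · simp [pauliMul, pauliNeg, wordMul_comm]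

/-- The square of `i ^ e * (-1) ^ s * w` is `(-1) ^ e` times the sign `cocycle w w`. As words are
unitary, these are the self-adjoint words. -/
theorem mul_self_eq_one_iff (P : PauliWordOn N) :
    P * P = 1 ↔ P.1.1 = cocycle P.1.2.2 P.1.2.2 := by
  rw [Subtype.ext_iff, val_mul, val_one]
  obtain ⟨⟨e, s, w⟩, rfl⟩ := P
  simp only [pauliMul, wordMul_self, Prod.mk.injEq, and_true]
  cases e <;> cases s <;> cases cocycle w w <;> decide

end PauliWordOn

/-! ### Conjugating Pauli words by pairs of anticommuting words -/

/-- The conjugate of the word `P` under `(A + B) / √2`, where `V = (A, B)`. -/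
def pauliConj (P : PauliWord) (V : PauliWord × PauliWord) : PauliWord :=
  bif anticommute P V.1 then
    (bif anticommute P V.2 then pauliNeg P else pauliMul (pauliMul P V.2) V.1)
  else (bif anticommute P V.2 then pauliMul (pauliMul P V.1) V.2 else P)

/-- A pair of anticommuting self-adjoint words. -/
def IsGoodPair {N : ℕ} (V : PauliWordOn N × PauliWordOn N) : Prop :=
  V.1 * V.1 = 1 ∧ V.2 * V.2 = 1 ∧ V.1 * V.2 = -(V.2 * V.1)

/-- Forget that the words have length `N`. -/
def pairVal {N : ℕ} (V : PauliWordOn N × PauliWordOn N) : PauliWord × PauliWord := (V.1.1, V.2.1)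

/-- Two words either commute or anticommute, so there are four cases; in each of them the conjugate
is again a single word. -/
theorem exists_intertwines {N : ℕ} {V : PauliWordOn N × PauliWordOn N} (hV : IsGoodPair V)
    {P : PauliWordOn N} (hP : P * P = 1) :
    ∃ Q : PauliWordOn N, Q.1 = pauliConj P.1 (pairVal V) ∧ Q * Q = 1 ∧ Intertwines V P Q := by
  obtain ⟨A, B⟩ := V
  obtain ⟨h1, h2, h3⟩ := hV
  simp only [pauliConj, pairVal]
  cases hA : anticommute P.1 A.1 <;> cases hB : anticommute P.1 B.1
  · have kA := PauliWordOn.mul_comm_of_not_anticommute hA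
    have kB := PauliWordOn.mul_comm_of_not_anticommute hB
    exact ⟨P, rfl, hP, intertwines_self kA kB⟩
  · have kA := PauliWordOn.mul_comm_of_not_anticommute hA
    have kB := PauliWordOn.mul_eq_neg_of_anticommute hB
    exact ⟨P * A * B, rfl, mul_self_of_conj kA kB h1 h2 h3 hP, intertwines_mul kA kB h1 h2 h3⟩
  · have kA := PauliWordOn.mul_eq_neg_of_anticommute hA
    have kB := PauliWordOn.mul_comm_of_not_anticommute hB
    exact ⟨P * B * A, rfl, mul_self_of_conj kB kA h2 h1 (by simp only at h3; rw [h3, neg_neg]) hP,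
      intertwines_mul' kA kB h1 h2 h3⟩
  · have kA := PauliWordOn.mul_eq_neg_of_anticommute hA
    have kB := PauliWordOn.mul_eq_neg_of_anticommute hB
    exact ⟨-P, rfl, by simpa using hP, intertwines_neg kA kB⟩

theorem exists_intertwinesList {N : ℕ} {U : List (PauliWordOn N × PauliWordOn N)}
    (hU : ∀ V ∈ U, IsGoodPair V) {P : PauliWordOn N} (hP : P * P = 1) :
    ∃ Q : PauliWordOn N, Q.1 = (U.map pairVal).foldl pauliConj P.1 ∧ Q * Q = 1 ∧
      IntertwinesList U P Q := by
  induction U generalizing P with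
  | nil => exact ⟨P, rfl, hP, rfl⟩
  | cons V U ih =>
    obtain ⟨R, hR, hR1, hR2⟩ := exists_intertwines (hU V List.mem_cons_self) hP
    obtain ⟨Q, hQ, hQ1, hQ2⟩ := ih (fun V hV => hU V (List.mem_cons_of_mem _ hV)) hR1
    exact ⟨Q, by rw [hQ, hR]; rfl, hQ1, R, hR2, hQ2⟩

/-! ### Products of two-qubit stabilizer states -/

/-- Codes of two-qubit stabilizer states: `(false, u, v)` is the product of two states, each of
them the positive eigenstate of `X` or `Z`; `(true, c, s)` is the Bell state stabilized by
`± X ⊗ X` and `± Z ⊗ Z`, or by `± X ⊗ Z` and `± Z ⊗ X`. -/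
abbrev PairState : Type := Bool × Bool × Bool

/-- The expectation of `a ⊗ b`: whether it is nonzero, and whether it is negative. -/
def pairExp (s : PairState) (a b : Letter) : Bool × Bool :=
  bif s.1 then
    (bif s.2.1 then a.1 == b.2 && a.2 == b.1 else a.1 == b.1 && a.2 == b.2,
      bif a.1 then (bif a.2 then s.2.1 else s.2.2) else (bif a.2 then s.2.2 else false))
  else (!(bif s.2.1 then a.2 else a.1) && !(bif s.2.2 then b.2 else b.1), false)

/-- A stabilizer of the state that anticommutes with `a ⊗ b`, if there is one: its sign and its
letters. -/
def pairGen (s : PairState) (a b : Letter) : Bool × Letter × Letter :=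
  bif s.1 then
    (bif (bif s.2.1 then a.2 ^^ b.1 else a.2 ^^ b.2) then
      (s.2.2, (true, false), (!s.2.1, s.2.1))
    else (s.2.2, (false, true), (s.2.1, !s.2.1)))
  else
    (bif (bif s.2.1 then a.2 else a.1) then (false, (s.2.1, !s.2.1), (false, false))
    else (false, (false, false), (s.2.2, !s.2.2)))

/-- The value `0`, `1` or `-1`. -/
def signVal (e : Bool × Bool) : ℝ := if e.1 then (if e.2 then -1 else 1) else 0

/-- The expectation of a word in a product of two-qubit states. -/
def wordExp : List PairState → List Letter → ℝ
  | s :: S, a :: b :: w => signVal (pairExp s a b) * wordExp S w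
  | _, _ => 1

/-- The real part of the expectation of a word with a phase. -/
def pauliExp (S : List PairState) (P : PauliWord) : ℝ :=
  if P.1 then 0 else (if P.2.1 then -1 else 1) * wordExp S P.2.2

/-- Look for a stabilizer that anticommutes with the word: whether there is one, its sign and its
letters; if there is none, then the sign is the one of the expectation of the word. -/
def probe : List PairState → List Letter → Bool × Bool × List Letter
  | s :: S, a :: b :: w =>
    let r := probe S w
    bif r.1 then (true, r.2.1, (false, false) :: (false, false) :: r.2.2)
    else bif (pairExp s a b).1 then
      (false, (r.2.1 ^^ (pairExp s a b).2), (false, false) :: (false, false) :: r.2.2)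
    else
      (true, (pairGen s a b).1, (pairGen s a b).2.1 :: (pairGen s a b).2.2 :: r.2.2)
  | _, _ => (false, false, [])

/-- A word with nonzero expectation stabilizes the state up to sign, so multiplication by it changes
other expectations by a sign only. If `c ⊗ d` has expectation zero, the sign bit has no meaning, and
the formula just repeats it. -/
theorem pairExp_mul (s : PairState) (a b c d : Letter) (h : (pairExp s a b).1 = true) :
    pairExp s (letterMul a c) (letterMul b d) =
      ((pairExp s c d).1, bif (pairExp s c d).1 then
        ((pairExp s a b).2 ^^ (pairExp s c d).2 ^^ (a.2 && c.1) ^^ (b.2 && d.1)) else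
        (pairExp s (letterMul a c) (letterMul b d)).2) := by
  obtain ⟨s1, s2, s3⟩ := s
  obtain ⟨a1, a2⟩ := a
  obtain ⟨b1, b2⟩ := b
  obtain ⟨c1, c2⟩ := c
  obtain ⟨d1, d2⟩ := d
  revert s1 s2 s3 a1 a2 b1 b2 c1 c2 d1 d2
  decide +kernel

theorem pairExp_mul' (s : PairState) (a b c d : Letter) (h : (pairExp s a b).1 = true) :
    pairExp s (letterMul c a) (letterMul d b) =
      ((pairExp s c d).1, bif (pairExp s c d).1 then
        ((pairExp s a b).2 ^^ (pairExp s c d).2 ^^ (c.2 && a.1) ^^ (d.2 && b.1)) else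
        (pairExp s (letterMul c a) (letterMul d b)).2) := by
  obtain ⟨s1, s2, s3⟩ := s
  obtain ⟨a1, a2⟩ := a
  obtain ⟨b1, b2⟩ := b
  obtain ⟨c1, c2⟩ := c
  obtain ⟨d1, d2⟩ := d
  revert s1 s2 s3 a1 a2 b1 b2 c1 c2 d1 d2
  decide +kernel

/-- The stabilizers contain an even number of letters `X * Z`, so they square to `1` without a
factor `i`. -/
theorem pairExp_letters (s : PairState) (a b : Letter) (h : (pairExp s a b).1 = true) :
    ((a.2 && a.1) ^^ (b.2 && b.1)) = false := by
  obtain ⟨s1, s2, s3⟩ := s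
  obtain ⟨a1, a2⟩ := a
  obtain ⟨b1, b2⟩ := b
  revert s1 s2 s3 a1 a2 b1 b2
  decide

theorem pairExp_pairGen (s : PairState) (a b : Letter) :
    pairExp s (pairGen s a b).2.1 (pairGen s a b).2.2 = (true, (pairGen s a b).1) := by
  obtain ⟨s1, s2, s3⟩ := s
  obtain ⟨a1, a2⟩ := a
  obtain ⟨b1, b2⟩ := b
  revert s1 s2 s3 a1 a2 b1 b2
  decide

/-- Expectation zero means that `a ⊗ b` lies outside the stabilizer group up to sign. That group is
maximal commutative up to phases, so some stabilizer fails to commute with `a ⊗ b`. -/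
theorem pairGen_anticommutes (s : PairState) (a b : Letter) (h : (pairExp s a b).1 = false) :
    (((a.2 && (pairGen s a b).2.1.1) ^^ (b.2 && (pairGen s a b).2.2.1)) ^^
      (((pairGen s a b).2.1.2 && a.1) ^^ ((pairGen s a b).2.2.2 && b.1))) = true := by
  obtain ⟨s1, s2, s3⟩ := s
  obtain ⟨a1, a2⟩ := a
  obtain ⟨b1, b2⟩ := b
  revert s1 s2 s3 a1 a2 b1 b2
  decide

theorem pairExp_one (s : PairState) : pairExp s (false, false) (false, false) = (true, false) := by
  obtain ⟨s1, s2, s3⟩ := s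
  revert s1 s2 s3
  decide

/-! ### Stabilizers of product states -/

/-- The sign of a bit. -/
def bitSign (b : Bool) : ℝ := if b then -1 else 1

theorem bitSign_xor (a b : Bool) : bitSign (a ^^ b) = bitSign a * bitSign b := by
  cases a <;> cases b <;> simp [bitSign]

theorem bitSign_mul_self (a : Bool) : bitSign a * bitSign a = 1 := by
  cases a <;> simp [bitSign]

theorem signVal_eq (e : Bool × Bool) : signVal e = if e.1 then bitSign e.2 else 0 := rfl

theorem pauliExp_eq (S : List PairState) (P : PauliWord) :
    pauliExp S P = if P.1 then 0 else bitSign P.2.1 * wordExp S P.2.2 := rfl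

/-- Up to the sign `t`, the word `w` stabilizes the product of the states `S`. -/
def Stabilizes (S : List PairState) (w : List Letter) (t : Bool) : Prop :=
  w.length = 2 * S.length ∧ cocycle w w = false ∧
  ∀ v : List Letter, v.length = 2 * S.length →
    wordExp S (wordMul w v) = bitSign (t ^^ cocycle w v) * wordExp S v ∧
    wordExp S (wordMul v w) = bitSign (t ^^ cocycle v w) * wordExp S v

theorem signVal_pairExp_mul {s : PairState} {a b : Letter} {t : Bool}
    (h : pairExp s a b = (true, t)) (c d : Letter) :
    signVal (pairExp s (letterMul a c) (letterMul b d)) =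
      bitSign (t ^^ (a.2 && c.1) ^^ (b.2 && d.1)) * signVal (pairExp s c d) ∧
    signVal (pairExp s (letterMul c a) (letterMul d b)) =
      bitSign (t ^^ (c.2 && a.1) ^^ (d.2 && b.1)) * signVal (pairExp s c d) := by
  rw [pairExp_mul s a b c d (by rw [h]), pairExp_mul' s a b c d (by rw [h]), h]
  simp only [signVal_eq]
  cases (pairExp s c d).1
  · simp
  · simp only [cond_true, if_true, bitSign_xor]
    constructor <;> ring

theorem Stabilizes.cons {S : List PairState} {w : List Letter} {t t' : Bool} {s : PairState}
    {a b : Letter} (h : Stabilizes S w t) (hab : pairExp s a b = (true, t')) :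
    Stabilizes (s :: S) (a :: b :: w) (t ^^ t') := by
  obtain ⟨h1, h2, h3⟩ := h
  refine ⟨by simp only [List.length_cons, h1]; ring, ?_, ?_⟩
  · have := pairExp_letters s a b (by rw [hab])
    simp only [cocycle, h2]
    revert this
    cases (a.2 && a.1) <;> cases (b.2 && b.1) <;> decide
  · intro v hv
    match v, hv with
    | c :: d :: v, hv =>
      obtain ⟨k1, k2⟩ := h3 v (by simp only [List.length_cons] at hv; omega)
      obtain ⟨l1, l2⟩ := signVal_pairExp_mul hab c d
      simp only [wordMul, List.zipWith_cons_cons, wordExp, cocycle] at k1 k2 ⊢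
      rw [k1, k2, l1, l2]
      simp only [bitSign_xor]
      constructor <;> ring
    | [], hv => simp at hv
    | [_], hv => simp only [List.length_cons, List.length_nil] at hv; omega

/-- A word stabilizes the product up to sign iff all its two-letter factors do. One factor that does
not suffices for an anticommuting stabilizer, which is trivial on all other factors. -/
theorem probe_spec (S : List PairState) (w : List Letter) (hw : w.length = 2 * S.length) :
    ((probe S w).1 = false → Stabilizes S w (probe S w).2.1 ∧
      (probe S w).2.2 = trivialWord (2 * S.length)) ∧
    ((probe S w).1 = true → Stabilizes S (probe S w).2.2 (probe S w).2.1 ∧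
      (cocycle w (probe S w).2.2 ^^ cocycle (probe S w).2.2 w) = true) := by
  -- The trivial word serves as the remainder of the stabilizer found at the first pair.
  have htriv : ∀ S : List PairState, Stabilizes S (trivialWord (2 * S.length)) false := by
    intro S
    refine ⟨by simp [trivialWord], (cocycle_trivialWord _ _).1, fun v hv => ?_⟩
    rw [wordMul_comm v, ← hv, trivialWord_mul, (cocycle_trivialWord _ _).1,
      (cocycle_trivialWord _ _).2]
    simp [bitSign]
  induction S generalizing w with
  | nil =>
    have : w = [] := List.eq_nil_of_length_eq_zero (by simpa using hw)
    subst this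
    exact ⟨fun _ => ⟨htriv [], rfl⟩, fun h => absurd h (by simp [probe])⟩
  | cons s S ih =>
    match w, hw with
    | a :: b :: w, hw =>
      obtain ⟨ih1, ih2⟩ := ih w (by simp only [List.length_cons] at hw; omega)
      have e : trivialWord (2 * (s :: S).length) =
          (false, false) :: (false, false) :: trivialWord (2 * S.length) := by
        simp [trivialWord, mul_add, List.replicate_succ]
      simp only [probe]
      cases hf : (probe S w).1 with
      | true =>
        obtain ⟨k1, k2⟩ := ih2 hf
        refine ⟨fun h => absurd h (by simp), fun _ => ?_⟩
        have := k1.cons (pairExp_one s)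
        simp only [Bool.xor_false] at this
        exact ⟨this, by simpa [cocycle] using k2⟩
      | false =>
        obtain ⟨k1, k2⟩ := ih1 hf
        cases hp : (pairExp s a b).1 with
        | true =>
          refine ⟨fun _ => ⟨k1.cons (t' := (pairExp s a b).2) (by rw [← hp]), ?_⟩,
            fun h => absurd h (by simp)⟩
          simp only [cond_true, cond_false, k2, e]
        | false =>
          refine ⟨fun h => absurd h (by simp), fun _ => ⟨?_, ?_⟩⟩
          · simp only [cond_false, k2]
            have := (htriv S).cons (pairExp_pairGen s a b)
            rwa [Bool.false_xor] at this
          · have := pairGen_anticommutes s a b hp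
            simp only [cond_false, k2, cocycle, (cocycle_trivialWord _ _).1,
              (cocycle_trivialWord _ _).2, Bool.xor_false]
            exact this
    | [], hw => simp at hw
    | [_], hw => simp only [List.length_cons, List.length_nil] at hw; omega

theorem pauliExp_neg (S : List PairState) {N : ℕ} (P : PauliWordOn N) :
    pauliExp S (-P).1 = -pauliExp S P.1 := by
  obtain ⟨⟨e, s, w⟩, h⟩ := P
  rw [PauliWordOn.val_neg]
  cases e <;> cases s <;> simp [pauliExp, pauliNeg]

theorem wordExp_trivialWord (S : List PairState) :
    wordExp S (trivialWord (2 * S.length)) = 1 := by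
  induction S with
  | nil => rfl
  | cons s S ih =>
    have e : trivialWord (2 * (s :: S).length) =
        (false, false) :: (false, false) :: trivialWord (2 * S.length) := by
      simp [trivialWord, mul_add, List.replicate_succ]
    rw [e, wordExp, ih, pairExp_one]
    simp [signVal]

theorem pauliExp_one (S : List PairState) :
    pauliExp S (1 : PauliWordOn (2 * S.length)).1 = 1 := by
  rw [PauliWordOn.val_one]
  simp [pauliExp, wordExp_trivialWord]

/-- The expectation as a functional on words of the right length. -/
noncomputable def pauliFunctional (S : List PairState) (N : ℕ) : PauliWordOn N → ℝ :=
  fun P => pauliExp S P.1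

/-- The cocycle sign produced by `pauliMul` and the one in `Stabilizes` are equal and cancel. The
phase of `P` has to be real, since a factor `i` would exchange real and imaginary parts of the
expectations. -/
theorem Stabilizes.isEigen {S : List PairState} {N : ℕ} (hN : N = 2 * S.length)
    {P : PauliWordOn N} {t : Bool} (h : Stabilizes S P.1.2.2 t) (hP : P.1.1 = false) :
    IsEigen (pauliFunctional S N) P (bitSign (P.1.2.1 ^^ t)) := by
  intro g
  obtain ⟨⟨e, s, w⟩, hw⟩ := P
  obtain ⟨⟨e', s', v⟩, hv⟩ := g
  simp only at hP h
  subst hP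
  obtain ⟨k1, k2⟩ := h.2.2 v (by rw [← hN]; exact hv)
  simp only [pauliFunctional, PauliWordOn.val_mul, pauliMul, pauliExp_eq, k1, k2]
  cases e'
  · simp only [bitSign_xor, Bool.xor_false, Bool.and_false, Bool.false_eq_true,
      if_false]
    constructor
    · linear_combination bitSign s * bitSign s' * bitSign t * wordExp S v *
        bitSign_mul_self (cocycle w v)
    · linear_combination bitSign s * bitSign s' * bitSign t * wordExp S v *
        bitSign_mul_self (cocycle v w)
  · simp

/-! ### Simulation of adaptive Pauli measurements on a product of two-qubit states -/

/-- One measurement of `P`, where `U` is the list of the conjugations made so far and `b` is a coin: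
the outcome and the new list. -/
def simStep (S : List PairState) (U : List (PauliWord × PauliWord)) (P : PauliWord) (b : Bool) :
    Bool × List (PauliWord × PauliWord) :=
  let Q := U.foldl pauliConj P
  let r := probe S Q.2.2
  bif r.1 then (b, U ++ [((false, r.2.1, r.2.2), (Q.1, (Q.2.1 ^^ b), Q.2.2))])
  else ((Q.2.1 ^^ r.2.1), U)

/-- The outcomes of `j` measurements. -/
def simRun (S : List PairState) (W : List Bool → PauliWord) :
    ℕ → List (PauliWord × PauliWord) → List Bool → List Bool → List Bool
  | 0, _, h, _ => h
  | j + 1, U, h, coins =>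
    let r := simStep S U (W h) (coins.headD false)
    simRun S W j r.2 (h ++ [r.1]) coins.tail

/-- The expectation of a function of `j` fair coins. -/
noncomputable def coinExp : ℕ → (List Bool → ℝ) → ℝ
  | 0, f => f []
  | j + 1, f => (coinExp j (fun l => f (false :: l)) + coinExp j (fun l => f (true :: l))) / 2

/-- The simulation produces the outcomes with the right probabilities. -/
theorem adaptive_eq_coinExp {N : ℕ} (S : List PairState) (hN : N = 2 * S.length)
    (W : List Bool → PauliWordOn N) (hW : ∀ h, W h * W h = 1) (O : List Bool → Bool) (j : ℕ)
    (U : List (PauliWordOn N × PauliWordOn N)) (hU : ∀ V ∈ U, IsGoodPair V) (h : List Bool) :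
    adaptive W O j (conjugated U (pauliFunctional S N)) h =
      coinExp j (fun l => if O (simRun S (fun h => (W h).1) j (U.map pairVal) h l) then 1 else 0) := by
  have hneg : ∀ g : PauliWordOn N, pauliFunctional S N (-g) = -pauliFunctional S N g :=
    fun g => pauliExp_neg S g
  induction j generalizing U h with
  | zero =>
    have h1 : conjugated U (pauliFunctional S N) 1 = 1 := by
      rw [(conjugated_one hneg hU).1]
      subst hN
      exact pauliExp_one S
    simp only [adaptive, coinExp, simRun, h1]
    split <;> simp_all
  | succ j ih =>
    obtain ⟨Q, hQ, hQQ, hUQ⟩ := exists_intertwinesList hU (hW h)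
    have hQl : Q.1.2.2.length = 2 * S.length := Q.2.trans hN
    obtain ⟨hp1, hp2⟩ := probe_spec S Q.1.2.2 hQl
    simp only [adaptive, coinExp, simRun, simStep, ← hQ, List.headD_cons, List.tail_cons]
    cases hr : (probe S Q.1.2.2).1 with
    | false =>
      -- Determined outcome: one of the two branches has factor `1`, the other `0`. The simulation
      -- still discards a coin, so both halves of the coin average coincide.
      obtain ⟨hs, _⟩ := hp1 hr
      -- A self-adjoint word whose letters square to `+1` has no factor `i`.
      have he : Q.1.1 = false := by
        rw [(PauliWordOn.mul_self_eq_one_iff Q).1 hQQ, hs.2.1]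
      have e1 := hUQ.isEigen (hs.isEigen hN he)
      have e2 := e1.neg (conjugated_one hneg hU).2
      rw [afterMeas_of_isEigen e1, afterMeas_of_isEigen e2, adaptive_smul, adaptive_smul]
      simp only [cond_false, ← ih U hU]
      cases (Q.1.2.1 ^^ (probe S Q.1.2.2).2.1)
      · simp only [bitSign, Bool.false_eq_true, if_false]; ring
      · simp only [bitSign, if_true]; ring
    | true =>
      -- Random outcome: both branches have weight `1/2`, and they append the pairs `(G, Q)` and
      -- `(G, -Q)`, according to the coin.
      obtain ⟨hs, ha⟩ := hp2 hr
      let G : PauliWordOn N := ⟨(false, (probe S Q.1.2.2).2.1, (probe S Q.1.2.2).2.2),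
        hs.1.trans hN.symm⟩
      have hG : IsEigen (pauliFunctional S N) G 1 := by
        have := hs.isEigen hN (P := G) rfl
        simpa [G, bitSign] using this
      have hGG : G * G = 1 := (PauliWordOn.mul_self_eq_one_iff G).2 hs.2.1.symm
      have hGQ : G * Q = -(Q * G) := by
        apply PauliWordOn.mul_eq_neg_of_anticommute
        simp only [anticommute, pauliMul, G]
        revert ha
        cases cocycle Q.1.2.2 (probe S Q.1.2.2).2.2 <;>
          cases cocycle (probe S Q.1.2.2).2.2 Q.1.2.2 <;> cases Q.1.1 <;> cases Q.1.2.1 <;>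
          cases (probe S Q.1.2.2).2.1 <;> decide
      have hgood : ∀ V ∈ U ++ [(G, Q)], IsGoodPair V := by
        intro V hV
        rcases List.mem_append.1 hV with hV | hV
        · exact hU V hV
        · rw [List.mem_singleton.1 hV]
          exact ⟨hGG, hQQ, hGQ⟩
      have hgood' : ∀ V ∈ U ++ [(G, -Q)], IsGoodPair V := by
        intro V hV
        rcases List.mem_append.1 hV with hV | hV
        · exact hU V hV
        · rw [List.mem_singleton.1 hV]
          refine ⟨hGG, by simpa using hQQ, ?_⟩
          show G * -Q = -(-Q * G)
          rw [mul_neg, neg_mul, hGQ]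
      rw [hUQ.afterMeas_eq hG, hUQ.neg.afterMeas_eq hG, adaptive_smul, adaptive_smul,
        ih _ hgood, ih _ hgood']
      simp only [List.map_append, List.map_cons, List.map_nil, pairVal, PauliWordOn.val_neg,
        pauliNeg, cond_true, G, Bool.xor_false, Bool.xor_true]
      ring

/-! ## From Pauli-based computations to functionals on words -/

/-- The complex sign of a bit. -/
noncomputable def bitSignC (b : Bool) : ℂ := if b then -1 else 1

theorem bitSignC_xor (a b : Bool) : bitSignC (a ^^ b) = bitSignC a * bitSignC b := by
  cases a <;> cases b <;> simp [bitSignC]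

/-- The matrix `X ^ x * Z ^ z`. -/
noncomputable def letterMatrix (a : Letter) : Matrix (Fin 2) (Fin 2) ℂ :=
  (if a.1 then !![0, 1; 1, 0] else 1) * (if a.2 then !![1, 0; 0, -1] else 1)

theorem letterMatrix_mul (a b : Letter) :
    letterMatrix a * letterMatrix b = bitSignC (a.2 && b.1) • letterMatrix (letterMul a b) := by
  obtain ⟨a1, a2⟩ := a
  obtain ⟨b1, b2⟩ := b
  cases a1 <;> cases a2 <;> cases b1 <;> cases b2 <;>
    simp [letterMatrix, letterMul, bitSignC, Matrix.one_fin_two]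

/-- The matrix of a word without phase. -/
noncomputable def wordMatrix (n : ℕ) (w : List Letter) :
    Matrix (Fin n → Fin 2) (Fin n → Fin 2) ℂ :=
  fun x y => ∏ i : Fin n, letterMatrix (w.getD i (false, false)) (x i) (y i)

/-- The matrix of a word. -/
noncomputable def pauliMatrix (n : ℕ) (P : PauliWord) :
    Matrix (Fin n → Fin 2) (Fin n → Fin 2) ℂ :=
  ((bif P.1 then Complex.I else 1) * bitSignC P.2.1) • wordMatrix n P.2.2

theorem prod_bitSignC_cocycle {n : ℕ} {u v : List Letter} (hu : u.length = n) (hv : v.length = n) :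
    ∏ i : Fin n, bitSignC ((u.getD i (false, false)).2 && (v.getD i (false, false)).1) =
      bitSignC (cocycle u v) := by
  induction n generalizing u v with
  | zero =>
    rw [List.eq_nil_of_length_eq_zero hu]
    simp [cocycle, bitSignC]
  | succ n ih =>
    match u, v, hu, hv with
    | a :: u, b :: v, hu, hv =>
      rw [Fin.prod_univ_succ, cocycle, bitSignC_xor,
        ← ih (by simpa using hu) (by simpa using hv)]
      simp

theorem wordMatrix_mul {n : ℕ} {u v : List Letter} (hu : u.length = n) (hv : v.length = n) :
    wordMatrix n u * wordMatrix n v = bitSignC (cocycle u v) • wordMatrix n (wordMul u v) := by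
  ext x y
  rw [Matrix.mul_apply, Matrix.smul_apply, ← prod_bitSignC_cocycle hu hv]
  simp only [wordMatrix, ← Finset.prod_mul_distrib, smul_eq_mul]
  rw [← Fintype.prod_sum (fun (i : Fin n) b => letterMatrix (u.getD i (false, false)) (x i) b *
    letterMatrix (v.getD i (false, false)) b (y i))]
  refine Finset.prod_congr rfl fun i _ => ?_
  have h := congrFun (congrFun (letterMatrix_mul (u.getD i (false, false))
    (v.getD i (false, false))) (x i)) (y i)
  rw [Matrix.mul_apply, Matrix.smul_apply, smul_eq_mul] at h
  rw [h]
  congr 2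
  have hi : (i : ℕ) < u.length := by rw [hu]; exact i.2
  have hi' : (i : ℕ) < v.length := by rw [hv]; exact i.2
  simp [wordMul, List.getD_eq_getElem?_getD, hi, hi']

theorem pauliMatrix_mul {n : ℕ} (P Q : PauliWordOn n) :
    pauliMatrix n (P * Q).1 = pauliMatrix n P.1 * pauliMatrix n Q.1 := by
  obtain ⟨⟨e, s, u⟩, hu⟩ := P
  obtain ⟨⟨e', s', v⟩, hv⟩ := Q
  rw [PauliWordOn.val_mul]
  simp only [pauliMatrix, pauliMul, Matrix.smul_mul, Matrix.mul_smul, wordMatrix_mul hu hv,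
    smul_smul, bitSignC_xor]
  congr 1
  cases e <;> cases e' <;> simp only [Bool.and_self, Bool.and_true, Bool.and_false, Bool.xor_self,
    Bool.xor_true, Bool.xor_false, Bool.not_false, Bool.false_eq_true, cond_true, cond_false,
    if_true, if_false, bitSignC]
  · ring
  · ring
  · ring
  · linear_combination -(if s then (-1 : ℂ) else 1) * (if s' then (-1 : ℂ) else 1) *
      (if cocycle u v then (-1 : ℂ) else 1) * Complex.I_mul_I

theorem pauliMatrix_neg {n : ℕ} (P : PauliWordOn n) :
    pauliMatrix n (-P).1 = -pauliMatrix n P.1 := by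
  obtain ⟨⟨e, s, u⟩, hu⟩ := P
  rw [PauliWordOn.val_neg]
  cases s <;> simp [pauliMatrix, pauliNeg, bitSignC]

theorem pauliMatrix_one (n : ℕ) : pauliMatrix n (1 : PauliWordOn n).1 = 1 := by
  rw [PauliWordOn.val_one]
  ext x y
  have h : ∀ i : Fin n, (trivialWord n).getD (i : ℕ) (false, false) = (false, false) := by
    intro i
    simp [trivialWord, List.getD_eq_getElem?_getD]
  simp only [pauliMatrix, bitSignC, wordMatrix, h, letterMatrix, Matrix.smul_apply]
  simp only [Bool.false_eq_true, if_false, mul_one, Matrix.one_apply]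
  rw [Finset.prod_ite_zero]
  simp [funext_iff]

/-! ### Hermitian words -/

/-- The phase `i ^ m`, where `m` is the number of letters `X * Z` of the word. -/
def yPhase : List Letter → Bool × Bool
  | [] => (false, false)
  | a :: w => bif a.1 && a.2 then (!(yPhase w).1, (yPhase w).2 ^^ (yPhase w).1) else yPhase w

def padWord (N : ℕ) (w : List Letter) : List Letter := w ++ trivialWord (N - w.length)

/-- The word of a hermitian Pauli operator, given by its sign and its letters, and padded to the
length `N`. -/
def hermitianWord (N : ℕ) (p : Bool × List Letter) : PauliWord :=
  let w := padWord N p.2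
  ((yPhase w).1, (p.1 ^^ (yPhase w).2), w)

/-- Both sides are the parity of the number of letters `X * Z`; hence `hermitianWord` is an
involution. -/
theorem yPhase_fst (w : List Letter) : (yPhase w).1 = cocycle w w := by
  induction w with
  | nil => rfl
  | cons a w ih =>
    obtain ⟨a1, a2⟩ := a
    cases a1 <;> cases a2 <;> simp [yPhase, cocycle, ih]

theorem yPhase_append_trivial (w : List Letter) (m : ℕ) :
    yPhase (w ++ trivialWord m) = yPhase w := by
  induction w with
  | nil =>
    induction m with
    | zero => rfl
    | succ m ih =>
      simp only [List.nil_append, trivialWord, List.replicate_succ] at ih ⊢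
      rw [← ih]; rfl
  | cons a w ih => rw [List.cons_append, yPhase, ih]; rfl

theorem padWord_length {N : ℕ} {w : List Letter} (h : w.length ≤ N) : (padWord N w).length = N := by
  simp [padWord, trivialWord, h]

/-- `hermitianWord` as a word of length `N`. -/
def hermitianWordOn (N : ℕ) (p : Bool × List Letter) (h : p.2.length ≤ N) : PauliWordOn N :=
  ⟨hermitianWord N p, padWord_length h⟩

theorem hermitianWordOn_mul_self {N : ℕ} (p : Bool × List Letter) (h : p.2.length ≤ N) :
    hermitianWordOn N p h * hermitianWordOn N p h = 1 :=
  (PauliWordOn.mul_self_eq_one_iff _).2 (yPhase_fst _)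

def letterCode : PauliLetter → Letter
  | .I => (false, false)
  | .X => (true, false)
  | .Y => (true, true)
  | .Z => (false, true)

/-- The sign and the letters of a Pauli operator. -/
def PauliOp.code {n : ℕ} (P : PauliOp n) : Bool × List Letter :=
  (P.neg, List.ofFn fun i => letterCode (P.letter i))

theorem PauliOp.code_length {n : ℕ} (P : PauliOp n) : P.code.2.length = n := by
  simp [PauliOp.code]

theorem PauliLetter.toMatrix_eq (a : PauliLetter) :
    a.toMatrix = (bif (letterCode a).1 && (letterCode a).2 then Complex.I else 1) •
      letterMatrix (letterCode a) := by
  cases a <;> simp [PauliLetter.toMatrix, letterCode, letterMatrix, Matrix.one_fin_two]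

theorem prod_yPhase {n : ℕ} {w : List Letter} (hw : w.length = n) :
    ∏ i : Fin n, (bif (w.getD i (false, false)).1 && (w.getD i (false, false)).2 then Complex.I
      else 1) = (bif (yPhase w).1 then Complex.I else 1) * bitSignC (yPhase w).2 := by
  induction n generalizing w with
  | zero =>
    rw [List.eq_nil_of_length_eq_zero hw]
    simp [yPhase, bitSignC]
  | succ n ih =>
    match w, hw with
    | a :: w, hw =>
      rw [Fin.prod_univ_succ]
      have := ih (w := w) (by simpa using hw)
      simp only [Fin.val_zero, List.getD_cons_zero, Fin.val_succ, List.getD_cons_succ, this, yPhase]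
      obtain ⟨a1, a2⟩ := a
      generalize yPhase w = p
      obtain ⟨p1, p2⟩ := p
      cases a1 <;> cases a2 <;> cases p1 <;> cases p2 <;> simp [bitSignC]

theorem PauliOp.toMatrix_eq {n : ℕ} (P : PauliOp n) :
    P.toMatrix = pauliMatrix n (hermitianWord n P.code) := by
  have hp : padWord n P.code.2 = P.code.2 := by
    simp [padWord, P.code_length, trivialWord]
  have hg : ∀ i : Fin n, P.code.2.getD i (false, false) = letterCode (P.letter i) := by
    intro i
    simp [PauliOp.code, List.getD_eq_getElem?_getD]
  ext x y
  simp only [PauliOp.toMatrix, PauliLetter.toMatrix_eq, Matrix.smul_apply, smul_eq_mul,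
    Finset.prod_mul_distrib, pauliMatrix, hermitianWord, hp, wordMatrix, hg]
  rw [← mul_assoc]
  congr 1
  have := prod_yPhase P.code_length
  simp only [hg] at this
  rw [this, bitSignC_xor]
  show bitSignC P.neg * _ = _
  have : P.code.1 = P.neg := rfl
  rw [this]
  ring

theorem PauliLetter.toMatrix_conjTranspose (a : PauliLetter) (x y : Fin 2) :
    star (a.toMatrix y x) = a.toMatrix x y := by
  cases a <;> fin_cases x <;> fin_cases y <;> simp [PauliLetter.toMatrix]

theorem PauliOp.toMatrix_conjTranspose {n : ℕ} (P : PauliOp n) : P.toMatrixᴴ = P.toMatrix := by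
  ext x y
  rw [Matrix.conjTranspose_apply, PauliOp.toMatrix, star_mul', star_prod]
  congr 1
  · split <;> simp
  · exact Finset.prod_congr rfl fun i _ => PauliLetter.toMatrix_conjTranspose _ _ _

/-! ### Expectations -/

/-- The real part of the expectation of a word in the state `ψ`. -/
noncomputable def stateFunctional {n : ℕ} (ψ : QVec n) : PauliWordOn n → ℝ := fun g =>
  (star ψ ⬝ᵥ (pauliMatrix n g.1 *ᵥ ψ)).re

theorem stateFunctional_one {n : ℕ} (ψ : QVec n) : stateFunctional ψ 1 = ψ.sqNorm := by
  rw [stateFunctional, pauliMatrix_one, Matrix.one_mulVec, QVec.sqNorm, dotProduct, Complex.re_sum]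
  refine Finset.sum_congr rfl fun x _ => ?_
  have : star ψ x * ψ x = ((‖ψ x‖ ^ 2 : ℝ) : ℂ) := by
    rw [Pi.star_apply, ← Complex.normSq_eq_norm_sq, Complex.normSq_eq_conj_mul_self]
    rfl
  rw [this, Complex.ofReal_re]

/-- The projector is self-adjoint, so it can be moved to both sides of `g`; expanding the product
gives the four terms of `afterMeas`. -/
theorem stateFunctional_projection {n : ℕ} (ψ : QVec n) (R : PauliWordOn n)
    (hR : (pauliMatrix n R.1)ᴴ = pauliMatrix n R.1) :
    stateFunctional (((1 / 2 : ℂ) • (1 + pauliMatrix n R.1)) *ᵥ ψ) =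
      afterMeas (stateFunctional ψ) R := by
  funext g
  have h : ∀ A G : Matrix (Fin n → Fin 2) (Fin n → Fin 2) ℂ,
      star (A *ᵥ ψ) ⬝ᵥ (G *ᵥ (A *ᵥ ψ)) = star ψ ⬝ᵥ ((Aᴴ * G * A) *ᵥ ψ) := by
    intro A G
    rw [Matrix.star_mulVec, ← Matrix.dotProduct_mulVec, Matrix.mulVec_mulVec, Matrix.mulVec_mulVec,
      mul_assoc]
  have e : ((1 / 2 : ℂ) • (1 + pauliMatrix n R.1))ᴴ * pauliMatrix n g.1 *
      ((1 / 2 : ℂ) • (1 + pauliMatrix n R.1)) = ((1 / 4 : ℝ) : ℂ) • (pauliMatrix n g.1 +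
        pauliMatrix n (R * g).1 + pauliMatrix n (g * R).1 + pauliMatrix n (R * g * R).1) := by
    rw [Matrix.conjTranspose_smul, Matrix.conjTranspose_add, hR, Matrix.conjTranspose_one]
    simp only [pauliMatrix_mul, Matrix.smul_mul, Matrix.mul_smul, add_mul, mul_add,
      one_mul, mul_one]
    have : star (1 / 2 : ℂ) * (1 / 2) = ((1 / 4 : ℝ) : ℂ) := by
      simp [Complex.ext_iff]; norm_num
    rw [← smul_add, smul_smul, mul_comm (1 / 2 : ℂ), this]
    congr 1
    abel
  simp only [stateFunctional, afterMeas]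
  rw [h, e]
  simp only [Matrix.smul_mulVec, Matrix.add_mulVec,
    dotProduct_add, dotProduct_smul, smul_eq_mul, Complex.re_ofReal_mul, Complex.add_re]
  ring

theorem PauliOp.stateFunctional_proj {n : ℕ} (P : PauliOp n) (b : Bool) (ψ : QVec n) :
    stateFunctional (P.proj b *ᵥ ψ) = afterMeas (stateFunctional ψ)
      (if b then -hermitianWordOn n P.code P.code_length.le
        else hermitianWordOn n P.code P.code_length.le) := by
  rw [← stateFunctional_projection]
  · cases b <;> simp [PauliOp.proj, pauliMatrix_neg, P.toMatrix_eq, hermitianWordOn]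
  · have := P.toMatrix_conjTranspose
    rw [P.toMatrix_eq] at this
    cases b <;> simp [pauliMatrix_neg, hermitianWordOn, this]

/-- The expectation of a letter in the magic state. -/
noncomputable def magicLetter (a : Letter) : ℝ :=
  if a.1 then (if a.2 then 0 else √2 / 2) else (if a.2 then √2 / 2 else 1)

/-- The real part of the expectation of a word in a power of the magic state. -/
noncomputable def magicExp (P : PauliWord) : ℝ :=
  if P.1 then 0 else bitSign P.2.1 * (P.2.2.map magicLetter).prod

/-- The expectations of `X` and `Z` are `sin (π/4)` and `cos (π/4)` by the double angle formulas.
That of `X * Z` vanishes, because the matrix is antisymmetric and the amplitudes are real. -/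
theorem magicLetter_eq (a : Letter) :
    ∑ x : Fin 2, ∑ y : Fin 2, ((![Real.cos (Real.pi / 8), Real.sin (Real.pi / 8)] x : ℝ) : ℂ) *
      (letterMatrix a x y * ((![Real.cos (Real.pi / 8), Real.sin (Real.pi / 8)] y : ℝ) : ℂ)) =
    (magicLetter a : ℂ) := by
  have h1 : Real.cos (Real.pi / 8) * Real.sin (Real.pi / 8) +
      Real.sin (Real.pi / 8) * Real.cos (Real.pi / 8) = √2 / 2 := by
    rw [← Real.sin_pi_div_four, show Real.pi / 4 = 2 * (Real.pi / 8) by ring, Real.sin_two_mul]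
    ring
  have h2 : Real.cos (Real.pi / 8) * Real.cos (Real.pi / 8) -
      Real.sin (Real.pi / 8) * Real.sin (Real.pi / 8) = √2 / 2 := by
    rw [← Real.cos_pi_div_four, show Real.pi / 4 = 2 * (Real.pi / 8) by ring, Real.cos_two_mul']
    ring
  have h3 : Real.cos (Real.pi / 8) * Real.cos (Real.pi / 8) +
      Real.sin (Real.pi / 8) * Real.sin (Real.pi / 8) = 1 := by
    rw [← Real.cos_sq_add_sin_sq (Real.pi / 8)]; ring
  obtain ⟨a1, a2⟩ := a
  cases a1 <;> cases a2 <;>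
    simp only [letterMatrix, magicLetter, Fin.sum_univ_two, Matrix.one_fin_two, if_true,
      Bool.false_eq_true, if_false, Matrix.mul_apply, Matrix.of_apply, Matrix.cons_val_zero,
      Matrix.cons_val_one, Matrix.cons_val', Matrix.cons_val_fin_one]
  · rw [← h3]; push_cast; ring
  · rw [← h2]; push_cast; ring
  · rw [← h1]; push_cast; ring
  · push_cast; ring

/-- The expectation factorizes over the qubits. Words without `i` are real matrices and the
amplitudes are real, so a factor `i` makes the expectation purely imaginary. -/
theorem stateFunctional_magicState {n : ℕ} (g : PauliWordOn n) :
    stateFunctional (magicState n) g = magicExp g.1 := by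
  obtain ⟨⟨e, s, w⟩, hw⟩ := g
  have h1 : star (magicState n) ⬝ᵥ (wordMatrix n w *ᵥ magicState n) =
      (((w.map magicLetter).prod : ℝ) : ℂ) := by
    have h2 : (w.map magicLetter).prod = ∏ i : Fin n, magicLetter (w.getD i (false, false)) := by
      replace hw : w.length = n := hw
      clear e s
      induction n generalizing w with
      | zero => rw [List.eq_nil_of_length_eq_zero hw]; simp
      | succ n ih =>
        match w, hw with
        | a :: w, hw =>
          rw [Fin.prod_univ_succ]
          simp only [List.map_cons, List.prod_cons, Fin.val_zero, List.getD_cons_zero, Fin.val_succ,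
            List.getD_cons_succ]
          rw [ih w (by simpa using hw)]
    rw [h2]
    push_cast
    simp only [← magicLetter_eq, Fintype.prod_sum, dotProduct, Matrix.mulVec, wordMatrix,
      magicState, Pi.star_apply, Finset.mul_sum]
    refine Finset.sum_congr rfl fun x _ => Finset.sum_congr rfl fun y _ => ?_
    rw [star_prod, ← Finset.prod_mul_distrib, ← Finset.prod_mul_distrib]
    refine Finset.prod_congr rfl fun i _ => ?_
    congr 1
    exact Complex.conj_ofReal _
  simp only [stateFunctional, pauliMatrix, Matrix.smul_mulVec, dotProduct_smul, h1, magicExp]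
  cases e <;> cases s <;> simp [bitSignC, bitSign]

/-! ## The output probability of a Pauli-based computation -/

/-- The weight depends only on the functional along the words generated by the measured ones. This
is applied to the padding of words. -/
theorem adaptive_map {M M' : Type} [Monoid M] [HasDistribNeg M] [Monoid M'] [HasDistribNeg M']
    (φ : M → M') (hmul : ∀ a b, φ (a * b) = φ a * φ b) (hneg : ∀ a, φ (-a) = -φ a)
    (hone : φ 1 = 1) (W : List Bool → M) (O : List Bool → Bool) (j : ℕ) (F : M' → ℝ)
    (h : List Bool) :
    adaptive (fun h => φ (W h)) O j F h = adaptive W O j (fun g => F (φ g)) h := by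
  have hm : ∀ (F : M' → ℝ) (P : M), (fun g => afterMeas F (φ P) (φ g)) =
      afterMeas (fun g => F (φ g)) P := by
    intro F P
    funext g
    simp only [afterMeas, hmul]
  induction j generalizing F h with
  | zero => simp only [adaptive, hone]
  | succ j ih => simp only [adaptive, ih, ← hneg, hm]

/-- Padding of a word by trivial letters. -/
def padPauli {n N : ℕ} (hn : n ≤ N) (P : PauliWordOn n) : PauliWordOn N :=
  ⟨(P.1.1, P.1.2.1, padWord N P.1.2.2), padWord_length (P.2.trans_le hn)⟩

theorem cocycle_append {u v u' v' : List Letter} (h : u.length = v.length) :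
    cocycle (u ++ u') (v ++ v') = (cocycle u v ^^ cocycle u' v') := by
  induction u generalizing v with
  | nil =>
    rw [List.eq_nil_of_length_eq_zero h.symm]
    simp [cocycle]
  | cons a u ih =>
    match v, h with
    | b :: v, h =>
      simp only [List.cons_append, cocycle]
      rw [ih (by simpa using h), Bool.xor_assoc]

theorem padPauli_mul {n N : ℕ} (hn : n ≤ N) (P Q : PauliWordOn n) :
    padPauli hn (P * Q) = padPauli hn P * padPauli hn Q := by
  obtain ⟨⟨e, s, u⟩, hu⟩ := P
  obtain ⟨⟨e', s', v⟩, hv⟩ := Q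
  replace hu : u.length = n := hu
  replace hv : v.length = n := hv
  apply Subtype.ext
  have ht : wordMul (trivialWord (N - n)) (trivialWord (N - n)) = trivialWord (N - n) := by
    have := trivialWord_mul (trivialWord (N - n))
    simpa [trivialWord] using this
  have h1 : wordMul (padWord N u) (padWord N v) = padWord N (wordMul u v) := by
    simp only [padWord, hu, hv, wordMul_length hu hv]
    rw [wordMul, List.zipWith_append (by rw [hu, hv])]
    exact congrArg _ ht
  have h2 : cocycle (padWord N u) (padWord N v) = cocycle u v := by
    simp only [padWord]
    rw [cocycle_append (by rw [hu, hv]), hu, hv, (cocycle_trivialWord _ _).1, Bool.xor_false]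
  simp only [padPauli, PauliWordOn.val_mul, pauliMul, h1, h2]

theorem padPauli_neg {n N : ℕ} (hn : n ≤ N) (P : PauliWordOn n) :
    padPauli hn (-P) = -padPauli hn P := rfl

theorem padPauli_one {n N : ℕ} (hn : n ≤ N) : padPauli hn (1 : PauliWordOn n) = 1 := by
  apply Subtype.ext
  simp only [padPauli, PauliWordOn.val_one, padWord, trivialWord, List.length_replicate,
    List.replicate_append_replicate, Nat.add_sub_of_le hn]

/-- The additional qubits are magic states that are never touched. -/
theorem magicExp_padPauli {n N : ℕ} (hn : n ≤ N) (P : PauliWordOn n) :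
    magicExp (padPauli hn P).1 = magicExp P.1 := by
  simp [magicExp, padPauli, padWord, trivialWord, magicLetter]

theorem padPauli_hermitianWordOn {n N : ℕ} (hn : n ≤ N) (P : PauliOp n) :
    padPauli hn (hermitianWordOn n P.code P.code_length.le) =
      hermitianWordOn N P.code (P.code_length.trans_le hn) := by
  apply Subtype.ext
  have hp : padWord n P.code.2 = P.code.2 := by
    simp [padWord, P.code_length, trivialWord]
  simp only [padPauli, hermitianWordOn, hermitianWord, hp]
  simp only [padWord, yPhase_append_trivial]

/-! ### Outcome lists and the branching of a computation -/

/-- The operator measured next, from the list of the previous outcomes. -/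
def PBC.pauliAt {n : ℕ} (Q : PBC n) (h : List Bool) : PauliOp n :=
  if ht : (List.equivSigmaTuple h).1 < n then Q.pauli ⟨_, ht⟩ (List.equivSigmaTuple h).2
  else ⟨false, fun _ => PauliLetter.I⟩

/-- The output bit, from the list of all outcomes. -/
def PBC.outAt {n : ℕ} (Q : PBC n) (h : List Bool) : Bool :=
  if ht : n = (List.equivSigmaTuple h).1 then
    Q.out fun i => (List.equivSigmaTuple h).2 (Fin.cast ht i)
  else false

theorem PBC.pauliAt_ofFn {n t : ℕ} (Q : PBC n) (ht : t < n) (h : Fin t → Bool) :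
    Q.pauliAt (List.ofFn h) = Q.pauli ⟨t, ht⟩ h := by
  have e : List.equivSigmaTuple (List.ofFn h) = ⟨t, h⟩ :=
    List.equivSigmaTuple.right_inv ⟨t, h⟩
  rw [PBC.pauliAt, e, dif_pos ht]

theorem PBC.outAt_ofFn {n : ℕ} (Q : PBC n) (h : Fin n → Bool) :
    Q.outAt (List.ofFn h) = Q.out h := by
  have e : List.equivSigmaTuple (List.ofFn h) = ⟨n, h⟩ :=
    List.equivSigmaTuple.right_inv ⟨n, h⟩
  rw [PBC.outAt, e, dif_pos rfl]
  rfl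

/-- The word of length `N` measured next. -/
def PBC.wordAt {n : ℕ} (Q : PBC n) (N : ℕ) (hN : n ≤ N) (h : List Bool) : PauliWordOn N :=
  hermitianWordOn N (Q.pauliAt h).code ((Q.pauliAt h).code_length.trans_le hN)

theorem PBC.state_congr {n : ℕ} (Q : PBC n) {σ τ : Fin n → Bool} (t : ℕ) (ht : t ≤ n)
    (h : ∀ i : Fin n, (i : ℕ) < t → σ i = τ i) : Q.state σ t ht = Q.state τ t ht := by
  induction t with
  | zero => rfl
  | succ t ih =>
    rw [PBC.state, PBC.state, ih _ fun i hi => h i (by omega), h ⟨t, ht⟩ (Nat.lt_succ_self t)]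
    congr 3
    funext i
    exact h _ (Nat.lt_succ_of_lt i.2)

/-- The first `t` outcomes. -/
def outcomePrefix {n : ℕ} (σ : Fin n → Bool) (t : ℕ) (ht : t ≤ n) : List Bool :=
  List.ofFn fun i : Fin t => σ (Fin.castLE ht i)

theorem outcomePrefix_succ {n : ℕ} (σ : Fin n → Bool) (t : ℕ) (ht : t + 1 ≤ n) :
    outcomePrefix σ (t + 1) ht = outcomePrefix σ t (Nat.le_of_succ_le ht) ++ [σ ⟨t, ht⟩] := by
  rw [outcomePrefix, List.ofFn_succ_last]
  rfl

/-- Flipping the bit `t` is an involution of the index set, and it exchanges the terms with `σ t`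
and `!σ t`. -/
theorem sum_flip {n : ℕ} (t : Fin n) (A : (Fin n → Bool) → Bool → ℝ)
    (hA : ∀ σ b b', A (Function.update σ t b) b' = A σ b') :
    ∑ σ, (A σ false + A σ true) = 2 * ∑ σ, A σ (σ t) := by
  have h1 : ∀ σ, A σ false + A σ true = A σ (σ t) + A σ (!σ t) := by
    intro σ
    cases σ t <;> simp [add_comm]
  have h2 : ∑ σ, A σ (!σ t) = ∑ σ, A σ (σ t) := by
    have hinv : Function.Involutive fun σ : Fin n → Bool => Function.update σ t (!σ t) := by
      intro σ
      simp
    rw [← Equiv.sum_comp (hinv.toPerm _)]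
    refine Finset.sum_congr rfl fun σ _ => ?_
    simp [Function.Involutive.coe_toPerm, hA]
  rw [Finset.sum_congr rfl fun σ _ => h1 σ, Finset.sum_add_distrib, h2]
  ring

/-- The sum runs over full outcome sequences although only the first `t` bits matter, so every
prefix is counted `2 ^ (n - t)` times. At `t = n` this is the definition of the probability; the
induction goes backwards, and `t = 0` is the case of interest. -/
theorem sum_adaptive_state {n : ℕ} (Q : PBC n) (t : ℕ) (ht : t ≤ n) :
    ∑ σ : Fin n → Bool, adaptive (Q.wordAt n le_rfl) Q.outAt (n - t)
        (stateFunctional (Q.state σ t ht)) (outcomePrefix σ t ht) =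
      2 ^ (n - t) * ∑ σ : Fin n → Bool, if Q.out σ then Q.prob σ else 0 := by
  obtain ⟨j, hj⟩ : ∃ j, j = n - t := ⟨_, rfl⟩
  rw [← hj]
  induction j generalizing t with
  | zero =>
    have : t = n := by omega
    subst this
    rw [pow_zero, one_mul]
    refine Finset.sum_congr rfl fun σ _ => ?_
    rw [adaptive, stateFunctional_one]
    have : outcomePrefix σ t ht = List.ofFn σ := rfl
    rw [this, Q.outAt_ofFn]
    rfl
  | succ j ih =>
    have ht' : t + 1 ≤ n := by omega
    have h1 := ih (t + 1) ht' (by omega)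
    rw [pow_succ', mul_assoc, ← h1]
    simp only [adaptive]
    let A : (Fin n → Bool) → Bool → ℝ := fun σ b => adaptive (Q.wordAt n le_rfl) Q.outAt j
      (afterMeas (stateFunctional (Q.state σ t ht)) (if b then -Q.wordAt n le_rfl
        (outcomePrefix σ t ht) else Q.wordAt n le_rfl (outcomePrefix σ t ht)))
        (outcomePrefix σ t ht ++ [b])
    have hA : ∀ σ b b', A (Function.update σ ⟨t, ht'⟩ b) b' = A σ b' := by
      intro σ b b'
      have e : ∀ i : Fin n, (i : ℕ) < t → Function.update σ ⟨t, ht'⟩ b i = σ i := by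
        intro i hi
        rw [Function.update_of_ne]
        intro h
        rw [h] at hi
        exact lt_irrefl _ hi
      have e1 : Q.state (Function.update σ ⟨t, ht'⟩ b) t ht = Q.state σ t ht := Q.state_congr t ht e
      have e2 : outcomePrefix (Function.update σ ⟨t, ht'⟩ b) t ht = outcomePrefix σ t ht := by
        rw [outcomePrefix, outcomePrefix]
        congr 1
        funext i
        exact e _ i.2
      simp only [A, e1, e2]
    have := sum_flip ⟨t, ht'⟩ A hA
    simp only [A, Bool.false_eq_true, if_false, if_true] at this
    rw [this]
    congr 1
    refine Finset.sum_congr rfl fun σ _ => ?_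
    rw [outcomePrefix_succ, PBC.state, PauliOp.stateFunctional_proj]
    congr 2
    have e : Q.wordAt n le_rfl (outcomePrefix σ t ht) = hermitianWordOn n
        (Q.pauli ⟨t, ht'⟩ fun i => σ (Fin.castLE ht i)).code (PauliOp.code_length _).le := by
      apply Subtype.ext
      have := Q.pauliAt_ofFn ht' fun i => σ (Fin.castLE ht i)
      simp only [PBC.wordAt, hermitianWordOn, outcomePrefix, this]
    rw [e]

/-- The output probability in terms of the expectations of words in the magic state. -/
theorem PBC.probOne_eq_adaptive {n : ℕ} (Q : PBC n) (N : ℕ) (hN : n ≤ N) :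
    Q.probOne = adaptive (Q.wordAt N hN) Q.outAt n (fun g : PauliWordOn N => magicExp g.1) [] := by
  have h := sum_adaptive_state Q 0 (Nat.zero_le n)
  have e : ∀ σ, adaptive (Q.wordAt n le_rfl) Q.outAt (n - 0)
      (stateFunctional (Q.state σ 0 (Nat.zero_le n))) (outcomePrefix σ 0 (Nat.zero_le n)) =
      adaptive (Q.wordAt N hN) Q.outAt n (fun g : PauliWordOn N => magicExp g.1) [] := by
    intro σ
    have e1 : (Q.wordAt N hN) = fun h => padPauli hN (Q.wordAt n le_rfl h) := by
      funext h
      exact (padPauli_hermitianWordOn hN _).symm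
    rw [e1, adaptive_map (padPauli hN) (padPauli_mul hN) (padPauli_neg hN) (padPauli_one hN)]
    have e2 : stateFunctional (Q.state σ 0 (Nat.zero_le n)) =
        fun g : PauliWordOn n => magicExp (padPauli hN g).1 := by
      funext g
      rw [magicExp_padPauli, ← stateFunctional_magicState]
      rfl
    rw [e2]
    rfl
  rw [Finset.sum_congr rfl fun σ _ => e σ] at h
  simp only [Finset.sum_const, Finset.card_univ, Fintype.card_pi, Fintype.card_bool,
    Finset.prod_const, Fintype.card_fin, nsmul_eq_mul, Nat.sub_zero] at h
  rw [PBC.probOne]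
  have h2 : (2 : ℝ) ^ n ≠ 0 := by positivity
  push_cast at h
  exact (mul_left_cancel₀ h2 h).symm

/-! ## Expectations over fair coins -/

theorem coinExp_const (j : ℕ) (c : ℝ) : coinExp j (fun _ => c) = c := by
  induction j with
  | zero => rfl
  | succ j ih => simp only [coinExp, ih]; ring

theorem coinExp_mul_left (j : ℕ) (c : ℝ) (f : List Bool → ℝ) :
    coinExp j (fun l => c * f l) = c * coinExp j f := by
  induction j generalizing f with
  | zero => rfl
  | succ j ih => simp only [coinExp, ih]; ring

theorem coinExp_mul_right (j : ℕ) (c : ℝ) (f : List Bool → ℝ) :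
    coinExp j (fun l => f l * c) = coinExp j f * c := by
  simp only [mul_comm _ c, coinExp_mul_left]

theorem coinExp_add_fun (j : ℕ) (f g : List Bool → ℝ) :
    coinExp j (fun l => f l + g l) = coinExp j f + coinExp j g := by
  induction j generalizing f g with
  | zero => rfl
  | succ j ih => simp only [coinExp, ih]; ring

theorem coinExp_congr {j : ℕ} {f g : List Bool → ℝ} (h : ∀ l, l.length = j → f l = g l) :
    coinExp j f = coinExp j g := by
  induction j generalizing f g with
  | zero => exact h [] rfl
  | succ j ih =>
    rw [coinExp, coinExp, ih fun l hl => h (false :: l) (by simp [hl]),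
      ih fun l hl => h (true :: l) (by simp [hl])]

theorem coinExp_mono {j : ℕ} {f g : List Bool → ℝ} (h : ∀ l, l.length = j → f l ≤ g l) :
    coinExp j f ≤ coinExp j g := by
  induction j generalizing f g with
  | zero => exact h [] rfl
  | succ j ih =>
    have h1 := ih (f := fun l => f (false :: l)) (g := fun l => g (false :: l))
      fun l hl => h (false :: l) (by simp [hl])
    have h2 := ih (f := fun l => f (true :: l)) (g := fun l => g (true :: l))
      fun l hl => h (true :: l) (by simp [hl])
    rw [coinExp, coinExp]
    linarith

theorem coinExp_append (a b : ℕ) (f : List Bool → ℝ) :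
    coinExp (a + b) f = coinExp a (fun u => coinExp b (fun v => f (u ++ v))) := by
  induction a generalizing f with
  | zero => simp [coinExp]
  | succ a ih => rw [Nat.succ_add, coinExp, ih, ih]; rfl

/-- By linearity the random choice of the initial functional may be made before the measurements. -/
theorem adaptive_coinExp {M : Type} [Monoid M] [HasDistribNeg M] (W : List Bool → M)
    (O : List Bool → Bool) (j a : ℕ) (G : List Bool → M → ℝ) (h : List Bool) :
    adaptive W O j (fun g => coinExp a (fun u => G u g)) h =
      coinExp a (fun u => adaptive W O j (G u) h) := by
  induction a generalizing G with
  | zero => rfl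
  | succ a ih =>
    have e : (fun g => coinExp (a + 1) (fun u => G u g)) =
        (1 / 2 : ℝ) • ((fun g => coinExp a (fun u => G (false :: u) g)) +
          fun g => coinExp a (fun u => G (true :: u) g)) := by
      funext g
      simp only [coinExp, Pi.smul_apply, Pi.add_apply, smul_eq_mul]
      ring
    rw [e, adaptive_smul, adaptive_add, ih, ih, coinExp]
    ring

/-! ### Programs that consume coins -/

/-- The step `f` reads exactly `c` coins. -/
def Reads {σ : Type} (c : ℕ) (f : σ × List Bool → σ × List Bool) : Prop :=
  ∀ x u v, u.length = c → f (x, u ++ v) = ((f (x, u)).1, v)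

theorem Reads.iterate {σ : Type} {c : ℕ} {f : σ × List Bool → σ × List Bool} (hf : Reads c f)
    (m : ℕ) : Reads (m * c) f^[m] := by
  induction m with
  | zero =>
    intro x u v hu
    rw [Nat.zero_mul] at hu
    rw [List.eq_nil_of_length_eq_zero hu]
    rfl
  | succ m ih =>
    intro x u v hu
    rw [Nat.succ_mul] at hu
    have h1 : (u.take (m * c)).length = m * c := by
      rw [List.length_take]; exact Nat.min_eq_left (by rw [hu]; exact Nat.le_add_right _ _)
    have h2 : (u.drop (m * c)).length = c := by rw [List.length_drop, hu]; omega
    have h3 := List.take_append_drop (m * c) u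
    rw [Function.iterate_succ_apply', Function.iterate_succ_apply']
    conv_lhs => rw [← h3, List.append_assoc, ih _ _ _ h1, hf _ _ _ h2]
    conv_rhs => rw [← h3, ih _ _ _ h1]

/-! ### A coin with an irrational bias -/

/-- One move of a random walk with an absorbing state: whether the walk has been absorbed, and its
position. -/
def walkMove (b₁ b₂ b₃ b₄ b₅ : Bool) (s : Bool × ℕ) : Bool × ℕ :=
  bif s.1 || !decide (0 < s.2) then s
  -- Of the 32 equally likely patterns of five coins, 8 absorb the walk, 9 move it down, 1 moves it
  -- up, and 14 leave it in place.
  else bif !b₁ && !b₂ then (true, s.2)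
  else bif b₁ && (!b₂ || (!b₃ && !b₄ && !b₅)) then (false, s.2 - 1)
  else bif b₁ && b₂ && !b₃ && !b₄ && b₅ then (false, s.2 + 1)
  else s

def walkStep (s : (Bool × ℕ) × List Bool) : (Bool × ℕ) × List Bool :=
  (walkMove (s.2.headD false) (s.2.tail.headD false) (s.2.tail.tail.headD false)
    (s.2.tail.tail.tail.headD false) (s.2.tail.tail.tail.tail.headD false) s.1,
    s.2.tail.tail.tail.tail.tail)

theorem reads_walkStep : Reads 5 walkStep := by
  intro x u v hu
  match u, hu with
  | [a, b, c, d, e], _ => rfl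

/-- The walk has arrived at `0`. -/
def walkSuccess (s : Bool × ℕ) : Bool := !s.1 && !decide (0 < s.2)

/-- The probability that the walk arrives at `0` within `T` steps. -/
noncomputable def walkProb (T : ℕ) (s : Bool × ℕ) : ℝ :=
  coinExp (T * 5) (fun v => if walkSuccess (walkStep^[T] (s, v)).1 then 1 else 0)

theorem walkProb_succ (T : ℕ) (s : Bool × ℕ) :
    walkProb (T + 1) s = coinExp 5 (fun u => walkProb T (walkStep (s, u)).1) := by
  rw [walkProb, Nat.succ_mul, Nat.add_comm, coinExp_append]
  refine coinExp_congr fun u hu => coinExp_congr fun v _ => ?_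
  rw [Function.iterate_succ_apply, reads_walkStep _ _ _ hu]

theorem walkProb_absorbed (T c : ℕ) : walkProb T (true, c) = 0 := by
  induction T generalizing c with
  | zero => simp [walkProb, coinExp, walkSuccess]
  | succ T ih =>
    rw [walkProb_succ, ← coinExp_const 5 0]
    exact coinExp_congr fun u _ => ih c

theorem walkProb_zero (T : ℕ) : walkProb T (false, 0) = 1 := by
  induction T with
  | zero => simp [walkProb, coinExp, walkSuccess]
  | succ T ih =>
    rw [walkProb_succ, ← coinExp_const 5 1]
    exact coinExp_congr fun u _ => ih

theorem walkProb_rec (T c : ℕ) : walkProb (T + 1) (false, c + 1) =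
    (9 * walkProb T (false, c) + walkProb T (false, c + 2) +
      14 * walkProb T (false, c + 1)) / 32 := by
  rw [walkProb_succ]
  simp [coinExp, walkStep, walkMove, walkProb_absorbed]
  ring

/-- The bias of the coin. -/
noncomputable def walkBias : ℝ := 9 - 6 * √2

/-- The fixed point equation of the walk, `β ^ 2 - 18 β + 9 = 0`; its root in `[0, 1]` is `9 - 6
√2`. -/
theorem walkBias_eq : walkBias = (9 + walkBias ^ 2 + 14 * walkBias) / 32 := by
  have h : √2 ^ 2 = 2 := Real.sq_sqrt (by norm_num)
  rw [walkBias]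
  linear_combination (-36 / 32 : ℝ) * h

theorem walkBias_mem : 0 ≤ walkBias ∧ walkBias ≤ 1 := by
  have h1 : √2 ≤ 3 / 2 := by rw [Real.sqrt_le_left (by norm_num)]; norm_num
  have h2 : 4 / 3 ≤ √2 := by apply Real.le_sqrt_of_sq_le; norm_num
  rw [walkBias]
  constructor <;> linarith

/-- The function `c ↦ walkBias ^ c` solves the recursion of `walkProb_rec`, whose coefficients sum
to `24/32`. So the gap to the limit shrinks at least by the factor `3/4` in each step. -/
theorem walkProb_bounds (T c : ℕ) : walkBias ^ c - (3 / 4) ^ T ≤ walkProb T (false, c) ∧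
    walkProb T (false, c) ≤ walkBias ^ c := by
  have hb := walkBias_mem
  induction T generalizing c with
  | zero =>
    cases c with
    | zero => simp [walkProb, coinExp, walkSuccess]
    | succ c =>
      have h1 : walkProb 0 (false, c + 1) = 0 := by simp [walkProb, coinExp, walkSuccess]
      have h2 : walkBias ^ (c + 1) ≤ 1 := pow_le_one₀ hb.1 hb.2
      have h3 : 0 ≤ walkBias ^ (c + 1) := pow_nonneg hb.1 _
      rw [h1, pow_zero]
      constructor <;> linarith
  | succ T ih =>
    cases c with
    | zero =>
      rw [walkProb_zero, pow_zero]
      have : (0 : ℝ) ≤ (3 / 4) ^ (T + 1) := by positivity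
      constructor <;> linarith
    | succ c =>
      have h0 := ih c
      have h1 := ih (c + 1)
      have h2 := ih (c + 2)
      have e : walkBias ^ (c + 1) =
          (9 * walkBias ^ c + walkBias ^ (c + 2) + 14 * walkBias ^ (c + 1)) / 32 := by
        linear_combination walkBias ^ c * walkBias_eq
      rw [walkProb_rec, e, pow_succ (3 / 4 : ℝ) T]
      constructor <;> linarith [h0.1, h0.2, h1.1, h1.2, h2.1, h2.2]

/-! ### Sampling of pair states -/

/-- A random pair state: whether the weight is zero, whether it is negative, and the state. The
second component contains the remaining coins. -/
def drawPair (T : ℕ) (l : List Bool) : (Bool × Bool × PairState) × List Bool :=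
  let b₁ := l.headD false
  let b₂ := l.tail.headD false
  let b₃ := l.tail.tail.headD false
  let b₄ := l.tail.tail.tail.headD false
  let b₅ := l.tail.tail.tail.tail.headD false
  let b₆ := l.tail.tail.tail.tail.tail.headD false
  let r := walkStep^[T] ((false, 1), l.tail.tail.tail.tail.tail.tail)
  ((b₁ && b₂ && b₃ && b₄ && !walkSuccess r.1, b₁ && b₂,
    bif b₁ && b₂ then (true, b₅, !(b₃ && b₄)) else (false, b₅, b₆)), r.2)

/-- Add a random pair state to a list, keeping track of the product of the weights. -/
def pairStep (T : ℕ) (s : (Bool × Bool × List PairState) × List Bool) :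
    (Bool × Bool × List PairState) × List Bool :=
  let d := drawPair T s.2
  ((s.1.1 || d.1.1, s.1.2.1 ^^ d.1.2.1, d.1.2.2 :: s.1.2.2), d.2)

/-- All coins, including those of the walk, are consumed even if the drawn state does not depend on
them, so successive draws occupy fixed segments of the row. -/
theorem drawPair_append (T : ℕ) (u v : List Bool) (hu : u.length = 6 + T * 5) :
    drawPair T (u ++ v) = ((drawPair T u).1, v) := by
  rcases u with _ | ⟨b₁, _ | ⟨b₂, _ | ⟨b₃, _ | ⟨b₄, _ | ⟨b₅, _ | ⟨b₆, u⟩⟩⟩⟩⟩⟩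
  iterate 6 (simp only [List.length_cons, List.length_nil] at hu; omega)
  have hu' : u.length = T * 5 := by simp only [List.length_cons] at hu; omega
  have h := reads_walkStep.iterate T (false, 1) u v hu'
  simp only [drawPair, List.cons_append, List.tail_cons, List.headD_cons, h]

theorem reads_pairStep (T : ℕ) : Reads (6 + T * 5) (pairStep T) := by
  intro x u v hu
  simp only [pairStep, drawPair_append T u v hu]

/-- The weight `0`, `1` or `-1`. -/
def weight (zero neg : Bool) : ℝ := signVal (!zero, neg)

theorem weight_mul (z n z' n' : Bool) :
    weight (z || z') (n ^^ n') = weight z n * weight z' n' := by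
  cases z <;> cases n <;> cases z' <;> cases n' <;> simp [weight, signVal]

/-- The weighted mean of the expectations of `a ⊗ b`. -/
noncomputable def pairMean (T : ℕ) (a b : Letter) : ℝ :=
  coinExp (6 + T * 5) (fun v => weight (drawPair T v).1.1 (drawPair T v).1.2.1 *
    signVal (pairExp (drawPair T v).1.2.2 a b))

/-- The first two coins choose a Bell-like state with probability `1/4` and a product state
otherwise. Among the former the sign is negative with probability `3/4`; the positive ones count
only if the walk succeeds. -/
theorem pairMean_eq (T : ℕ) (a b : Letter) : pairMean T a b =
    (3 / 16) * (signVal (pairExp (false, false, false) a b) +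
      signVal (pairExp (false, false, true) a b) + signVal (pairExp (false, true, false) a b) +
      signVal (pairExp (false, true, true) a b)) -
    (3 / 32) * (signVal (pairExp (true, false, true) a b) +
      signVal (pairExp (true, true, true) a b)) -
    (1 / 32) * walkProb T (false, 1) * (signVal (pairExp (true, false, false) a b) +
      signVal (pairExp (true, true, false) a b)) := by
  have h : ∀ x : ℝ, coinExp (T * 5) (fun v =>
      weight (!walkSuccess (walkStep^[T] ((false, 1), v)).1) true * x) =
      -(walkProb T (false, 1) * x) := by
    intro x
    rw [coinExp_mul_right, walkProb, ← neg_mul, ← neg_one_mul, ← coinExp_mul_left]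
    congr 2
    funext v
    cases walkSuccess (walkStep^[T] ((false, 1), v)).1 <;> simp [weight, signVal]
  rw [pairMean, coinExp_append]
  have h0 : weight false false = 1 := by simp [weight, signVal]
  have h1 : weight false true = -1 := by simp [weight, signVal]
  simp [coinExp, drawPair, h, coinExp_const, h0, h1]
  ring

/-- The number `(4/3) √2`, to which the weights of the pair states sum up. -/
noncomputable def pairNorm : ℝ := 4 / 3 * √2

theorem pairNorm_pos : 0 < pairNorm := by rw [pairNorm]; positivity

/-- With `f = 9 - 6 √2` in place of the walk probability the two sides agree for each of the 16
words. For the trivial word, for instance, the mean is `(9 - f) / 16 = (3/8) √2`, the inverse of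
`pairNorm`. -/
theorem pairMean_approx (T : ℕ) (a b : Letter) :
    |pairMean T a b - magicLetter a * magicLetter b / pairNorm| ≤ (3 / 4) ^ T := by
  have h := walkProb_bounds T 1
  rw [pow_one] at h
  have hs : √2 ^ 2 = 2 := Real.sq_sqrt (by norm_num)
  have hinv : (1 : ℝ) / pairNorm = 3 / 8 * √2 := by
    rw [div_eq_iff pairNorm_pos.ne', pairNorm]
    linear_combination (-1 / 2 : ℝ) * hs
  have hpos : (0 : ℝ) ≤ (3 / 4) ^ T := by positivity
  have hcub : √2 / 2 * (√2 / 2) * (3 / 8 * √2) = 3 / 16 * √2 := by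
    linear_combination (3 / 32 * √2) * hs
  rw [div_eq_mul_one_div, hinv, pairMean_eq]
  rw [walkBias] at h
  generalize walkProb T (false, 1) = f at h
  obtain ⟨h1, h2⟩ := h
  obtain ⟨a1, a2⟩ := a
  obtain ⟨b1, b2⟩ := b
  rw [abs_le]
  cases a1 <;> cases a2 <;> cases b1 <;> cases b2 <;>
    simp only [signVal, pairExp, magicLetter] <;> norm_num <;> constructor <;> nlinarith

theorem pairMean_le (T : ℕ) (a b : Letter) : |pairMean T a b| ≤ 1 := by
  have h : ∀ v, |weight (drawPair T v).1.1 (drawPair T v).1.2.1 *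
      signVal (pairExp (drawPair T v).1.2.2 a b)| ≤ 1 := by
    intro v
    have h1 : ∀ e, |signVal e| ≤ 1 := by
      intro e
      rcases e with ⟨e1, e2⟩
      cases e1 <;> cases e2 <;> simp [signVal]
    rw [abs_mul]
    exact mul_le_one₀ (h1 _) (abs_nonneg _) (h1 _)
  rw [abs_le, pairMean]
  constructor
  · rw [← coinExp_const (6 + T * 5) (-1)]
    exact coinExp_mono fun l _ => (abs_le.1 (h l)).1
  · rw [← coinExp_const (6 + T * 5) 1]
    exact coinExp_mono fun l _ => (abs_le.1 (h l)).2

/-! ### Sampling of products of pair states -/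

/-- A random product of `m` pair states. -/
def drawPairs (T m : ℕ) (v : List Bool) : (Bool × Bool × List PairState) × List Bool :=
  (pairStep T)^[m] ((false, false, []), v)

theorem drawPairs_append (T m : ℕ) (u v : List Bool) (hu : u.length = m * (6 + T * 5)) :
    drawPairs T m (u ++ v) = ((drawPairs T m u).1, v) :=
  (reads_pairStep T).iterate m _ u v hu

theorem drawPairs_succ (T m : ℕ) (v : List Bool) :
    drawPairs T (m + 1) v = pairStep T (drawPairs T m v) :=
  Function.iterate_succ_apply' _ _ _

theorem drawPairs_length (T m : ℕ) (v : List Bool) : (drawPairs T m v).1.2.2.length = m := by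
  induction m with
  | zero => rfl
  | succ m ih => rw [drawPairs_succ, pairStep, List.length_cons, ih]

/-- The weighted mean of the expectations of a word. -/
noncomputable def pairsMean (T : ℕ) : List Letter → ℝ
  | a :: b :: w => pairMean T a b * pairsMean T w
  | _ => 1

theorem coinExp_drawPairs (T m : ℕ) (w : List Letter) (hw : w.length = 2 * m) :
    coinExp (m * (6 + T * 5)) (fun v => weight (drawPairs T m v).1.1 (drawPairs T m v).1.2.1 *
      wordExp (drawPairs T m v).1.2.2 w) = pairsMean T w := by
  induction m generalizing w with
  | zero =>
    obtain rfl : w = [] := List.eq_nil_of_length_eq_zero (by simpa using hw)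
    rw [Nat.zero_mul]
    simp [coinExp, drawPairs, weight, signVal, wordExp, pairsMean]
  | succ m ih =>
    match w, hw with
    | a :: b :: w, hw =>
      have hw' : w.length = 2 * m := by simp only [List.length_cons] at hw; omega
      -- New states are put in front, so the first two letters belong to the last segment of coins;
      -- it is independent of the earlier ones, and the mean factorizes.
      rw [Nat.succ_mul, coinExp_append, pairsMean, ← ih w hw', ← coinExp_mul_left]
      refine coinExp_congr fun u hu => ?_
      rw [pairMean, ← coinExp_mul_right]
      refine coinExp_congr fun v _ => ?_
      simp only [drawPairs_succ, drawPairs_append T m u v hu, pairStep, wordExp]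
      rw [Bool.xor_comm, Bool.or_comm, weight_mul]
      ring
    | [], hw => simp at hw
    | [_], hw => simp only [List.length_cons, List.length_nil] at hw; omega

theorem magicLetter_mem (a : Letter) : 0 ≤ magicLetter a ∧ magicLetter a ≤ 1 := by
  have h1 : √2 ≤ 2 := by rw [Real.sqrt_le_left (by norm_num)]; norm_num
  have h2 : 0 ≤ √2 := Real.sqrt_nonneg _
  rw [magicLetter]
  split_ifs <;> constructor <;> linarith

theorem one_le_pairNorm : 1 ≤ pairNorm := by
  have h2 : 4 / 3 ≤ √2 := by apply Real.le_sqrt_of_sq_le; norm_num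
  rw [pairNorm]
  linarith

theorem magicLetter_prod_mem (w : List Letter) :
    0 ≤ (w.map magicLetter).prod ∧ (w.map magicLetter).prod ≤ 1 := by
  induction w with
  | nil => simp
  | cons a w ih =>
    have := magicLetter_mem a
    rw [List.map_cons, List.prod_cons]
    exact ⟨mul_nonneg this.1 ih.1, mul_le_one₀ this.2 ih.1 ih.2⟩

/-- The factors are exchanged one at a time, and the others have absolute value at most `1`, so the
errors add up. -/
theorem pairsMean_approx (T m : ℕ) (w : List Letter) (hw : w.length = 2 * m) :
    |pairsMean T w - (w.map magicLetter).prod / pairNorm ^ m| ≤ m * (3 / 4) ^ T := by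
  induction m generalizing w with
  | zero =>
    obtain rfl : w = [] := List.eq_nil_of_length_eq_zero (by simpa using hw)
    simp [pairsMean]
  | succ m ih =>
    match w, hw with
    | a :: b :: w, hw =>
      have hw' : w.length = 2 * m := by simp only [List.length_cons] at hw; omega
      have h1 := ih w hw'
      have h2 := pairMean_approx T a b
      have h3 := pairMean_le T a b
      have hR : (1 : ℝ) ≤ pairNorm ^ m := one_le_pow₀ one_le_pairNorm
      have h4 : |(w.map magicLetter).prod / pairNorm ^ m| ≤ 1 := by
        have := magicLetter_prod_mem w
        rw [abs_of_nonneg (div_nonneg this.1 (by linarith)), div_le_one (by linarith)]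
        linarith
      simp only [pairsMean, List.map_cons, List.prod_cons]
      have e : pairMean T a b * pairsMean T w -
          magicLetter a * (magicLetter b * (w.map magicLetter).prod) / pairNorm ^ (m + 1) =
          pairMean T a b * (pairsMean T w - (w.map magicLetter).prod / pairNorm ^ m) +
          (pairMean T a b - magicLetter a * magicLetter b / pairNorm) *
            ((w.map magicLetter).prod / pairNorm ^ m) := by
        have := pairNorm_pos.ne'
        field_simp
        ring
      rw [e]
      refine (abs_add_le _ _).trans ?_
      rw [abs_mul, abs_mul]
      have h5 := mul_le_mul h3 h1 (abs_nonneg _) zero_le_one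
      have h6 := mul_le_mul h2 h4 (abs_nonneg _) (by positivity)
      push_cast
      linarith
    | [], hw => simp at hw
    | [_], hw => simp only [List.length_cons, List.length_nil] at hw; omega

/-! ### One sample of the simulation -/

/-- One sample: whether its value is nonzero, and whether it is negative. -/
def samplePBC (T m n : ℕ) (W : List Bool → PauliWord) (O : List Bool → Bool) (row : List Bool) :
    Bool × Bool :=
  let r := drawPairs T m row
  (!r.1.1 && O (simRun r.1.2.2 W n [] [] r.2), r.1.2.1)

theorem simRun_append (S : List PairState) (W : List Bool → PauliWord) (j : ℕ)
    (U : List (PauliWord × PauliWord)) (h u v : List Bool) (hu : u.length = j) :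
    simRun S W j U h (u ++ v) = simRun S W j U h u := by
  induction j generalizing U h u with
  | zero => rfl
  | succ j ih =>
    match u, hu with
    | b :: u, hu =>
      simp only [simRun, List.cons_append, List.headD_cons, List.tail_cons]
      exact ih _ _ u (by simpa using hu)

/-- A row consists of the coins for the states, `n` coins for the measurements, and `e` surplus
coins that bring it to a prescribed length. -/
theorem coinExp_samplePBC {N : ℕ} (T m n e : ℕ) (hN : N = 2 * m) (W : List Bool → PauliWordOn N)
    (hW : ∀ h, W h * W h = 1) (O : List Bool → Bool) :
    coinExp (m * (6 + T * 5) + (n + e))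
      (fun row => signVal (samplePBC T m n (fun h => (W h).1) O row)) =
    adaptive W O n (fun g : PauliWordOn N => if g.1.1 then 0 else
      bitSign g.1.2.1 * pairsMean T g.1.2.2) [] := by
  have e1 : (fun g : PauliWordOn N => if g.1.1 then 0 else
      bitSign g.1.2.1 * pairsMean T g.1.2.2) = fun g => coinExp (m * (6 + T * 5)) (fun v =>
        ((weight (drawPairs T m v).1.1 (drawPairs T m v).1.2.1) •
          pauliFunctional (drawPairs T m v).1.2.2 N) g) := by
    funext g
    obtain ⟨⟨x, s, w⟩, hw⟩ := g
    simp only [Pi.smul_apply, pauliFunctional, pauliExp_eq, smul_eq_mul]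
    cases x
    · simp only [Bool.false_eq_true, if_false]
      rw [← coinExp_drawPairs T m w (Eq.trans hw hN), ← coinExp_mul_left]
      refine coinExp_congr fun v _ => ?_
      ring
    · simp only [if_true, mul_zero, coinExp_const]
  rw [e1, adaptive_coinExp, coinExp_append]
  refine coinExp_congr fun u hu => ?_
  rw [adaptive_smul]
  have := adaptive_eq_coinExp (drawPairs T m u).1.2.2
    (hN.trans (by rw [drawPairs_length])) W hW O n [] (by simp) []
  rw [conjugated] at this
  rw [this, coinExp_append, ← coinExp_mul_left]
  refine coinExp_congr fun v hv => ?_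
  rw [← coinExp_const e (weight _ _ * _)]
  refine coinExp_congr fun x _ => ?_
  simp only [samplePBC, drawPairs_append T m u _ hu, List.map_nil,
    simRun_append _ _ n [] [] v x hv, weight, signVal]
  cases (drawPairs T m u).1.1 <;> simp

theorem samplePBC_mean {n N : ℕ} (Q : PBC n) (hn : n ≤ N) (T m e : ℕ) (hN : N = 2 * m) :
    |pairNorm ^ m * coinExp (m * (6 + T * 5) + (n + e))
      (fun row => signVal (samplePBC T m n (fun h => (Q.wordAt N hn h).1) Q.outAt row)) -
      Q.probOne| ≤ pairNorm ^ m * (2 ^ n * (m * (3 / 4) ^ T)) := by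
  rw [coinExp_samplePBC T m n e hN (Q.wordAt N hn) (fun h => hermitianWordOn_mul_self _ _),
    Q.probOne_eq_adaptive N hn]
  have hR : (0 : ℝ) < pairNorm ^ m := pow_pos pairNorm_pos m
  set F : PauliWordOn N → ℝ := fun g => if g.1.1 then 0 else bitSign g.1.2.1 * pairsMean T g.1.2.2
  set G : PauliWordOn N → ℝ := fun g => magicExp g.1
  -- The sampled functional is the rescaled magic functional plus the truncation error of the walks.
  -- The error is propagated crudely through all `2 ^ n` branches, which is harmless because it
  -- decreases exponentially in `T`.
  have e1 : F = (1 / pairNorm ^ m) • G + (F - (1 / pairNorm ^ m) • G) := by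
    funext g
    simp only [Pi.add_apply, Pi.sub_apply]
    ring
  have h1 : ∀ g, |(F - (1 / pairNorm ^ m) • G) g| ≤ m * (3 / 4) ^ T := by
    intro g
    obtain ⟨⟨x, s, w⟩, hw⟩ := g
    have hb : |bitSign s| = 1 := by cases s <;> simp [bitSign]
    simp only [F, G, Pi.sub_apply, Pi.smul_apply, smul_eq_mul, magicExp]
    cases x
    · simp only [Bool.false_eq_true, if_false]
      have := pairsMean_approx T m w (Eq.trans hw hN)
      rw [show bitSign s * pairsMean T w - 1 / pairNorm ^ m *
        (bitSign s * (w.map magicLetter).prod) = bitSign s *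
          (pairsMean T w - (w.map magicLetter).prod / pairNorm ^ m) by ring, abs_mul, hb, one_mul]
      exact this
    · simp only [if_true, mul_zero, sub_zero, abs_zero]
      positivity
  have h2 := abs_adaptive_le (Q.wordAt N hn) Q.outAt n _ [] h1
  rw [e1, adaptive_add, adaptive_smul]
  rw [show ∀ a b : ℝ, pairNorm ^ m * (1 / pairNorm ^ m * a + b) - a = pairNorm ^ m * b by
    intro a b; field_simp; ring, abs_mul, abs_of_pos hR]
  exact mul_le_mul_of_nonneg_left h2 hR.le

/-! ## Pairwise independent rows -/

/-- The sum of two rows of bits. -/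
def xorRow (a b : List Bool) : List Bool := List.zipWith xor a b

theorem xorRow_length {B : ℕ} {a b : List Bool} (ha : a.length = B) (hb : b.length = B) :
    (xorRow a b).length = B := by
  simp [xorRow, ha, hb]

theorem xorRow_assoc (a b c : List Bool) : xorRow (xorRow a b) c = xorRow a (xorRow b c) := by
  induction a generalizing b c with
  | nil => simp [xorRow]
  | cons x a ih =>
    match b, c with
    | [], _ => simp [xorRow]
    | y :: b, [] => simp [xorRow]
    | y :: b, z :: c =>
      have := ih b c
      simp only [xorRow, List.zipWith_cons_cons, Bool.xor_assoc] at this ⊢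
      rw [this]

theorem xorRow_comm (a b : List Bool) : xorRow a b = xorRow b a := by
  rw [xorRow, List.zipWith_comm]
  congr 1
  funext x y
  exact Bool.xor_comm _ _

theorem xorRow_replicate_false (B : ℕ) (a : List Bool) (ha : a.length = B) :
    xorRow a (List.replicate B false) = a := by
  induction a generalizing B with
  | nil => simp [xorRow]
  | cons x a ih =>
    subst ha
    have := ih _ rfl
    simp only [xorRow, List.length_cons, List.replicate_succ, List.zipWith_cons_cons,
      Bool.xor_false] at this ⊢
    rw [this]

/-- Translations preserve the uniform distribution on bit strings. -/
theorem coinExp_xorRow (B : ℕ) (f : List Bool → ℝ) (b : List Bool) (hb : b.length = B) :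
    coinExp B (fun a => f (xorRow a b)) = coinExp B f := by
  induction B generalizing f b with
  | zero => simp [coinExp, xorRow]
  | succ B ih =>
    match b, hb with
    | c :: b, hb =>
      have hb' : b.length = B := by simpa using hb
      have h1 : ∀ x, coinExp B (fun a => f (xorRow (x :: a) (c :: b))) =
          coinExp B (fun a => f ((x ^^ c) :: a)) := fun x => ih (fun a => f ((x ^^ c) :: a)) b hb'
      rw [coinExp, coinExp, h1, h1]
      cases c
      · rfl
      · simp only [Bool.xor_true, Bool.not_false, Bool.not_true]
        ring

theorem coinExp_list_sum {α : Type} (B : ℕ) (L : List α) (F : α → List Bool → ℝ) :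
    coinExp B (fun a => (L.map fun o => F o a).sum) = (L.map fun o => coinExp B (F o)).sum := by
  induction L with
  | nil => simp [coinExp_const]
  | cons o L ih =>
    simp only [List.map_cons, List.sum_cons]
    rw [coinExp_add_fun, ih]

/-- Double a list of rows by adding a random row, unless there are at least `m` rows. The second
component contains the remaining coins. -/
def doubleRows (B m : ℕ) (s : List (List Bool) × List Bool) : List (List Bool) × List Bool :=
  (bif decide (s.1.length < m) then s.1 ++ s.1.map (xorRow (s.2.take B)) else s.1, s.2.drop B)

/-- The number of rows after one doubling. -/
def doubleCount (m x : ℕ) : ℕ := bif decide (x < m) then x + x else x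

/-- The number of rows does not depend on the coins; hence the sample number can be recomputed for
the denominator. -/
theorem doubleRows_length (B m : ℕ) (s : List (List Bool) × List Bool) :
    (doubleRows B m s).1.length = doubleCount m s.1.length := by
  rw [doubleRows, doubleCount]
  cases decide (s.1.length < m) <;> simp

theorem doubleRows_iterate_length (B m ℓ : ℕ) (s : List (List Bool) × List Bool) :
    ((doubleRows B m)^[ℓ] s).1.length = (doubleCount m)^[ℓ] s.1.length := by
  induction ℓ generalizing s with
  | zero => rfl
  | succ ℓ ih => rw [Function.iterate_succ_apply, ih, doubleRows_length, Function.iterate_succ_apply]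

theorem reads_doubleRows (B m : ℕ) : Reads B (doubleRows B m) := by
  intro x u v hu
  simp only [doubleRows, ← hu, List.take_left, List.drop_left, List.take_length]

/-- Doubling stops at the first value that is at least `m`, so it overshoots at most by a factor 2.
-/
theorem doubleCount_iterate (m ℓ x : ℕ) (hx : 1 ≤ x) (h : x ≤ 2 * m) (hm : m ≤ 2 ^ ℓ * x) :
    m ≤ (doubleCount m)^[ℓ] x ∧ (doubleCount m)^[ℓ] x ≤ 2 * m := by
  induction ℓ generalizing x with
  | zero => exact ⟨by simpa using hm, h⟩
  | succ ℓ ih =>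
    rw [Function.iterate_succ_apply]
    by_cases hxm : x < m
    · have e : doubleCount m x = x + x := by simp [doubleCount, hxm]
      rw [e]
      refine ih _ (by omega) (by omega) ?_
      rw [pow_succ] at hm
      calc m ≤ _ := hm
        _ = _ := by ring
    · have e : doubleCount m x = x := by simp [doubleCount, hxm]
      rw [e]
      refine ih _ hx h ?_
      have : 1 ≤ 2 ^ ℓ := Nat.one_le_two_pow
      nlinarith

/-- The mean of the square of the sum of the values of `g` on the shifts of a row. -/
noncomputable def rowsMoment (B : ℕ) (g : List Bool → ℝ) (L : List (List Bool)) : ℝ :=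
  coinExp B (fun b => (L.map fun o => g (xorRow b o)).sum ^ 2)

/-- For independent uniform `a` and `b` the rows `b` and `b + a` are independent, so the cross term
of the squared sum has mean zero, and each of the two halves contributes the old moment. -/
theorem rowsMoment_double {B : ℕ} {g : List Bool → ℝ} (hg : coinExp B g = 0)
    {L : List (List Bool)} (hL : ∀ o ∈ L, o.length = B) :
    coinExp B (fun a => rowsMoment B g (L ++ L.map (xorRow a))) = 2 * rowsMoment B g L := by
  set F : List Bool → ℝ := fun b => (L.map fun o => g (xorRow b o)).sum with hF
  have e : ∀ a b : List Bool, ((L ++ L.map (xorRow a)).map fun o => g (xorRow b o)).sum =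
      F b + F (xorRow b a) := by
    intro a b
    rw [List.map_append, List.sum_append, List.map_map]
    congr 2
    refine List.map_congr_left fun o _ => ?_
    simp only [Function.comp_apply, xorRow_assoc]
  have h0 : coinExp B F = 0 := by
    rw [hF, coinExp_list_sum]
    apply List.sum_eq_zero
    intro x hx
    obtain ⟨o, ho, rfl⟩ := List.mem_map.1 hx
    rw [coinExp_xorRow B g o (hL o ho), hg]
  -- For fixed `b` the shift `b + a` is uniform in `a`, and `F` has mean zero.
  have hcross : coinExp B (fun a => coinExp B (fun b => F b * F (xorRow b a))) = 0 := by
    have hswap : ∀ (j i : ℕ) (f : List Bool → List Bool → ℝ),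
        coinExp j (fun a => coinExp i (fun b => f a b)) =
          coinExp i (fun b => coinExp j (fun a => f a b)) := by
      intro j
      induction j with
      | zero => intro i f; rfl
      | succ j ih =>
        intro i f
        simp only [coinExp, ih]
        rw [← coinExp_add_fun, div_eq_mul_inv, ← coinExp_mul_right]
        rfl
    rw [hswap, ← coinExp_const B 0]
    refine coinExp_congr fun b hb => ?_
    rw [coinExp_mul_left]
    have : coinExp B (fun a => F (xorRow b a)) = 0 := by
      simp only [xorRow_comm b]
      rw [coinExp_xorRow B F b hb, h0]
    rw [this, mul_zero]
  have hsq : ∀ a : List Bool, a.length = B → rowsMoment B g (L ++ L.map (xorRow a)) =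
      2 * rowsMoment B g L + 2 * coinExp B (fun b => F b * F (xorRow b a)) := by
    intro a ha
    rw [rowsMoment, rowsMoment]
    simp only [e]
    have e1 : (fun b => (F b + F (xorRow b a)) ^ 2) = fun b => F b ^ 2 + F (xorRow b a) ^ 2 +
        2 * (F b * F (xorRow b a)) := by
      funext b; ring
    rw [e1, coinExp_add_fun, coinExp_add_fun, coinExp_mul_left,
      coinExp_xorRow B (fun b => F b ^ 2) a ha]
    ring
  rw [coinExp_congr hsq, coinExp_add_fun, coinExp_const, coinExp_mul_left, hcross]
  ring

/-- The second moment grows linearly with the number of rows, exactly as for independent samples.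
Both sides are multiplied by the initial number of rows to avoid a division. -/
theorem rowsMoment_iterate {B : ℕ} {g : List Bool → ℝ} (hg : coinExp B g = 0) (m ℓ : ℕ)
    {L : List (List Bool)} (hL : ∀ o ∈ L, o.length = B) :
    coinExp (ℓ * B) (fun u => rowsMoment B g ((doubleRows B m)^[ℓ] (L, u)).1) * L.length =
      (doubleCount m)^[ℓ] L.length * rowsMoment B g L := by
  induction ℓ generalizing L with
  | zero => simp [coinExp, mul_comm]
  | succ ℓ ih =>
    rw [Nat.succ_mul, Nat.add_comm, coinExp_append, Function.iterate_succ_apply]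
    simp only [Function.iterate_succ_apply]
    by_cases hm : L.length < m
    · have e : ∀ a, a.length = B → coinExp (ℓ * B) (fun v => rowsMoment B g
          ((doubleRows B m)^[ℓ] (doubleRows B m (L, a ++ v))).1) * (2 * L.length) =
          (doubleCount m)^[ℓ] (L.length + L.length) * rowsMoment B g (L ++ L.map (xorRow a)) := by
        intro a ha
        have h1 : ∀ v, doubleRows B m (L, a ++ v) = (L ++ L.map (xorRow a), v) := by
          intro v
          rw [reads_doubleRows B m _ _ _ ha]
          simp [doubleRows, hm, ← ha]
        have hL' : ∀ o ∈ L ++ L.map (xorRow a), o.length = B := by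
          intro o ho
          rcases List.mem_append.1 ho with ho | ho
          · exact hL o ho
          · obtain ⟨o', ho', rfl⟩ := List.mem_map.1 ho
            exact xorRow_length ha (hL o' ho')
        have := ih hL'
        simp only [h1]
        rw [List.length_append, List.length_map] at this
        rw [← this]
        push_cast
        ring
      have h2 : doubleCount m L.length = L.length + L.length := by simp [doubleCount, hm]
      rw [h2]
      have h3 := coinExp_congr e
      rw [coinExp_mul_right, coinExp_mul_left, rowsMoment_double hg hL] at h3
      linarith
    · have e : ∀ a, a.length = B → coinExp (ℓ * B) (fun v => rowsMoment B g
          ((doubleRows B m)^[ℓ] (doubleRows B m (L, a ++ v))).1) * L.length =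
          (doubleCount m)^[ℓ] L.length * rowsMoment B g L := by
        intro a ha
        have h1 : ∀ v, doubleRows B m (L, a ++ v) = (L, v) := by
          intro v
          rw [reads_doubleRows B m _ _ _ ha]
          simp [doubleRows, hm]
        simp only [h1]
        exact ih hL
      have h2 : doubleCount m L.length = L.length := by simp [doubleCount, hm]
      rw [h2, ← coinExp_mul_right, coinExp_congr e, coinExp_const]

/-! ## Sums of pairwise independent samples -/

/-- Count one sample. -/
def tallyStep (p : ℕ × ℕ) (e : Bool × Bool) : ℕ × ℕ :=
  bif e.1 then (bif e.2 then (p.1, p.2 + 1) else (p.1 + 1, p.2)) else p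

/-- The numbers of positive and of negative samples. -/
def tally (f : List Bool → Bool × Bool) (b : List Bool) (L : List (List Bool)) : ℕ × ℕ :=
  L.foldl (fun p o => tallyStep p (f (xorRow b o))) (0, 0)

theorem tally_sub (f : List Bool → Bool × Bool) (b : List Bool) (L : List (List Bool)) :
    ((tally f b L).1 : ℝ) - (tally f b L).2 = (L.map fun o => signVal (f (xorRow b o))).sum := by
  have : ∀ p : ℕ × ℕ, (((L.foldl (fun p o => tallyStep p (f (xorRow b o))) p).1 : ℝ)) -
      (L.foldl (fun p o => tallyStep p (f (xorRow b o))) p).2 =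
      (L.map fun o => signVal (f (xorRow b o))).sum + (p.1 - p.2) := by
    induction L with
    | nil => intro p; simp
    | cons o L ih =>
      intro p
      rw [List.foldl_cons, ih, List.map_cons, List.sum_cons]
      rcases f (xorRow b o) with ⟨e1, e2⟩
      cases e1 <;> cases e2 <;> simp [tallyStep, signVal] <;> ring
  simpa [tally] using this (0, 0)

theorem tally_le (f : List Bool → Bool × Bool) (b : List Bool) (L : List (List Bool)) :
    (tally f b L).1 + (tally f b L).2 ≤ L.length := by
  have : ∀ p : ℕ × ℕ, (L.foldl (fun p o => tallyStep p (f (xorRow b o))) p).1 +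
      (L.foldl (fun p o => tallyStep p (f (xorRow b o))) p).2 ≤ L.length + (p.1 + p.2) := by
    induction L with
    | nil => intro p; simp
    | cons o L ih =>
      intro p
      rw [List.foldl_cons, List.length_cons]
      refine (ih _).trans ?_
      have : (tallyStep p (f (xorRow b o))).1 + (tallyStep p (f (xorRow b o))).2 ≤
          p.1 + p.2 + 1 := by
        rcases f (xorRow b o) with ⟨e1, e2⟩
        cases e1 <;> cases e2 <;> simp [tallyStep] <;> omega
      omega
  simpa [tally] using this (0, 0)

/-- One trial: the excess of the positive samples, and the remaining coins. -/
def trial (f : List Bool → Bool × Bool) (B m ℓ : ℕ) (c : List Bool) : ℕ × List Bool :=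
  let r := (doubleRows B m)^[ℓ] ([List.replicate B false], c)
  ((tally f (r.2.take B) r.1).1 - (tally f (r.2.take B) r.1).2, r.2.drop B)

theorem trial_append (f : List Bool → Bool × Bool) (B m ℓ : ℕ) (u b v : List Bool)
    (hu : u.length = ℓ * B) (hb : b.length = B) :
    trial f B m ℓ ((u ++ b) ++ v) =
      ((tally f b ((doubleRows B m)^[ℓ] ([List.replicate B false], u)).1).1 -
        (tally f b ((doubleRows B m)^[ℓ] ([List.replicate B false], u)).1).2, v) := by
  have := (reads_doubleRows B m).iterate ℓ [List.replicate B false] u (b ++ v) hu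
  simp only [trial, List.append_assoc, this, List.take_left' hb, List.drop_left' hb]

theorem trial_le (f : List Bool → Bool × Bool) (B m ℓ : ℕ) (c : List Bool) :
    (trial f B m ℓ c).1 ≤ (doubleCount m)^[ℓ] 1 := by
  have h1 := tally_le f (((doubleRows B m)^[ℓ] ([List.replicate B false], c)).2.take B)
    ((doubleRows B m)^[ℓ] ([List.replicate B false], c)).1
  rw [doubleRows_iterate_length] at h1
  simp only [List.length_singleton] at h1
  simp only [trial]
  omega

theorem abs_signVal_le (e : Bool × Bool) : |signVal e| ≤ 1 := by
  rcases e with ⟨e1, e2⟩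
  cases e1 <;> cases e2 <;> simp [signVal]

open Classical in
/-- A trial is inaccurate with small probability. -/
theorem trial_chebyshev (f : List Bool → Bool × Bool) (B m ℓ : ℕ) (μ η p : ℝ)
    (hμ : μ = coinExp B (fun b => signVal (f b))) (hη : 0 < η) (hp : 0 ≤ p) :
    coinExp ((ℓ + 1) * B) (fun c => if ((doubleCount m)^[ℓ] 1 : ℕ) * (η + |μ - p|) <
      |((trial f B m ℓ c).1 : ℝ) - ((doubleCount m)^[ℓ] 1 : ℕ) * p| then 1 else 0) *
      (((doubleCount m)^[ℓ] 1 : ℕ) * η ^ 2) ≤ 1 := by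
  set M : ℕ := (doubleCount m)^[ℓ] 1 with hM
  rcases Nat.eq_zero_or_pos M with h0 | hMpos
  · rw [h0]; simp
  have hMpos' : (0 : ℝ) < M := by exact_mod_cast hMpos
  -- The centred sample; its variance is at most `1` because the samples lie in `[-1, 1]`.
  set g : List Bool → ℝ := fun b => signVal (f b) - μ with hgdef
  have hg : coinExp B g = 0 := by
    simp only [hgdef, sub_eq_add_neg]
    rw [coinExp_add_fun, coinExp_const, ← hμ]
    ring
  have hg2 : coinExp B (fun b => g b ^ 2) ≤ 1 := by
    have e1 : (fun b => g b ^ 2) = fun b => signVal (f b) ^ 2 + (signVal (f b) * (-2 * μ) + μ ^ 2) := by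
      funext b; simp only [hgdef]; ring
    rw [e1, coinExp_add_fun, coinExp_add_fun, coinExp_mul_right, coinExp_const, ← hμ]
    have h2 : coinExp B (fun b => signVal (f b) ^ 2) ≤ coinExp B (fun _ => 1) := by
      refine coinExp_mono fun b _ => ?_
      have := abs_le.1 (abs_signVal_le (f b))
      nlinarith
    rw [coinExp_const] at h2
    nlinarith [sq_nonneg μ]
  have hlen : ∀ o ∈ [List.replicate B false], o.length = B := by simp
  have hmom := rowsMoment_iterate hg m ℓ hlen
  have h1 : rowsMoment B g [List.replicate B false] = coinExp B (fun b => g b ^ 2) := by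
    rw [rowsMoment]
    refine coinExp_congr fun b hb => ?_
    simp [xorRow_replicate_false B b hb]
  rw [h1, List.length_singleton, Nat.cast_one, mul_one, ← hM] at hmom
  -- Markov's inequality for the square of the centred sum.
  have hkey : coinExp ((ℓ + 1) * B) (fun c => if (M : ℝ) * (η + |μ - p|) <
      |((trial f B m ℓ c).1 : ℝ) - M * p| then 1 else 0) * (M * η) ^ 2 ≤
      coinExp (ℓ * B) (fun u => rowsMoment B g
        ((doubleRows B m)^[ℓ] ([List.replicate B false], u)).1) := by
    rw [← coinExp_mul_right, Nat.succ_mul, coinExp_append]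
    refine coinExp_mono fun u hu => ?_
    rw [rowsMoment]
    refine coinExp_mono fun b hb => ?_
    have ht := trial_append f B m ℓ u b [] hu hb
    rw [List.append_nil] at ht
    rw [ht]
    set L := ((doubleRows B m)^[ℓ] ([List.replicate B false], u)).1 with hL
    have hLM : L.length = M := by rw [hL, doubleRows_iterate_length]; rfl
    have hs : (L.map fun o => g (xorRow b o)).sum =
        (L.map fun o => signVal (f (xorRow b o))).sum - M * μ := by
      rw [← hLM]
      simp only [hgdef]
      clear_value L
      clear ht hL hLM
      induction L with
      | nil => simp
      | cons o L ih => simp only [List.map_cons, List.sum_cons, ih, List.length_cons]; push_cast; ring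
    have hts := tally_sub f b L
    rw [hs, ← hts]
    split_ifs with hif
    · rw [one_mul]
      -- The subtraction is truncated at `0`. As the target `M * p` is nonnegative, this only
      -- decreases the error.
      have h3 : |(((tally f b L).1 - (tally f b L).2 : ℕ) : ℝ) - M * p| ≤
          |((tally f b L).1 : ℝ) - (tally f b L).2 - M * p| := by
        rcases le_total (tally f b L).2 (tally f b L).1 with hle | hle
        · rw [Nat.cast_sub hle]
        · rw [Nat.sub_eq_zero_of_le hle]
          have : ((tally f b L).1 : ℝ) ≤ (tally f b L).2 := by exact_mod_cast hle
          have hMp : 0 ≤ M * p := by positivity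
          rw [abs_of_nonpos (by push_cast; linarith), abs_of_nonpos (by linarith)]
          push_cast; linarith
      have h4 : |((tally f b L).1 : ℝ) - (tally f b L).2 - M * p| ≤
          |((tally f b L).1 : ℝ) - (tally f b L).2 - M * μ| + M * |μ - p| := by
        have : M * |μ - p| = |M * μ - M * p| := by
          rw [← mul_sub, abs_mul, Nat.abs_cast]
        rw [this]
        exact abs_sub_le _ _ _
      have h5 : M * η ≤ |((tally f b L).1 : ℝ) - (tally f b L).2 - M * μ| := by
        have : (M : ℝ) * (η + |μ - p|) = M * η + M * |μ - p| := by ring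
        linarith
      rw [← sq_abs (((tally f b L).1 : ℝ) - (tally f b L).2 - M * μ)]
      exact pow_le_pow_left₀ (by positivity) h5 2
    · rw [zero_mul]; positivity
  rw [hmom] at hkey
  have h6 : (M : ℝ) * coinExp B (fun b => g b ^ 2) ≤ M * 1 :=
    mul_le_mul_of_nonneg_left hg2 hMpos'.le
  have h7 := hkey.trans h6
  rw [show ((M : ℝ) * η) ^ 2 = M * (M * η ^ 2) by ring] at h7
  nlinarith

/-! ## Medians of independent trials -/

/-- Apply a randomized program repeatedly, and collect the results. -/
def collect (t : List Bool → ℕ × List Bool) (s : List ℕ × List Bool) : List ℕ × List Bool :=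
  ((t s.2).1 :: s.1, (t s.2).2)

theorem collect_length (t : List Bool → ℕ × List Bool) (y : ℕ) (s : List ℕ × List Bool) :
    ((collect t)^[y] s).1.length = y + s.1.length := by
  induction y generalizing s with
  | zero => simp
  | succ y ih => rw [Function.iterate_succ_apply, ih, collect, List.length_cons]; omega

open Classical in
/-- If every trial is bad with probability at most `1/16`, then half of the trials are bad with
exponentially small probability. -/
theorem collect_chernoff (t : List Bool → ℕ × List Bool) (C : ℕ)
    (ht : ∀ u v, u.length = C → t (u ++ v) = ((t u).1, v)) (bad : ℕ → Prop)
    (hbad : coinExp C (fun u => if bad (t u).1 then 1 else 0) ≤ 1 / 16) (y : ℕ) :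
    coinExp (y * C) (fun c => if y ≤ 2 * (((collect t)^[y] ([], c)).1.countP fun a => bad a) then
      1 else 0) ≤ (1 / 2) ^ y := by
  -- The exponential moment with base 16: each trial contributes at most `1 + 15/16 ≤ 2`.
  have h1 : ∀ (y : ℕ) (l : List ℕ), coinExp (y * C) (fun c =>
      (16 : ℝ) ^ (((collect t)^[y] (l, c)).1.countP fun a => bad a)) ≤
      2 ^ y * 16 ^ (l.countP fun a => bad a) := by
    intro y
    induction y with
    | zero => intro l; simp [coinExp]
    | succ y ih =>
      intro l
      rw [Nat.succ_mul, Nat.add_comm, coinExp_append]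
      have h2 : ∀ u : List Bool, u.length = C → coinExp (y * C) (fun v =>
          (16 : ℝ) ^ (((collect t)^[y + 1] (l, u ++ v)).1.countP fun a => bad a)) ≤
          (2 ^ y * 16 ^ (l.countP fun a => bad a)) * (1 + 15 * if bad (t u).1 then 1 else 0) := by
        intro u hu
        simp only [Function.iterate_succ_apply, collect, ht u _ hu]
        refine (ih _).trans ?_
        rw [List.countP_cons]
        split_ifs with h3 h4 h4
        · rw [pow_succ]; linarith
        · simp_all
        · simp_all
        · simp
      refine (coinExp_mono h2).trans ?_
      rw [coinExp_mul_left, coinExp_add_fun, coinExp_const, coinExp_mul_left, pow_succ]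
      have h5 : (0 : ℝ) ≤ 2 ^ y * 16 ^ (l.countP fun a => bad a) := by positivity
      have h6 := mul_le_mul_of_nonneg_left (show 1 + 15 * coinExp C
        (fun u => if bad (t u).1 then (1 : ℝ) else 0) ≤ 2 by linarith) h5
      linarith
  -- If at least half of the `y` trials are bad, the exponential is at least `16 ^ (y/2) = 4 ^ y`.
  have h7 : coinExp (y * C) (fun c => if y ≤ 2 * (((collect t)^[y] ([], c)).1.countP
      fun a => bad a) then (1 : ℝ) else 0) * 4 ^ y ≤ 2 ^ y := by
    refine le_trans ?_ ((h1 y []).trans (by simp))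
    rw [← coinExp_mul_right]
    refine coinExp_mono fun c _ => ?_
    split_ifs with h
    · rw [one_mul, show (16 : ℝ) = 4 ^ 2 by norm_num, ← pow_mul]
      exact pow_le_pow_right₀ (by norm_num) h
    · rw [zero_mul]; positivity
  rw [one_div, inv_pow, ← one_div, le_div_iff₀ (by positivity)]
  have h8 : (4 : ℝ) ^ y = 2 ^ y * 2 ^ y := by rw [← mul_pow]; norm_num
  rw [h8, ← mul_assoc] at h7
  have h9 : (0 : ℝ) < 2 ^ y := by positivity
  exact le_of_mul_le_mul_right (h7.trans (by rw [one_mul])) h9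

/-- The number of positive entries. -/
def countPos (l : List ℕ) : ℕ := l.foldl (fun c a => bif decide (0 < a) then c + 1 else c) 0

theorem countPos_eq (l : List ℕ) : countPos l = l.countP fun a => decide (0 < a) := by
  have : ∀ c, l.foldl (fun c a => bif decide (0 < a) then c + 1 else c) c =
      (l.countP fun a => decide (0 < a)) + c := by
    induction l with
    | nil => simp
    | cons a l ih =>
      intro c
      rw [List.foldl_cons, ih, List.countP_cons]
      by_cases h : 0 < a
      · simp only [h, decide_true, cond_true, if_true]; omega
      · simp [h]
  exact this 0

/-- Decrease all entries, as long as more than half of the `y` entries are positive. -/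
def medianStep (y : ℕ) (s : List ℕ × ℕ) : List ℕ × ℕ :=
  bif decide (y < countPos s.1 + countPos s.1) then (s.1.map fun a => a - 1, s.2 + 1) else s

/-- The counter `c` is the number of decrements so far. Each was made while more than half of the
entries exceeded the previous value; once the process stops it stays put. -/
theorem medianStep_iterate (y : ℕ) (l : List ℕ) (K : ℕ) :
    ∃ c ≤ K, (medianStep y)^[K] (l, 0) = (l.map fun a => a - c, c) ∧
      (∀ x < c, y < 2 * l.countP fun a => decide (x < a)) ∧
      (2 * (l.countP fun a => decide (c < a)) ≤ y ∨ c = K) := by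
  have hc : ∀ c, countPos (l.map fun a => a - c) = l.countP fun a => decide (c < a) := by
    intro c
    rw [countPos_eq, List.countP_map]
    congr 1
    funext a
    simp
  induction K with
  | zero => exact ⟨0, le_rfl, by simp, by simp, Or.inr rfl⟩
  | succ K ih =>
    obtain ⟨c, hcK, h1, h2, h3⟩ := ih
    rw [Function.iterate_succ_apply', h1, medianStep]
    simp only [hc]
    by_cases h : y < (l.countP fun a => decide (c < a)) + l.countP fun a => decide (c < a)
    · have hcK' : c = K := by
        rcases h3 with h3 | h3
        · omega
        · exact h3
      refine ⟨c + 1, by omega, ?_, ?_, Or.inr (by omega)⟩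
      · simp only [h, decide_true, cond_true, List.map_map, Prod.mk.injEq, and_true]
        refine List.map_congr_left fun a _ => ?_
        simp only [Function.comp_apply]
        omega
      · intro x hx
        rcases Nat.lt_succ_iff_lt_or_eq.1 hx with hx | rfl
        · exact h2 x hx
        · omega
    · refine ⟨c, by omega, ?_, h2, Or.inl (by omega)⟩
      simp [h]

/-- The median is accurate if less than half of the entries are not. -/
theorem median_accurate (y : ℕ) (l : List ℕ) (hl : l.length = y) (K : ℕ) (hK : ∀ a ∈ l, a ≤ K)
    (lo hi : ℝ) (bad : ℕ → Bool) (hbad : ∀ a, bad a = false → lo ≤ a ∧ (a : ℝ) ≤ hi)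
    (hcount : 2 * l.countP bad < y) :
    lo ≤ ((medianStep y)^[K] (l, 0)).2 ∧ (((medianStep y)^[K] (l, 0)).2 : ℝ) ≤ hi := by
  obtain ⟨c, hcK, h1, h2, h3⟩ := medianStep_iterate y l K
  rw [h1]
  have hsplit : ∀ p : ℕ → Bool, (∀ a ∈ l, bad a = false → p a = true → False) →
      l.countP p ≤ l.countP bad := by
    intro p hp
    refine List.countP_mono_left fun a ha hpa => ?_
    by_contra hb
    exact hp a ha (by simpa using hb) hpa
  -- Even if all `K` rounds are used, no entry exceeds `K`.
  have h4 : 2 * (l.countP fun a => decide (c < a)) ≤ y := by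
    rcases h3 with h3 | h3
    · exact h3
    · have : (l.countP fun a => decide (c < a)) = 0 := by
        rw [List.countP_eq_zero]
        intro a ha
        have := hK a ha
        simp only [decide_eq_true_eq, not_lt]
        omega
      omega
  have h5 : (l.countP fun a => decide (c < a)) + (l.countP fun a => !decide (c < a)) = y := by
    rw [← hl, List.length_eq_countP_add_countP (p := fun a => decide (c < a))]
    exact congrArg _ (List.countP_congr fun a _ => by simp)
  constructor
  · by_contra hlo
    have := hsplit (fun a => !decide (c < a)) (by
      intro a _ hb hp
      have h6 := (hbad a hb).1
      have h7 : a ≤ c := by simpa using hp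
      have h8 : (a : ℝ) ≤ c := by exact_mod_cast h7
      exact hlo (h6.trans h8))
    omega
  · by_contra hhi
    -- If `c = 0` exceeds `hi`, then no natural number is good, and all entries are bad. For
    -- positive `c` more than half of the entries exceed `c - 1`, and these are bad.
    rcases Nat.eq_zero_or_pos c with h0 | h0
    · have := hsplit (fun _ => true) (by
        intro a _ hb _
        have h6 := (hbad a hb).2
        apply hhi
        rw [h0]
        exact le_trans (by simp) h6)
      simp at this
      omega
    · have h9 := h2 (c - 1) (by omega)
      have := hsplit (fun a => decide (c - 1 < a)) (by
        intro a _ hb hp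
        have h6 := (hbad a hb).2
        have h7 : c - 1 < a := by simpa using hp
        have h8 : (c : ℝ) ≤ a := by exact_mod_cast (by omega : c ≤ a)
        exact hhi (h8.trans h6))
      omega

/-! ## Counting coin sequences -/

theorem coinExp_eq_sum (m : ℕ) (f : List Bool → ℝ) :
    coinExp m f = (∑ w : Fin m → Bool, f (List.ofFn w)) / 2 ^ m := by
  induction m generalizing f with
  | zero => simp [coinExp]
  | succ m ih =>
    rw [coinExp, ih, ih, ← (Fin.consEquiv fun _ => Bool).sum_comp, Fintype.sum_prod_type,
      Fintype.sum_bool]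
    simp only [Fin.consEquiv_apply, List.ofFn_succ, Fin.cons_zero, Fin.cons_succ]
    rw [pow_succ]
    ring

open Classical in
theorem card_coins (m : ℕ) (good : List Bool → Prop) :
    (Nat.card {w : Fin m → Bool // good (List.ofFn w)} : ℝ) / 2 ^ m =
      coinExp m (fun c => if good c then 1 else 0) := by
  rw [coinExp_eq_sum, Nat.card_eq_fintype_card, Fintype.card_subtype]
  simp

/-! ## The result of the sampling -/

/-- The median of `y` trials. -/
def medianOfTrials (f : List Bool → Bool × Bool) (B m ℓ y K : ℕ) (c : List Bool) : ℕ :=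
  ((medianStep y)^[K] (((collect (trial f B m ℓ))^[y] ([], c)).1, 0)).2

theorem reads_trial (f : List Bool → Bool × Bool) (B m ℓ : ℕ) (u v : List Bool)
    (hu : u.length = (ℓ + 1) * B) : trial f B m ℓ (u ++ v) = ((trial f B m ℓ u).1, v) := by
  rw [Nat.succ_mul] at hu
  have h1 : (u.take (ℓ * B)).length = ℓ * B := by
    rw [List.length_take]; exact Nat.min_eq_left (by omega)
  have h2 : (u.drop (ℓ * B)).length = B := by rw [List.length_drop]; omega
  have h3 := trial_append f B m ℓ _ _ v h1 h2
  have h4 := trial_append f B m ℓ _ _ [] h1 h2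
  rw [List.append_nil, List.take_append_drop] at h4
  rw [List.take_append_drop] at h3
  rw [h3, h4]

theorem collect_le (t : List Bool → ℕ × List Bool) (M : ℕ) (ht : ∀ c, (t c).1 ≤ M) (y : ℕ)
    (s : List ℕ × List Bool) (hs : ∀ a ∈ s.1, a ≤ M) : ∀ a ∈ ((collect t)^[y] s).1, a ≤ M := by
  induction y generalizing s with
  | zero => exact hs
  | succ y ih =>
    rw [Function.iterate_succ_apply]
    refine ih _ fun a ha => ?_
    rcases List.mem_cons.1 ha with rfl | ha
    · exact ht _
    · exact hs a ha

/-- Chebyshev's inequality with `16 ≤ M * η ^ 2` makes each trial bad with probability at most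
`1/16`. The trials use disjoint coins, so the exponential bound for the number of bad ones applies.
-/
theorem medianOfTrials_accurate (f : List Bool → Bool × Bool) (B m ℓ y K M : ℕ)
    (hM : M = (doubleCount m)^[ℓ] 1) (μ η p : ℝ)
    (hμ : μ = coinExp B (fun b => signVal (f b))) (hη : 0 < η) (hp : 0 ≤ p)
    (hK : M ≤ K) (h16 : 16 ≤ M * η ^ 2) :
    1 - (1 / 2 : ℝ) ^ y ≤ (Nat.card {w : Fin (y * ((ℓ + 1) * B)) → Bool //
      |(medianOfTrials f B m ℓ y K (List.ofFn w) : ℝ) - M * p| ≤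
        M * (η + |μ - p|)} : ℝ) / 2 ^ (y * ((ℓ + 1) * B)) := by
  classical
  rw [card_coins _ fun c => |(medianOfTrials f B m ℓ y K c : ℝ) - M * p| ≤ M * (η + |μ - p|)]
  have h1 := trial_chebyshev f B m ℓ μ η p hμ hη hp
  rw [← hM] at h1
  have h2 : coinExp ((ℓ + 1) * B) (fun c => if (M : ℝ) * (η + |μ - p|) <
      |((trial f B m ℓ c).1 : ℝ) - M * p| then 1 else 0) ≤ 1 / 16 := by
    have h0 : 0 ≤ coinExp ((ℓ + 1) * B) (fun c => if (M : ℝ) * (η + |μ - p|) <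
        |((trial f B m ℓ c).1 : ℝ) - M * p| then 1 else 0) := by
      refine (coinExp_const ((ℓ + 1) * B) 0).ge.trans (coinExp_mono fun c _ => ?_)
      split_ifs <;> norm_num
    nlinarith
  have h3 := collect_chernoff (trial f B m ℓ) ((ℓ + 1) * B) (reads_trial f B m ℓ)
    (fun a : ℕ => (M : ℝ) * (η + |μ - p|) < |(a : ℝ) - M * p|) h2 y
  have h4 : coinExp (y * ((ℓ + 1) * B)) (fun c => 1 + -1 *
      (if y ≤ 2 * (((collect (trial f B m ℓ))^[y] ([], c)).1.countP
        fun a : ℕ => decide ((M : ℝ) * (η + |μ - p|) < |(a : ℝ) - M * p|)) then 1 else 0)) ≤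
      coinExp (y * ((ℓ + 1) * B)) (fun c => if |(medianOfTrials f B m ℓ y K c : ℝ) - M * p| ≤
        M * (η + |μ - p|) then 1 else 0) := by
    refine coinExp_mono fun c _ => ?_
    by_cases hbad : y ≤ 2 * (((collect (trial f B m ℓ))^[y] ([], c)).1.countP
        fun a : ℕ => decide ((M : ℝ) * (η + |μ - p|) < |(a : ℝ) - M * p|))
    · rw [if_pos hbad]
      split_ifs <;> norm_num
    · rw [if_neg hbad, if_pos]
      · norm_num
      · have h5 := median_accurate y ((collect (trial f B m ℓ))^[y] ([], c)).1
          (by rw [collect_length]; rfl) K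
          (fun a ha => (collect_le _ M (fun c => (trial_le f B m ℓ c).trans hM.ge) y _ (by simp) a
            ha).trans hK)
          (M * p - M * (η + |μ - p|)) (M * p + M * (η + |μ - p|))
          (fun a : ℕ => decide ((M : ℝ) * (η + |μ - p|) < |(a : ℝ) - M * p|))
          (by
            intro a ha
            have := abs_le.1 (not_lt.1 (of_decide_eq_false ha))
            constructor <;> linarith) (by omega)
        rw [abs_le, medianOfTrials]
        constructor <;> linarith [h5.1, h5.2]
  rw [coinExp_add_fun, coinExp_const, coinExp_mul_left] at h4
  linarith

/-! ## Accuracy -/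

/-- Division by `32 / 9`, rounded down. -/
def scaleStep (d : ℕ) : ℕ := 9 * (d / 32)

/-- One rounding costs at most `9 * 31 / 32`, and `9/32 * 13 + 9 * 31 / 32 ≤ 13`, so the error never
accumulates beyond 13. -/
theorem scaleStep_iterate (j M : ℕ) :
    ((scaleStep^[j] M : ℕ) : ℝ) ≤ M / (32 / 9) ^ j ∧
      (M : ℝ) / (32 / 9) ^ j - 13 ≤ (scaleStep^[j] M : ℕ) := by
  induction j with
  | zero => simp
  | succ j ih =>
    rw [Function.iterate_succ_apply', scaleStep]
    set d := scaleStep^[j] M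
    have e : (M : ℝ) / (32 / 9) ^ (j + 1) = 9 / 32 * (M / (32 / 9) ^ j) := by
      rw [pow_succ, div_mul_eq_div_div, div_eq_mul_inv _ (32 / 9 : ℝ)]
      ring
    have h1 : ((d / 32 : ℕ) : ℝ) ≤ (d : ℝ) / 32 := by exact_mod_cast Nat.cast_div_le
    have h2 : (d : ℝ) ≤ 32 * ((d / 32 : ℕ) : ℝ) + 31 := by
      have : d ≤ 32 * (d / 32) + 31 := by omega
      exact_mod_cast this
    rw [e]
    push_cast
    constructor <;> linarith [ih.1, ih.2]

theorem pairNorm_sq : pairNorm ^ 2 = 32 / 9 := by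
  rw [pairNorm, mul_pow, Real.sq_sqrt (by norm_num)]
  norm_num

theorem pairNorm_pow (j : ℕ) : pairNorm ^ (2 * j) = (32 / 9) ^ j := by
  rw [pow_mul, pairNorm_sq]

/-! ### Output probabilities are at most one -/

theorem PBC.probOne_nonneg {n : ℕ} (Q : PBC n) : 0 ≤ Q.probOne :=
  Finset.sum_nonneg fun σ _ => by
    split_ifs
    · exact Finset.sum_nonneg fun x _ => by positivity
    · exact le_rfl

/-- Conservation of probability: at `1` the functionals after the two outcomes add up to the old
value, since `W h` is an involution and the functional is odd. -/
theorem adaptive_true {M : Type} [Monoid M] [HasDistribNeg M] {W : List Bool → M}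
    (hW : ∀ h, W h * W h = 1) {O : List Bool → Bool} (j : ℕ) {F : M → ℝ}
    (hF : ∀ g, F (-g) = -F g) (h : List Bool)
    (hO : ∀ l : List Bool, l.length = h.length + j → O l = true) : adaptive W O j F h = F 1 := by
  induction j generalizing F h with
  | zero => simp [adaptive, hO h]
  | succ j ih =>
    have hm : ∀ P : M, ∀ g, afterMeas F P (-g) = -afterMeas F P g := by
      intro P g
      simp only [afterMeas, mul_neg, neg_mul, hF]
      ring
    have hl : ∀ b, ∀ l : List Bool, l.length = (h ++ [b]).length + j → O l = true := by
      intro b l hl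
      apply hO
      rw [hl, List.length_append, List.length_singleton]
      omega
    rw [adaptive, ih (hm _) _ (hl _), ih (hm _) _ (hl _)]
    simp only [afterMeas, mul_one, hF, hW, neg_mul, mul_neg, neg_neg]
    ring

/-- Comparison with the computation that has the same measurements and always outputs `1`. -/
theorem PBC.probOne_le_one {n : ℕ} (Q : PBC n) : Q.probOne ≤ 1 := by
  let Q' : PBC n := ⟨Q.pauli, fun _ => true⟩
  have hs : ∀ σ t ht, Q'.state σ t ht = Q.state σ t ht := by
    intro σ t
    induction t with
    | zero => intro ht; rfl
    | succ t ih => intro ht; simp only [PBC.state, ih, Q']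
  have h1 : Q.probOne ≤ Q'.probOne := by
    refine Finset.sum_le_sum fun σ _ => ?_
    have h0 : 0 ≤ Q.prob σ := Finset.sum_nonneg fun x _ => by positivity
    have h2 : Q'.prob σ = Q.prob σ := by simp only [PBC.prob, hs]
    simp only [Q', if_true] at h2 ⊢
    rw [h2]
    split_ifs
    · exact le_rfl
    · exact h0
  refine h1.trans (le_of_eq ?_)
  rw [Q'.probOne_eq_adaptive n le_rfl, adaptive_true (W := Q'.wordAt n le_rfl)
    (fun h => hermitianWordOn_mul_self _ _)]
  · simp [PauliWordOn.val_one, magicExp, bitSign, trivialWord, magicLetter]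
  · intro g
    obtain ⟨⟨e, s, w⟩, hw⟩ := g
    rw [PauliWordOn.val_neg]
    cases e <;> cases s <;> simp [magicExp, pauliNeg, bitSign]
  · intro l hl
    have : ∃ σ : Fin n → Bool, l = List.ofFn σ := by
      refine ⟨fun i => l.get (Fin.cast (by simpa using hl.symm) i), ?_⟩
      apply List.ext_get
      · simpa using hl
      · intro i h1 h2; simp
    obtain ⟨σ, rfl⟩ := this
    rw [Q'.outAt_ofFn]

/-! ### Parameters of the simulation -/

/-- The number of blocks of twelve qubits. -/
def blocks (n : ℕ) : ℕ := n / 12 + 1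

/-- Equal to `5 * (2 y + 7)`; since `(3/4) ^ 5 ≤ 1/4`, the truncation error is at most `4 ^ (-(2 y +
7))`, as `walk_error` requires. -/
def walkLength (y : ℕ) : ℕ := 10 * y + 35

/-- For `y = n + k` there is room for `y + 6 ≥ 6 * blocks n` pairs of qubits and for `y ≥ n`
measurements. The length depends on `n + k` alone, as the number of coins must. -/
def rowLength (y : ℕ) : ℕ := (y + 6) * (6 + walkLength y * 5) + y

/-- Enough rounds to reach `sampleGoal`, which is at most `2 ^ (2 k + n + 19)`. -/
def doublings (y : ℕ) : ℕ := 3 * y + 19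

/-- Precision `η = 1 / (4 k R)` with `16 ≤ M * η ^ 2` requires `M ≥ 256 k ^ 2 R ^ 2`, and `R ^ 2 ≤ 2
^ (11 * blocks n)`. -/
def sampleGoal (n k : ℕ) : ℕ := 256 * (k * k) * 2 ^ (11 * blocks n)

/-- There are `y` trials; each reads one row per doubling and one row for the common shift. -/
def coinNumber (y : ℕ) : ℕ := y * ((doublings y + 1) * rowLength y)

def sampleNumber (n k : ℕ) : ℕ := (doubleCount (sampleGoal n k))^[doublings (n + k)] 1

def sampler {n : ℕ} (Q : PBC n) (y : ℕ) (row : List Bool) : Bool × Bool :=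
  samplePBC (walkLength y) (6 * blocks n) n
    (fun h => hermitianWord (12 * blocks n) (Q.pauliAt h).code) Q.outAt row

def numerator {n : ℕ} (Q : PBC n) (k : ℕ) (c : List Bool) : ℕ :=
  medianOfTrials (sampler Q (n + k)) (rowLength (n + k)) (sampleGoal n k) (doublings (n + k))
    (n + k) (2 * sampleGoal n k) c

/-- An approximation of `M / R`, where `R = (32/9) ^ (3 * blocks n)` is rational because the number
of pairs is even. -/
def denominator (n k : ℕ) : ℕ := scaleStep^[3 * blocks n] (sampleNumber n k)

theorem sampleNumber_bounds (n k : ℕ) (hk : 1 ≤ k) :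
    sampleGoal n k ≤ sampleNumber n k ∧ sampleNumber n k ≤ 2 * sampleGoal n k := by
  have h1 : 1 ≤ sampleGoal n k := by
    rw [sampleGoal]
    exact Nat.mul_pos (Nat.mul_pos (by norm_num) (Nat.mul_pos hk hk)) (by positivity)
  refine doubleCount_iterate _ _ 1 le_rfl (by omega) ?_
  rw [mul_one, sampleGoal, doublings]
  have h2 : k ≤ 2 ^ k := Nat.lt_two_pow_self.le
  have h3 : 11 * blocks n ≤ n + 11 := by rw [blocks]; omega
  calc 256 * (k * k) * 2 ^ (11 * blocks n) ≤ 2 ^ 8 * (2 ^ k * 2 ^ k) * 2 ^ (n + 11) := by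
        gcongr
        · norm_num
        · norm_num
    _ = 2 ^ (2 * k + n + 19) := by rw [← pow_add, ← pow_add, ← pow_add]; congr 1; omega
    _ ≤ 2 ^ (3 * (n + k) + 19) := Nat.pow_le_pow_right (by norm_num) (by omega)

/-- All growing factors, including the crude `2 ^ n` and the precision `k`, are at most powers of
two, with product at most `2 ^ (4 y + 14)`; the truncation error compensates exactly this. -/
theorem walk_error (n k : ℕ) (hk : 1 ≤ k) : pairNorm ^ (6 * blocks n) *
    (2 ^ n * (((6 * blocks n : ℕ) : ℝ) * (3 / 4) ^ walkLength (n + k))) ≤ 1 / (4 * k) := by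
  have hk' : (0 : ℝ) < k := by exact_mod_cast hk
  have hm : 6 * blocks n ≤ n + k + 6 := by rw [blocks]; omega
  have hR : pairNorm ≤ 2 := by
    have h2 : √2 ≤ 3 / 2 := by rw [Real.sqrt_le_left (by norm_num)]; norm_num
    rw [pairNorm]; linarith
  set y := n + k
  have h1 : pairNorm ^ (6 * blocks n) ≤ 2 ^ (y + 6) :=
    (pow_le_pow_left₀ pairNorm_pos.le hR _).trans (pow_le_pow_right₀ (by norm_num) hm)
  have h2 : (2 : ℝ) ^ n ≤ 2 ^ y := pow_le_pow_right₀ (by norm_num) (Nat.le_add_right _ _)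
  have h3 : ((6 * blocks n : ℕ) : ℝ) ≤ 2 ^ (y + 6) := by
    exact_mod_cast hm.trans Nat.lt_two_pow_self.le
  have h4 : (k : ℝ) ≤ 2 ^ y := by
    exact_mod_cast (Nat.le_add_left k n).trans Nat.lt_two_pow_self.le
  have h5 : ((3 : ℝ) / 4) ^ walkLength y ≤ (1 / 4) ^ (2 * y + 7) := by
    rw [walkLength, show 10 * y + 35 = 5 * (2 * y + 7) by ring, pow_mul]
    exact pow_le_pow_left₀ (by norm_num) (by norm_num) _
  rw [le_div_iff₀ (by positivity)]
  calc pairNorm ^ (6 * blocks n) *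
      (2 ^ n * (((6 * blocks n : ℕ) : ℝ) * (3 / 4) ^ walkLength y)) * (4 * k) ≤
      2 ^ (y + 6) * (2 ^ y * (2 ^ (y + 6) * (1 / 4) ^ (2 * y + 7))) * (4 * 2 ^ y) := by
        have := pairNorm_pos
        gcongr
    _ = 2 ^ (4 * y + 14) * (1 / 4) ^ (2 * y + 7) := by
        rw [show (4 : ℝ) = 2 ^ 2 by norm_num]
        rw [show (2 : ℝ) ^ (4 * y + 14) = 2 ^ (y + 6) * 2 ^ y * 2 ^ (y + 6) * (2 ^ 2 * 2 ^ y) by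
          rw [← pow_add, ← pow_add, ← pow_add, ← pow_add]; congr 1; omega]
        ring
    _ = 1 := by
        rw [show 4 * y + 14 = 2 * (2 * y + 7) by ring, pow_mul, ← mul_pow]
        norm_num

/-- Half of the tolerance is used for `c`. The rounding of the denominator costs at most 13 in the
numerator, which is negligible against `X ≥ 256 k ^ 2`. -/
theorem ratio_accurate {c D X p k : ℝ} (hk : 1 ≤ k) (hX : 256 * k ^ 2 ≤ X) (h1 : D ≤ X)
    (h2 : X - 13 ≤ D) (hp0 : 0 ≤ p) (hp1 : p ≤ 1) (hc : |c - X * p| ≤ X / (2 * k)) :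
    |c / D - p| ≤ 1 / k := by
  have hk2 : k ≤ k ^ 2 := le_self_pow₀ hk (by norm_num)
  have hD : 0 < D := by linarith
  have e3 : c / D - p = (c - X * p + p * (X - D)) / D := by field_simp; ring
  rw [e3, abs_div, abs_of_pos hD, div_le_div_iff₀ hD (by linarith)]
  have h5 : |c - X * p + p * (X - D)| ≤ X / (2 * k) + 13 := by
    refine (abs_add_le _ _).trans (add_le_add hc ?_)
    rw [abs_mul, abs_of_nonneg hp0, abs_of_nonneg (by linarith)]
    exact (mul_le_of_le_one_left (by linarith) hp1).trans (by linarith)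
  have h6 : (X / (2 * k) + 13) * k = X / 2 + 13 * k := by field_simp
  have h7 := mul_le_mul_of_nonneg_right h5 (by linarith : (0 : ℝ) ≤ k)
  rw [h6] at h7
  linarith

theorem simulation_accurate {n : ℕ} (Q : PBC n) (k : ℕ) (hk : 1 ≤ k) :
    1 - (1 / 2 : ℝ) ^ k ≤ (Nat.card {w : Fin (coinNumber (n + k)) → Bool //
      0 < denominator n k ∧ |(numerator Q k (List.ofFn w) : ℝ) / (denominator n k : ℝ) -
        Q.probOne| ≤ 1 / (k : ℝ)} : ℝ) / 2 ^ coinNumber (n + k) := by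
  have hk' : (1 : ℝ) ≤ k := by exact_mod_cast hk
  set p := Q.probOne with hpdef
  have hp0 : 0 ≤ p := Q.probOne_nonneg
  have hp1 : p ≤ 1 := Q.probOne_le_one
  set R := pairNorm ^ (6 * blocks n) with hR
  have hRpos : 0 < R := pow_pos pairNorm_pos _
  have hR1 : 1 ≤ R := one_le_pow₀ one_le_pairNorm
  -- This rests on `(32/9) ^ 6 ≤ 2 ^ 11`; blocks of twelve qubits are chosen to make the exponent
  -- integral.
  have hR2 : R ^ 2 ≤ 2 ^ (11 * blocks n) := by
    rw [hR, ← pow_mul, show 6 * blocks n * 2 = 2 * (6 * blocks n) by ring, pairNorm_pow,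
      pow_mul, pow_mul]
    exact pow_le_pow_left₀ (by norm_num) (by norm_num) _
  have hR3 : R = (32 / 9) ^ (3 * blocks n) := by
    rw [hR, ← pairNorm_pow]; congr 1; ring
  obtain ⟨hM1, hM2⟩ := sampleNumber_bounds n k hk
  set M := sampleNumber n k with hM
  have hM1' : 256 * (k : ℝ) ^ 2 * R ^ 2 ≤ M := by
    have : ((sampleGoal n k : ℕ) : ℝ) ≤ M := by exact_mod_cast hM1
    refine le_trans ?_ this
    rw [sampleGoal]
    push_cast
    have h0 : (0 : ℝ) ≤ 256 * (k * k) := by positivity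
    have := mul_le_mul_of_nonneg_left hR2 h0
    linarith
  set μ := coinExp (rowLength (n + k)) (fun b => signVal (sampler Q (n + k) b)) with hμ
  have hmean : |R * μ - p| ≤ 1 / (4 * k) := by
    have hn : n ≤ 12 * blocks n := by rw [blocks]; omega
    have hm : 6 * blocks n ≤ n + k + 6 := by rw [blocks]; omega
    obtain ⟨e, he⟩ : ∃ e, rowLength (n + k) =
        6 * blocks n * (6 + walkLength (n + k) * 5) + (n + e) := by
      -- The surplus consists of the segments of the missing pairs and of the `k` unneeded
      -- measurement coins.
      refine ⟨(n + k + 6 - 6 * blocks n) * (6 + walkLength (n + k) * 5) + k, ?_⟩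
      obtain ⟨i, hi⟩ := Nat.exists_eq_add_of_le hm
      rw [rowLength, hi, Nat.add_sub_cancel_left]
      ring
    have := samplePBC_mean Q hn (walkLength (n + k)) (6 * blocks n) e (by ring)
    rw [← he] at this
    exact this.trans (walk_error n k hk)
  have hbias : |μ - p / R| ≤ 1 / (4 * k * R) := by
    have e1 : μ - p / R = (R * μ - p) / R := by field_simp
    rw [e1, abs_div, abs_of_pos hRpos, ← div_div]
    exact div_le_div_of_nonneg_right hmean hRpos.le
  clear_value M R p μ
  have hη : (0 : ℝ) < 1 / (4 * k * R) := by positivity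
  have h16 : (16 : ℝ) ≤ M * (1 / (4 * k * R)) ^ 2 := by
    rw [div_pow, one_pow, mul_one_div, le_div_iff₀ (by positivity)]
    calc (16 : ℝ) * (4 * k * R) ^ 2 = 256 * (k : ℝ) ^ 2 * R ^ 2 := by ring
      _ ≤ (M : ℝ) := hM1'
  have hX : 256 * (k : ℝ) ^ 2 ≤ M / R := by
    rw [le_div_iff₀ hRpos]
    refine le_trans ?_ hM1'
    have : R ≤ R ^ 2 := le_self_pow₀ hR1 (by norm_num)
    have h0 : (0 : ℝ) ≤ 256 * k ^ 2 := by positivity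
    exact mul_le_mul_of_nonneg_left this h0
  have hmain := medianOfTrials_accurate (sampler Q (n + k)) (rowLength (n + k)) (sampleGoal n k)
    (doublings (n + k)) (n + k) (2 * sampleGoal n k) M (by rw [hM, sampleNumber]) μ
    (1 / (4 * k * R)) (p / R) hμ hη
    (by positivity) hM2 h16
  have hD := scaleStep_iterate (3 * blocks n) M
  rw [← hR3] at hD
  obtain ⟨hD1, hD2⟩ := hD
  have hDpos : 0 < denominator n k := by
    have : (0 : ℝ) < (denominator n k : ℕ) := by
      rw [denominator, ← hM]
      exact lt_of_lt_of_le (by linarith only [hX, one_le_pow₀ hk' (n := 2)]) hD2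
    exact_mod_cast this
  -- The median of `n + k` trials fails with probability at most `2 ^ (-(n + k))`, which is more
  -- than enough.
  refine le_trans (sub_le_sub_left (pow_le_pow_of_le_one (by norm_num) (by norm_num)
    (Nat.le_add_left k n)) 1) (hmain.trans ?_)
  refine div_le_div_of_nonneg_right ?_ (by positivity)
  refine Nat.cast_le.2 (Nat.card_le_card_of_injective (Subtype.map id fun w hw => ⟨hDpos, ?_⟩)
    (Subtype.map_injective _ Function.injective_id))
  set c := medianOfTrials (sampler Q (n + k)) (rowLength (n + k)) (sampleGoal n k)
    (doublings (n + k)) (n + k) (2 * sampleGoal n k) (List.ofFn w) with hc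
  show |(c : ℝ) / ((denominator n k : ℕ) : ℝ) - p| ≤ 1 / k
  rw [denominator, ← hM] at hDpos ⊢
  set D := scaleStep^[3 * blocks n] M
  set X : ℝ := M / R with hXdef
  have hw' : |(c : ℝ) - X * p| ≤ X / (2 * k) := by
    have e1 : X * p = M * (p / R) := by rw [hXdef]; ring
    rw [e1]
    refine hw.trans ?_
    have e2 : X / (2 * k) = M * (1 / (4 * k * R) + 1 / (4 * k * R)) := by
      rw [hXdef]; field_simp; ring
    rw [e2]
    exact mul_le_mul_of_nonneg_left (by linarith only [hbias]) (Nat.cast_nonneg _)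
  exact ratio_accurate hk' hX hD1 hD2 hp0 hp1 hw'

/-! ## Programs for Pauli words -/

section PauliPrograms

variable {α β γ : Type} [Enc α] [Enc β] [Enc γ]

theorem constTime_headD_of (a₀ : α) : ConstTime (fun l : List α => l.headD a₀) := by
  obtain ⟨P, c, hP⟩ := constTime_const (α := List α) a₀
  refine ⟨Prog.cond Prog.ident Prog.fst P, c + 3, fun l => ?_⟩
  cases l with
  | nil =>
    obtain ⟨t, ht, hr⟩ := hP []
    exact ⟨1 + t + 1, by omega, Runs.cond_false (Runs.ident _) hr⟩
  | cons a l => exact ⟨1 + 1 + 1, by omega, Runs.cond_true (Runs.ident _) (Runs.fst_cons _ _)⟩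

theorem ConstTime.headD {f : α → List β} (hf : ConstTime f) (b₀ : β) :
    ConstTime (fun a => (f a).headD b₀) :=
  (constTime_headD_of b₀).comp hf

theorem InTime.sub {D : γ → Prop} {a b : γ → ℕ} {T : γ → ℕ} (ha : InTime D a T)
    (hb : InTime D b T) (hT : BigO D b T) : InTime D (fun c => a c - b c) T := by
  have h := InTime.iterate (b₀ := a) (s := fun (_ : γ) m => m - 1) (B := fun _ => 0)
    (V := fun _ => 0)
    (E := fun _ => True) ((constTime_pred.comp constTime_snd).inTime) hb ha (fun _ _ _ => True)
    (fun _ _ => trivial) (fun _ _ _ _ _ => ⟨trivial, trivial, le_rfl⟩) (by simpa using hT)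
  refine h.congr fun c _ => ?_
  have : ∀ m k : ℕ, (fun m => m - 1)^[m] k = k - m := by
    intro m
    induction m with
    | zero => simp
    | succ m ih => intro k; rw [Function.iterate_succ_apply, ih]; omega
  exact this _ _

theorem ConstTime.letterMul {f g : α → Letter} (hf : ConstTime f) (hg : ConstTime g) :
    ConstTime (fun a => _root_.letterMul (f a) (g a)) :=
  (ConstTime.bool₂ (fun x y => x ^^ y) hf.fst hg.fst).pair
    (ConstTime.bool₂ (fun x y => x ^^ y) hf.snd hg.snd)

theorem foldl_mulWords (u v : List Letter) (c : Bool) (r : List Letter) :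
    (u.zip v).foldl (fun (x : Bool × List Letter) (p : Letter × Letter) =>
      ((x.1 ^^ (p.1.2 && p.2.1)), letterMul p.1 p.2 :: x.2)) (c, r) =
      ((c ^^ cocycle u v), (wordMul u v).reverse ++ r) := by
  induction u generalizing v c r with
  | nil => simp [cocycle, wordMul]
  | cons a u ih =>
    cases v with
    | nil => simp [cocycle, wordMul]
    | cons b v =>
      rw [List.zip_cons_cons, List.foldl_cons, ih]
      simp [cocycle, wordMul]

/-- A single pass computes the sign and the reversed product; the second word is consumed as part of
the loop state. -/
theorem inTime_mulWords : InTime (fun x : List Letter × List Letter => x.1.length ≤ x.2.length)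
    (fun x => (cocycle x.1 x.2, wordMul x.1 x.2)) (fun x => x.1.length) := by
  have hs : ConstTime (fun x : (List Letter × List Letter) ×
      ((Bool × List Letter) × List Letter) × Letter =>
      (((x.2.1.1.1 ^^ (x.2.2.2 && (x.2.1.2.headD (false, false)).1)),
        letterMul x.2.2 (x.2.1.2.headD (false, false)) :: x.2.1.1.2), x.2.1.2.tail)) := by
    have hst : ConstTime (fun x : (List Letter × List Letter) ×
      ((Bool × List Letter) × List Letter) × Letter => x.2.1) := constTime_snd.fst
    have ha : ConstTime (fun x : (List Letter × List Letter) ×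
      ((Bool × List Letter) × List Letter) × Letter => x.2.2) := constTime_snd.snd
    exact ((ConstTime.bool₃ (fun x y z => x ^^ (y && z)) hst.fst.fst ha.snd
      (hst.snd.headD _).fst).pair ((ha.letterMul (hst.snd.headD _)).cons hst.fst.snd)).pair
      hst.snd.tail
  have h := InTime.foldl_const (D := fun x : List Letter × List Letter => x.1.length ≤ x.2.length)
    (l := fun x => x.1) (b₀ := fun x => ((false, []), x.2)) (T := fun x => x.1.length)
    (s := fun _ p a => (((p.1.1 ^^ (a.2 && (p.2.headD (false, false)).1)),
        letterMul a (p.2.headD (false, false)) :: p.1.2), p.2.tail)) hs constTime_fst.inTime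
    ((constTime_const _).pair constTime_snd).inTime (BigO.of_le_one fun _ _ => le_rfl)
  have h2 : InTime (fun x : List Letter × List Letter => x.1.length ≤ x.2.length)
      (fun x => (cocycle x.1 x.2, (wordMul x.1 x.2).reverse)) (fun x => x.1.length) := by
    refine h.fst.congr fun x hx => ?_
    rw [foldl_zip_eq (fun (p : Bool × List Letter) a b => ((p.1 ^^ (a.2 && b.1)),
      letterMul a b :: p.2)) (false, false) x.1 x.2 (false, []) hx, foldl_mulWords]
    simp
  refine (h2.fst.pair (h2.snd.reverse (BigO.of_le_one fun x hx => ?_))).congr fun x _ => by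
    rw [List.reverse_reverse]
  simp only [wordMul, List.length_reverse, List.length_zipWith]
  exact Nat.min_le_left _ _

theorem inTime_pauliMul : InTime (fun x : PauliWord × PauliWord => x.1.2.2.length ≤ x.2.2.2.length)
    (fun x => pauliMul x.1 x.2) (fun x => x.1.2.2.length) := by
  have h := inTime_mulWords.comp (D := fun x : PauliWord × PauliWord =>
      x.1.2.2.length ≤ x.2.2.2.length) (f := fun x => (x.1.2.2, x.2.2.2))
    (T := fun x => x.1.2.2.length) (constTime_fst.snd.snd.pair constTime_snd.snd.snd).inTime
    (fun _ h => h) (BigO.of_le_one fun _ _ => le_rfl)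
  have hc : ConstTime (fun x : (PauliWord × PauliWord) × (Bool × List Letter) =>
      ((x.1.1.1 ^^ x.1.2.1), (x.1.1.2.1 ^^ x.1.2.2.1 ^^ (x.1.1.1 && x.1.2.1) ^^ x.2.1), x.2.2)) :=
    (ConstTime.bool₂ (fun x y => x ^^ y) constTime_fst.fst.fst constTime_fst.snd.fst).pair
      ((ConstTime.bool₅ (fun a b c d e => a ^^ b ^^ (c && d) ^^ e) constTime_fst.fst.snd.fst
        constTime_fst.snd.snd.fst constTime_fst.fst.fst constTime_fst.snd.fst
        constTime_snd.fst).pair constTime_snd.snd)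
  exact (hc.compIn (constTime_id.inTime.pair h)).congr fun x _ => rfl

theorem ConstTime.pauliNeg {f : α → PauliWord} (hf : ConstTime f) :
    ConstTime (fun a => _root_.pauliNeg (f a)) :=
  hf.fst.pair ((ConstTime.bool₁ (fun b => !b) hf.snd.fst).pair hf.snd.snd)

theorem pauliMul_length (P Q : PauliWord) (h : P.2.2.length = Q.2.2.length) :
    (pauliMul P Q).2.2.length = P.2.2.length :=
  wordMul_length rfl h.symm

theorem InTime.pauliMul {D : α → Prop} {f g : α → PauliWord} {T : α → ℕ} (hf : InTime D f T)
    (hg : InTime D g T) (h : ∀ a, D a → (f a).2.2.length = (g a).2.2.length)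
    (hT : BigO D (fun a => (f a).2.2.length) T) :
    InTime D (fun a => _root_.pauliMul (f a) (g a)) T :=
  inTime_pauliMul.comp (hf.pair hg) (fun a ha => (h a ha).le) hT

theorem InTime.anticommute {D : α → Prop} {f g : α → PauliWord} {T : α → ℕ} (hf : InTime D f T)
    (hg : InTime D g T) (h : ∀ a, D a → (f a).2.2.length = (g a).2.2.length)
    (hT : BigO D (fun a => (f a).2.2.length) T) :
    InTime D (fun a => _root_.anticommute (f a) (g a)) T := by
  have h1 := hf.pauliMul hg h hT
  have h2 := hg.pauliMul hf (fun a ha => (h a ha).symm) (by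
    obtain ⟨C, hC⟩ := hT
    exact ⟨C, fun a ha => by simpa only [h a ha] using hC a ha⟩)
  have hc : ConstTime (fun x : PauliWord × PauliWord => x.1.2.1 ^^ x.2.2.1) :=
    ConstTime.bool₂ (fun x y => x ^^ y) constTime_fst.snd.fst constTime_snd.snd.fst
  exact hc.compIn (h1.pair h2)

theorem pauliConj_length {P : PauliWord} {V : PauliWord × PauliWord}
    (h1 : V.1.2.2.length = P.2.2.length) (h2 : V.2.2.2.length = P.2.2.length) :
    (pauliConj P V).2.2.length = P.2.2.length := by
  have e1 : (pauliMul (pauliMul P V.2) V.1).2.2.length = P.2.2.length := by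
    rw [pauliMul_length _ _ ((pauliMul_length _ _ h2.symm).trans h1.symm),
      pauliMul_length _ _ h2.symm]
  have e2 : (pauliMul (pauliMul P V.1) V.2).2.2.length = P.2.2.length := by
    rw [pauliMul_length _ _ ((pauliMul_length _ _ h1.symm).trans h2.symm),
      pauliMul_length _ _ h1.symm]
  rw [pauliConj]
  cases anticommute P V.1 <;> cases anticommute P V.2
  · rfl
  · exact e2
  · exact e1
  · rfl

theorem inTime_pauliConj : InTime (fun x : PauliWord × PauliWord × PauliWord =>
      x.2.1.2.2.length = x.1.2.2.length ∧ x.2.2.2.2.length = x.1.2.2.length)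
    (fun x => pauliConj x.1 x.2) (fun x => x.1.2.2.length) := by
  set D := fun x : PauliWord × PauliWord × PauliWord =>
      x.2.1.2.2.length = x.1.2.2.length ∧ x.2.2.2.2.length = x.1.2.2.length with hD
  set T := fun x : PauliWord × PauliWord × PauliWord => x.1.2.2.length with hT
  have hP : InTime D (fun x => x.1) T := constTime_fst.inTime
  have hA : InTime D (fun x => x.2.1) T := constTime_snd.fst.inTime
  have hB : InTime D (fun x => x.2.2) T := constTime_snd.snd.inTime
  have h0 : BigO D (fun x => x.1.2.2.length) T := BigO.of_le_one fun _ _ => le_rfl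
  have hPA := hP.anticommute hA (fun x hx => hx.1.symm) h0
  have hPB := hP.anticommute hB (fun x hx => hx.2.symm) h0
  have h1 := (hP.pauliMul hB (fun x hx => hx.2.symm) h0).pauliMul hA
    (fun x hx => (pauliMul_length _ _ hx.2.symm).trans hx.1.symm)
    (BigO.of_le_one fun x hx => (pauliMul_length _ _ hx.2.symm).le)
  have h2 := (hP.pauliMul hA (fun x hx => hx.1.symm) h0).pauliMul hB
    (fun x hx => (pauliMul_length _ _ hx.1.symm).trans hx.2.symm)
    (BigO.of_le_one fun x hx => (pauliMul_length _ _ hx.1.symm).le)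
  have h3 : InTime D (fun x => pauliNeg x.1) T := (constTime_fst.pauliNeg).inTime
  exact hPA.cond' (hPB.cond' h3 h1) (hPB.cond' h2 hP)

/-- Conjugation by a list of pairs. -/
theorem inTime_foldl_pauliConj : InTime (fun x : List (PauliWord × PauliWord) × PauliWord =>
      ∀ V ∈ x.1, V.1.2.2.length = x.2.2.2.length ∧ V.2.2.2.length = x.2.2.2.length)
    (fun x => x.1.foldl pauliConj x.2) (fun x => x.1.length * (x.2.2.2.length + 1)) := by
  refine InTime.foldl (γ := List (PauliWord × PauliWord) × PauliWord)
    (s := fun _ P V => pauliConj P V) (B := fun x => x.2.2.2.length)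
    (E := fun x => x.2.2.1.2.2.length = x.2.1.2.2.length ∧
      x.2.2.2.2.2.length = x.2.1.2.2.length) (V := fun x => x.2.1.2.2.length)
    (inTime_pauliConj.comp constTime_snd.inTime (fun _ h => h) (BigO.of_le_one fun _ _ => le_rfl))
    constTime_fst.inTime constTime_snd.inTime
    (fun x l P => P.2.2.length = x.2.2.2.length ∧
      ∀ V ∈ l, V.1.2.2.length = x.2.2.2.length ∧ V.2.2.2.length = x.2.2.2.length)
    (fun x hx => ⟨rfl, hx⟩) ?_ (BigO.of_le_one fun _ _ => le_rfl)
  intro x V l P _ hi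
  have h1 := hi.2 V List.mem_cons_self
  have h2 : V.1.2.2.length = P.2.2.length := h1.1.trans hi.1.symm
  have h3 : V.2.2.2.length = P.2.2.length := h1.2.trans hi.1.symm
  exact ⟨⟨(pauliConj_length h2 h3).trans hi.1, fun V hV => hi.2 V (List.mem_cons_of_mem _ hV)⟩,
    ⟨h2, h3⟩, hi.1.le⟩

theorem foldl_pauliConj_length (U : List (PauliWord × PauliWord)) (P : PauliWord)
    (hU : ∀ V ∈ U, V.1.2.2.length = P.2.2.length ∧ V.2.2.2.length = P.2.2.length) :
    (U.foldl pauliConj P).2.2.length = P.2.2.length := by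
  induction U generalizing P with
  | nil => rfl
  | cons V U ih =>
    have h := hU V List.mem_cons_self
    have h1 := pauliConj_length h.1 h.2
    rw [List.foldl_cons, ih _ fun V hV => by
      rw [h1]; exact hU V (List.mem_cons_of_mem _ hV), h1]

/-! ### The probe -/

def probeStep (r : Bool × Bool × List Letter) (s : PairState) (a b : Letter) :
    Bool × Bool × List Letter :=
  bif r.1 then (true, r.2.1, (false, false) :: (false, false) :: r.2.2)
  else bif (pairExp s a b).1 then
    (false, (r.2.1 ^^ (pairExp s a b).2), (false, false) :: (false, false) :: r.2.2)
  else (true, (pairGen s a b).1, (pairGen s a b).2.1 :: (pairGen s a b).2.2 :: r.2.2)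

/-- The recursion of `probe` starts at the last pair, so the loop runs along reversed lists, where
the second letter of a pair precedes the first. The tail `z` makes the induction work. -/
theorem foldl_probeStep (S : List PairState) (w z : List Letter) (hw : w.length = 2 * S.length) :
    S.reverse.foldl (fun (p : (Bool × Bool × List Letter) × List Letter) s =>
      (probeStep p.1 s (p.2.tail.headD (false, false)) (p.2.headD (false, false)), p.2.tail.tail))
      ((false, false, []), w.reverse ++ z) = (probe S w, z) := by
  induction S generalizing w z with
  | nil =>
    obtain rfl : w = [] := List.eq_nil_of_length_eq_zero (by simpa using hw)
    rfl
  | cons s S ih =>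
    match w, hw with
    | a :: b :: w, hw =>
      have := ih w (b :: a :: z) (by simp only [List.length_cons] at hw; omega)
      simp only [List.reverse_cons, List.append_assoc, List.cons_append, List.nil_append,
        List.foldl_append]
      rw [this]
      rfl
    | [], hw => simp at hw
    | [_], hw => simp only [List.length_cons, List.length_nil] at hw; omega

theorem probe_length (S : List PairState) (w : List Letter) (hw : w.length = 2 * S.length) :
    (probe S w).2.2.length = 2 * S.length := by
  induction S generalizing w with
  | nil => simp [probe]
  | cons s S ih =>
    match w, hw with
    | a :: b :: w, hw =>
      have := ih w (by simp only [List.length_cons] at hw; omega)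
      simp only [probe]
      cases (probe S w).1 <;> cases (pairExp s a b).1 <;> simp [this, mul_add]
    | [], hw => simp at hw
    | [_], hw => simp only [List.length_cons, List.length_nil] at hw; omega

theorem constTime_bool_prod {f : α → PairState × Letter × Letter} (hf : ConstTime f)
    (F : PairState × Letter × Letter → β) : ConstTime (fun a => F (f a)) :=
  (ConstTime.bool₇ (fun a b c d e i j => F ((a, b, c), (d, e), (i, j))) hf.fst.fst hf.fst.snd.fst
    hf.fst.snd.snd hf.snd.fst.fst hf.snd.fst.snd hf.snd.snd.fst hf.snd.snd.snd).of_eq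
    fun _ => rfl

theorem inTime_probe : InTime (fun x : List PairState × List Letter =>
      x.2.length = 2 * x.1.length) (fun x => probe x.1 x.2) (fun x => x.2.length) := by
  have hs : ConstTime (fun x : (List PairState × List Letter) ×
      ((Bool × Bool × List Letter) × List Letter) × PairState =>
      (probeStep x.2.1.1 x.2.2 (x.2.1.2.tail.headD (false, false)) (x.2.1.2.headD (false, false)),
        x.2.1.2.tail.tail)) := by
    have hr : ConstTime (fun x : (List PairState × List Letter) ×
      ((Bool × Bool × List Letter) × List Letter) × PairState => x.2.1.1) := constTime_snd.fst.fst
    have hl : ConstTime (fun x : (List PairState × List Letter) ×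
      ((Bool × Bool × List Letter) × List Letter) × PairState => x.2.1.2) := constTime_snd.fst.snd
    have hp : ConstTime (fun x : (List PairState × List Letter) ×
        ((Bool × Bool × List Letter) × List Letter) × PairState =>
        (x.2.2, x.2.1.2.tail.headD (false, false), x.2.1.2.headD (false, false))) :=
      constTime_snd.snd.pair ((hl.tail.headD _).pair (hl.headD _))
    have h0 := constTime_bool_prod hp fun y => pairExp y.1 y.2.1 y.2.2
    have h1 := constTime_bool_prod hp fun y => pairGen y.1 y.2.1 y.2.2
    have hz : ConstTime (fun _ : (List PairState × List Letter) ×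
      ((Bool × Bool × List Letter) × List Letter) × PairState => ((false, false) : Letter)) :=
      constTime_const _
    exact (hr.fst.cond ((constTime_const true).pair (hr.snd.fst.pair
      (hz.cons (hz.cons hr.snd.snd)))) (h0.fst.cond ((constTime_const false).pair
        ((ConstTime.bool₂ (fun x y => x ^^ y) hr.snd.fst h0.snd).pair
          (hz.cons (hz.cons hr.snd.snd))))
        ((constTime_const true).pair (h1.fst.pair
          (h1.snd.fst.cons (h1.snd.snd.cons hr.snd.snd)))))).pair hl.tail.tail
  have hD : BigO (fun x : List PairState × List Letter => x.2.length = 2 * x.1.length)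
      (fun x => x.1.length) (fun x => x.2.length) := BigO.of_le_one fun x hx => by omega
  have h := InTime.foldl_const (D := fun x : List PairState × List Letter =>
      x.2.length = 2 * x.1.length) (l := fun x => x.1.reverse)
    (b₀ := fun x => ((false, false, []), x.2.reverse)) (T := fun x => x.2.length)
    (s := fun _ p s => (probeStep p.1 s (p.2.tail.headD (false, false))
      (p.2.headD (false, false)), p.2.tail.tail)) hs (constTime_fst.inTime.reverse hD)
    ((constTime_const _).inTime.pair (constTime_snd.inTime.reverse
      (BigO.of_le_one fun _ _ => le_rfl))) (by simpa using hD)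
  refine h.fst.congr fun x hx => ?_
  have := foldl_probeStep x.1 x.2 [] hx
  rw [List.append_nil] at this
  rw [this]

/-! ### One measurement -/

theorem inTime_simStep : InTime
    (fun x : List PairState × List (PauliWord × PauliWord) × PauliWord × Bool =>
      x.2.2.1.2.2.length = 2 * x.1.length ∧ ∀ V ∈ x.2.1,
        V.1.2.2.length = x.2.2.1.2.2.length ∧ V.2.2.2.length = x.2.2.1.2.2.length)
    (fun x => simStep x.1 x.2.1 x.2.2.1 x.2.2.2)
    (fun x => (x.2.1.length + 1) * (x.2.2.1.2.2.length + 1)) := by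
  set D := fun x : List PairState × List (PauliWord × PauliWord) × PauliWord × Bool =>
      x.2.2.1.2.2.length = 2 * x.1.length ∧ ∀ V ∈ x.2.1,
        V.1.2.2.length = x.2.2.1.2.2.length ∧ V.2.2.2.length = x.2.2.1.2.2.length
  set T := fun x : List PairState × List (PauliWord × PauliWord) × PauliWord × Bool =>
    (x.2.1.length + 1) * (x.2.2.1.2.2.length + 1) with hT
  have hQ : InTime D (fun x => x.2.1.foldl pauliConj x.2.2.1) T :=
    inTime_foldl_pauliConj.comp (f := fun x : List PairState × List (PauliWord × PauliWord) ×
      PauliWord × Bool => (x.2.1, x.2.2.1)) (constTime_snd.fst.pair constTime_snd.snd.fst).inTime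
      (fun x hx => hx.2) (BigO.of_le_one fun x _ => by
        simp only [hT]; exact Nat.mul_le_mul_right _ (Nat.le_succ _))
  have hr : InTime D (fun x => probe x.1 (x.2.1.foldl pauliConj x.2.2.1).2.2) T :=
    inTime_probe.comp (f := fun x : List PairState × List (PauliWord × PauliWord) ×
      PauliWord × Bool => (x.1, (x.2.1.foldl pauliConj x.2.2.1).2.2))
      (constTime_fst.inTime.pair hQ.snd.snd)
      (fun x hx => (foldl_pauliConj_length _ _ hx.2).trans hx.1) (BigO.of_le_one fun x hx => by
        simp only [hT, foldl_pauliConj_length _ _ hx.2]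
        nlinarith [Nat.zero_le x.2.1.length])
  have hU : InTime D (fun x => x.2.1) T := constTime_snd.fst.inTime
  have hb : InTime D (fun x => x.2.2.2) T := constTime_snd.snd.snd.inTime
  have hxor : ConstTime (fun x : Bool × Bool => x.1 ^^ x.2) :=
    ConstTime.bool₂ (fun x y => x ^^ y) constTime_fst constTime_snd
  have hcons : ConstTime (fun x : PauliWord × PauliWord => [x]) :=
    constTime_id.cons (constTime_const [])
  have hnew := hcons.compIn (((constTime_const false).inTime.pair (hr.snd.fst.pair hr.snd.snd)).pair
    (hQ.fst.pair ((hxor.compIn (hQ.snd.fst.pair hb)).pair hQ.snd.snd)))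
  have happ := hU.append hnew (BigO.of_le_one fun x _ => by
    simp only [hT]; nlinarith [Nat.zero_le x.2.2.1.2.2.length])
  exact hr.fst.cond' (hb.pair happ) ((hxor.compIn (hQ.snd.fst.pair hr.snd.fst)).pair hU)

/-- At most one pair is added per measurement, so the list stays polynomially short and the
pull-back cheap. -/
theorem simStep_lengths {S : List PairState} {U : List (PauliWord × PauliWord)} {P : PauliWord}
    {b : Bool} (hP : P.2.2.length = 2 * S.length) (hU : ∀ V ∈ U,
      V.1.2.2.length = 2 * S.length ∧ V.2.2.2.length = 2 * S.length) :
    (simStep S U P b).2.length ≤ U.length + 1 ∧ ∀ V ∈ (simStep S U P b).2,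
      V.1.2.2.length = 2 * S.length ∧ V.2.2.2.length = 2 * S.length := by
  have hQ := foldl_pauliConj_length U P (by rw [hP]; exact hU)
  have hr := probe_length S _ (hQ.trans hP)
  simp only [simStep]
  cases (probe S (U.foldl pauliConj P).2.2).1
  · exact ⟨Nat.le_succ _, hU⟩
  · simp only [cond_true]
    refine ⟨by simp, fun V hV => ?_⟩
    rcases List.mem_append.1 hV with hV | hV
    · exact hU V hV
    · rw [List.mem_singleton.1 hV]
      exact ⟨hr, hQ.trans hP⟩

/-! ### Hermitian words -/

theorem yPhase_foldl (w : List Letter) :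
    w.reverse.foldl (fun (r : Bool × Bool) (a : Letter) =>
      bif a.1 && a.2 then (!r.1, r.2 ^^ r.1) else r) (false, false) = yPhase w := by
  induction w with
  | nil => rfl
  | cons a w ih => rw [List.reverse_cons, List.foldl_append, ih]; rfl

theorem inTime_hermitianWord : InTime (fun x : ℕ × Bool × List Letter => x.2.2.length ≤ x.1)
    (fun x => hermitianWord x.1 x.2) (fun x => x.1) := by
  set D := fun x : ℕ × Bool × List Letter => x.2.2.length ≤ x.1
  set T := fun x : ℕ × Bool × List Letter => x.1
  have hw : InTime D (fun x => x.2.2) T := constTime_snd.snd.inTime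
  have hl : BigO D (fun x => x.2.2.length) T := BigO.of_le_one fun x hx => hx
  have hsub : InTime D (fun x => x.1 - x.2.2.length) T :=
    constTime_fst.inTime.sub (hw.length hl) hl
  have htriv : InTime D (fun x => trivialWord (x.1 - x.2.2.length)) T := by
    have := hsub.toList.map_const (f := fun _ _ => ((false, false) : Letter)) (constTime_const _)
      (BigO.of_le_one fun x _ => by simp [T])
    exact this.congr fun x _ => by simp [trivialWord]
  have hpad : InTime D (fun x => padWord x.1 x.2.2) T := hw.append htriv hl
  have hlen : BigO D (fun x => (padWord x.1 x.2.2).length) T :=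
    BigO.of_le_one fun x hx => (padWord_length hx).le
  have hstep : ConstTime (fun x : (ℕ × Bool × List Letter) × (Bool × Bool) × Letter =>
      bif x.2.2.1 && x.2.2.2 then (!x.2.1.1, x.2.1.2 ^^ x.2.1.1) else x.2.1) :=
    ConstTime.bool₄ (fun p q r s => bif p && q then (!r, s ^^ r) else (r, s))
      constTime_snd.snd.fst constTime_snd.snd.snd constTime_snd.fst.fst constTime_snd.fst.snd
  have hy : InTime D (fun x => yPhase (padWord x.1 x.2.2)) T := by
    have := InTime.foldl_const (b₀ := fun _ => (false, false)) (s := fun _ (r : Bool × Bool)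
      (a : Letter) => bif a.1 && a.2 then (!r.1, r.2 ^^ r.1) else r) hstep (hpad.reverse hlen)
      (constTime_const _).inTime (by simpa using hlen)
    exact this.congr fun x _ => yPhase_foldl _
  have hxor : ConstTime (fun x : Bool × Bool => x.1 ^^ x.2) :=
    ConstTime.bool₂ (fun x y => x ^^ y) constTime_fst constTime_snd
  exact hy.fst.pair ((hxor.compIn (constTime_snd.fst.inTime.pair hy.snd)).pair hpad)

end PauliPrograms

/-! ## Programs for one sample -/

/-- A computation with its classical processing. -/
structure Ctx (L : Prog) : Type where
  n : ℕ
  Q : PBC n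
  d : Tree2
  time : ℕ
  computes : ComputesLabels L d Q time

/-- A computation and a precision. -/
structure Env (L : Prog) : Type where
  ctx : Ctx L
  k : ℕ

namespace Env

variable {L : Prog} (e : Env L)

def n : ℕ := e.ctx.n
def y : ℕ := e.ctx.n + e.k
def pairs : ℕ := 6 * blocks e.ctx.n
def wordLen : ℕ := 12 * blocks e.ctx.n
def walk : ℕ := walkLength e.y
def rowLen : ℕ := rowLength e.y
def doubles : ℕ := doublings e.y
def goal : ℕ := sampleGoal e.ctx.n e.k
def goal₂ : ℕ := 2 * sampleGoal e.ctx.n e.k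
def scalings : ℕ := 3 * blocks e.ctx.n

end Env

section SamplePrograms

variable {L : Prog} {α : Type} [Enc α]

/-- Only the description and `n` are written down. The computation, the time bound and the proof are
mathematical data that the machine never sees, although specifications may refer to them. -/
instance : Enc (Ctx L) := ⟨fun c => Tree2.cons c.d (encNat c.n)⟩

/-- All parameters are precomputed in unary, so that inner loops can read them in constant time.
Note that `k` itself is not stored. -/
instance : Enc (Env L) := ⟨fun e => Enc.enc (e.ctx, e.y, e.pairs, e.wordLen, e.walk, e.rowLen,
  e.doubles, e.goal, e.goal₂, e.scalings)⟩

theorem constTime_of_tuple {β : Type} [Enc β]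
    {g : Ctx L × ℕ × ℕ × ℕ × ℕ × ℕ × ℕ × ℕ × ℕ × ℕ → β} (hg : ConstTime g) :
    ConstTime (fun e : Env L => g (e.ctx, e.y, e.pairs, e.wordLen, e.walk, e.rowLen,
      e.doubles, e.goal, e.goal₂, e.scalings)) :=
  hg.recode _ (fun _ => rfl) (fun _ => rfl)

theorem Env.constTime_ctx : ConstTime (fun e : Env L => e.ctx) := constTime_of_tuple constTime_fst

theorem Env.constTime_y : ConstTime (fun e : Env L => e.y) :=
  constTime_of_tuple constTime_snd.fst

theorem Env.constTime_pairs : ConstTime (fun e : Env L => e.pairs) :=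
  constTime_of_tuple constTime_snd.snd.fst

theorem Env.constTime_wordLen : ConstTime (fun e : Env L => e.wordLen) :=
  constTime_of_tuple constTime_snd.snd.snd.fst

theorem Env.constTime_walk : ConstTime (fun e : Env L => e.walk) :=
  constTime_of_tuple constTime_snd.snd.snd.snd.fst

theorem Env.constTime_rowLen : ConstTime (fun e : Env L => e.rowLen) :=
  constTime_of_tuple constTime_snd.snd.snd.snd.snd.fst

theorem Env.constTime_doubles : ConstTime (fun e : Env L => e.doubles) :=
  constTime_of_tuple constTime_snd.snd.snd.snd.snd.snd.fst

theorem Env.constTime_goal : ConstTime (fun e : Env L => e.goal) :=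
  constTime_of_tuple constTime_snd.snd.snd.snd.snd.snd.snd.fst

theorem Env.constTime_goal₂ : ConstTime (fun e : Env L => e.goal₂) :=
  constTime_of_tuple constTime_snd.snd.snd.snd.snd.snd.snd.snd.fst

theorem Env.constTime_scalings : ConstTime (fun e : Env L => e.scalings) :=
  constTime_of_tuple constTime_snd.snd.snd.snd.snd.snd.snd.snd.snd

theorem Env.constTime_n : ConstTime (fun e : Env L => e.n) := by
  have h : ConstTime (fun x : Tree2 × ℕ => x.2) := constTime_snd
  have h2 : ConstTime (fun c : Ctx L => c.n) :=
    h.recode (fun c : Ctx L => (c.d, c.n)) (fun _ => rfl) (fun _ => rfl)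
  exact h2.comp Env.constTime_ctx

/-! ### The classical processing -/

theorem enc_ofFn_bits {m : ℕ} (h : Fin m → Bool) : Enc.enc (List.ofFn h) = encBits h := by
  show encList ((List.ofFn h).map Enc.enc) = _
  rw [List.map_ofFn]
  rfl

theorem enc_code {n : ℕ} (P : PauliOp n) : Enc.enc P.code = encPauli P := by
  have h : ∀ a, Enc.enc (letterCode a) = encLetter a := by intro a; cases a <;> rfl
  show Tree2.cons (encBool P.neg) (encList ((List.ofFn fun i => letterCode (P.letter i)).map
    Enc.enc)) = _
  rw [List.map_ofFn, encPauli]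
  congr 3
  funext i
  exact h _

theorem exists_eq_ofFn {m : ℕ} (l : List Bool) (h : l.length = m) :
    ∃ f : Fin m → Bool, l = List.ofFn f := by
  subst h
  exact ⟨l.get, (List.ofFn_get l).symm⟩

/-- One call of `L`, preceded by a constant number of instructions that rearrange its input. -/
theorem inTime_pauliAt : InTime (fun x : Ctx L × List Bool => x.2.length < x.1.n)
    (fun x => (x.1.Q.pauliAt x.2).code) (fun x => x.1.time) := by
  refine ⟨Prog.seq (Prog.pair (Prog.seq Prog.fst Prog.fst) (Prog.pair (Prog.seq Prog.fst Prog.snd)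
    Prog.snd)) L, 20, fun x hx => ?_⟩
  obtain ⟨c, l⟩ := x
  obtain ⟨h, hh⟩ := exists_eq_ofFn (m := l.length) l rfl
  obtain ⟨s, hs, hr⟩ := c.computes.1 ⟨l.length, hx⟩ h
  have e1 := c.Q.pauliAt_ofFn hx h
  have e2 : Enc.enc l = encBits h := by rw [← enc_ofFn_bits, ← hh]
  rw [← e1, ← hh, ← enc_code, ← e2] at hr
  exact ⟨_, by simp only; omega, Runs.seq (Runs.pair (Runs.seq (Runs.fst_cons _ _)
    (Runs.fst_cons _ _)) (Runs.pair (Runs.seq (Runs.fst_cons _ _) (Runs.snd_cons _ _))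
    (Runs.snd_cons _ _))) hr⟩

theorem inTime_outAt : InTime (fun x : Ctx L × List Bool => x.2.length = x.1.n)
    (fun x => x.1.Q.outAt x.2) (fun x => x.1.time) := by
  refine ⟨Prog.seq (Prog.pair (Prog.seq Prog.fst Prog.fst) (Prog.pair (Prog.seq Prog.fst Prog.snd)
    Prog.snd)) L, 20, fun x hx => ?_⟩
  obtain ⟨c, l⟩ := x
  obtain ⟨h, hh⟩ := exists_eq_ofFn l hx
  obtain ⟨s, hs, hr⟩ := c.computes.2 h
  have e1 := c.Q.outAt_ofFn h
  have e2 : Enc.enc l = encBits h := by rw [← enc_ofFn_bits, ← hh]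
  rw [← e1, ← hh, ← e2] at hr
  exact ⟨_, by simp only; omega, Runs.seq (Runs.pair (Runs.seq (Runs.fst_cons _ _)
    (Runs.fst_cons _ _)) (Runs.pair (Runs.seq (Runs.fst_cons _ _) (Runs.snd_cons _ _))
    (Runs.snd_cons _ _))) hr⟩

/-! ### A run of measurements -/

/-- The word measured next. -/
def Env.word (e : Env L) (h : List Bool) : PauliWord :=
  hermitianWord e.wordLen (e.ctx.Q.pauliAt h).code

theorem Env.n_le_wordLen (e : Env L) : e.n ≤ e.wordLen := by
  simp only [Env.n, Env.wordLen, blocks]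
  omega

theorem Env.word_length (e : Env L) (h : List Bool) : (e.word h).2.2.length = e.wordLen :=
  padWord_length ((PauliOp.code_length _).trans_le e.n_le_wordLen)

abbrev RunState : Type := List (PauliWord × PauliWord) × List Bool × List Bool

def runStep (S : List PairState) (W : List Bool → PauliWord) (s : RunState) : RunState :=
  let r := simStep S s.1 (W s.2.1) (s.2.2.headD false)
  (r.2, s.2.1 ++ [r.1], s.2.2.tail)

theorem simRun_eq_iterate (S : List PairState) (W : List Bool → PauliWord) (j : ℕ)
    (U : List (PauliWord × PauliWord)) (h c : List Bool) :
    simRun S W j U h c = ((runStep S W)^[j] (U, h, c)).2.1 := by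
  induction j generalizing U h c with
  | zero => rfl
  | succ j ih => rw [Function.iterate_succ_apply, simRun, ih]; rfl

theorem simRun_length (S : List PairState) (W : List Bool → PauliWord) (j : ℕ)
    (U : List (PauliWord × PauliWord)) (h c : List Bool) :
    (simRun S W j U h c).length = h.length + j := by
  induction j generalizing U h c with
  | zero => rfl
  | succ j ih => rw [simRun, ih, List.length_append, List.length_singleton]; omega

def Env.stepCost (e : Env L) : ℕ := e.ctx.time + (e.n + 1) * (e.wordLen + 1) + e.n

/-- The state of a run can be processed further. -/
def RunInv (e : Env L) (S : List PairState) (s : RunState) : Prop :=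
  e.wordLen = 2 * S.length ∧ s.2.1.length < e.n ∧ s.1.length ≤ s.2.1.length ∧ ∀ V ∈ s.1,
    V.1.2.2.length = 2 * S.length ∧ V.2.2.2.length = 2 * S.length

theorem inTime_runStep : InTime (fun x : (Env L × List PairState) × RunState =>
      RunInv x.1.1 x.1.2 x.2)
    (fun x => runStep x.1.2 x.1.1.word x.2) (fun x => x.1.1.stepCost) := by
  set D := fun x : (Env L × List PairState) × RunState => RunInv x.1.1 x.1.2 x.2
  set T := fun x : (Env L × List PairState) × RunState => x.1.1.stepCost with hT
  have he : ConstTime (fun x : (Env L × List PairState) × RunState => x.1.1) := constTime_fst.fst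
  have hh : ConstTime (fun x : (Env L × List PairState) × RunState => x.2.2.1) :=
    constTime_snd.snd.fst
  have hcoins : ConstTime (fun x : (Env L × List PairState) × RunState => x.2.2.2) :=
    constTime_snd.snd.snd
  have hcode : InTime D (fun x => (x.1.1.ctx.Q.pauliAt x.2.2.1).code) T :=
    inTime_pauliAt.comp (f := fun x : (Env L × List PairState) × RunState => (x.1.1.ctx, x.2.2.1))
      ((Env.constTime_ctx.comp he).pair hh).inTime (fun x hx => hx.2.1)
      (BigO.of_le_one fun x _ => by simp only [hT, Env.stepCost]; omega)
  have hword : InTime D (fun x => x.1.1.word x.2.2.1) T :=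
    inTime_hermitianWord.comp (f := fun x : (Env L × List PairState) × RunState =>
      (x.1.1.wordLen, (x.1.1.ctx.Q.pauliAt x.2.2.1).code))
      ((Env.constTime_wordLen.comp he).inTime.pair hcode)
      (fun x _ => (PauliOp.code_length _).trans_le x.1.1.n_le_wordLen)
      (BigO.of_le_one fun x _ => by simp only [hT, Env.stepCost]; nlinarith)
  have hsim : InTime D (fun x => simStep x.1.2 x.2.1 (x.1.1.word x.2.2.1)
      (x.2.2.2.headD false)) T :=
    inTime_simStep.comp (f := fun x : (Env L × List PairState) × RunState =>
      (x.1.2, x.2.1, x.1.1.word x.2.2.1, x.2.2.2.headD false))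
      (constTime_fst.snd.inTime.pair (constTime_snd.fst.inTime.pair
        (hword.pair (hcoins.headD false).inTime)))
      (fun x hx => by
        simp only [Env.word_length]
        rw [hx.1]
        exact ⟨rfl, hx.2.2.2⟩)
      (BigO.of_le_one fun x hx => by
        have h1 := hx.2.2.1
        have h2 := hx.2.1
        simp only [hT, Env.stepCost, Env.word_length]
        have : (x.2.1.length + 1) * (x.1.1.wordLen + 1) ≤ (x.1.1.n + 1) * (x.1.1.wordLen + 1) :=
          Nat.mul_le_mul_right _ (by omega)
        omega)
  have hone : ConstTime (fun b : Bool => [b]) := constTime_id.cons (constTime_const [])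
  have happ : InTime D (fun x => x.2.2.1 ++ [(simStep x.1.2 x.2.1 (x.1.1.word x.2.2.1)
      (x.2.2.2.headD false)).1]) T :=
    hh.inTime.append (hone.compIn hsim.fst) (BigO.of_le_one fun x hx => by
      have := hx.2.1
      simp only [hT, Env.stepCost]; omega)
  exact hsim.snd.pair (happ.pair hcoins.tail.inTime)

def Env.runCost (e : Env L) : ℕ := e.n * (e.stepCost + 1)

theorem inTime_simRun : InTime (fun x : (Env L × List PairState) × List Bool =>
      x.1.1.wordLen = 2 * x.1.2.length)
    (fun x => simRun x.1.2 x.1.1.word x.1.1.n [] [] x.2) (fun x => x.1.1.runCost) := by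
  have h := InTime.iterate (γ := (Env L × List PairState) × List Bool)
    (D := fun x => x.1.1.wordLen = 2 * x.1.2.length) (T := fun x => x.1.1.runCost)
    (m := fun x => x.1.1.n) (b₀ := fun x => (([], [], x.2) : RunState))
    (s := fun x s => runStep x.1.2 x.1.1.word s) (E := fun x => RunInv x.1.1.1 x.1.1.2 x.2)
    (V := fun x => x.1.1.1.stepCost) (B := fun x => x.1.1.stepCost)
    (inTime_runStep.comp (f := fun x : ((Env L × List PairState) × List Bool) × RunState =>
      (x.1.1, x.2)) (constTime_fst.fst.pair constTime_snd).inTime (fun _ h => h)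
      (BigO.of_le_one fun _ _ => le_rfl))
    (Env.constTime_n.comp constTime_fst.fst).inTime
    ((constTime_const []).pair ((constTime_const []).pair constTime_snd)).inTime
    -- With `r` steps left the history has `n - r` entries, and there are at most as many
    -- conjugations as outcomes.
    (fun x r s => s.2.1.length + r = x.1.1.n ∧ s.1.length ≤ s.2.1.length ∧ ∀ V ∈ s.1,
      V.1.2.2.length = 2 * x.1.2.length ∧ V.2.2.2.length = 2 * x.1.2.length)
    (fun x _ => ⟨by simp, by simp, by simp⟩)
    (fun x r s hx hi => by
      have hinv : RunInv x.1.1 x.1.2 s := ⟨hx, by omega, hi.2.1, hi.2.2⟩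
      refine ⟨?_, hinv, le_rfl⟩
      have := simStep_lengths (b := s.2.2.headD false)
        ((x.1.1.word_length s.2.1).trans hx) hi.2.2
      refine ⟨?_, ?_, this.2⟩
      · simp only [runStep, List.length_append, List.length_singleton]; omega
      · simp only [runStep, List.length_append, List.length_singleton]
        exact this.1.trans (by omega))
    (BigO.of_le_one fun x _ => le_rfl)
  exact h.snd.fst.congr fun x _ => (simRun_eq_iterate _ _ _ _ _ _).symm

/-! ### Pair states -/

theorem constTime_walkStep : ConstTime walkStep := by
  have hs : ConstTime (fun s : (Bool × ℕ) × List Bool => s.1) := constTime_fst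
  have h0 : ConstTime (fun s : (Bool × ℕ) × List Bool => s.2) := constTime_snd
  have hpos : ConstTime (fun s : (Bool × ℕ) × List Bool => decide (0 < s.1.2)) :=
    constTime_isPos.comp hs.snd
  have b₁ := h0.headD false
  have b₂ := h0.tail.headD false
  have b₃ := h0.tail.tail.headD false
  have b₄ := h0.tail.tail.tail.headD false
  have b₅ := h0.tail.tail.tail.tail.headD false
  refine ConstTime.pair ?_ h0.tail.tail.tail.tail.tail
  exact (ConstTime.bool₂ (fun a b => a || !b) hs.fst hpos).cond hs
    ((ConstTime.bool₂ (fun a b => !a && !b) b₁ b₂).cond ((constTime_const true).pair hs.snd)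
      ((ConstTime.bool₅ (fun a b c d e => a && (!b || (!c && !d && !e))) b₁ b₂ b₃ b₄ b₅).cond
        ((constTime_const false).pair (constTime_pred.comp hs.snd))
        ((ConstTime.bool₅ (fun a b c d e => a && b && !c && !d && e) b₁ b₂ b₃ b₄ b₅).cond
          ((constTime_const false).pair hs.snd.succ) hs)))

theorem inTime_drawPair : InTime (fun _ : ℕ × List Bool => True)
    (fun x => drawPair x.1 x.2) (fun x => x.1) := by
  have hl : ConstTime (fun x : ℕ × List Bool => x.2) := constTime_snd
  have hr : InTime (fun _ : ℕ × List Bool => True) (fun x => walkStep^[x.1]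
      ((false, 1), x.2.tail.tail.tail.tail.tail.tail)) (fun x => x.1) :=
    InTime.iterate (s := fun _ => walkStep) (E := fun _ => True) (V := fun _ => 0)
      (B := fun _ => 0) (constTime_walkStep.comp constTime_snd).inTime constTime_fst.inTime
      ((constTime_const (false, 1)).pair hl.tail.tail.tail.tail.tail.tail).inTime
      (fun _ _ _ => True) (fun _ _ => trivial) (fun _ _ _ _ _ => ⟨trivial, trivial, le_rfl⟩)
      (BigO.of_le_one fun _ _ => by simp)
  have hsuc : ConstTime (fun s : Bool × ℕ => walkSuccess s) :=
    ConstTime.bool₂ (fun a b => !a && !b) constTime_fst (constTime_isPos.comp constTime_snd)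
  have hc : ConstTime (fun x : List Bool × ((Bool × ℕ) × List Bool) =>
      ((((x.1.headD false) && (x.1.tail.headD false) && (x.1.tail.tail.headD false) &&
        (x.1.tail.tail.tail.headD false) && !walkSuccess x.2.1,
        (x.1.headD false) && (x.1.tail.headD false),
        bif (x.1.headD false) && (x.1.tail.headD false) then
          (true, (x.1.tail.tail.tail.tail.headD false),
            !((x.1.tail.tail.headD false) && (x.1.tail.tail.tail.headD false)))
        else (false, (x.1.tail.tail.tail.tail.headD false),
          (x.1.tail.tail.tail.tail.tail.headD false))), x.2.2) :
        (Bool × Bool × PairState) × List Bool)) := by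
    have h0 : ConstTime (fun x : List Bool × ((Bool × ℕ) × List Bool) => x.1) := constTime_fst
    have b₁ := h0.headD false
    have b₂ := h0.tail.headD false
    have b₃ := h0.tail.tail.headD false
    have b₄ := h0.tail.tail.tail.headD false
    have b₅ := h0.tail.tail.tail.tail.headD false
    have b₆ := h0.tail.tail.tail.tail.tail.headD false
    have hw : ConstTime (fun x : List Bool × ((Bool × ℕ) × List Bool) => walkSuccess x.2.1) :=
      hsuc.comp constTime_snd.fst
    exact ((ConstTime.bool₅ (fun a b c d e => a && b && c && d && !e) b₁ b₂ b₃ b₄ hw).pair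
      ((ConstTime.bool₂ (fun a b => a && b) b₁ b₂).pair
        ((ConstTime.bool₂ (fun a b => a && b) b₁ b₂).cond
          ((constTime_const true).pair (b₅.pair (ConstTime.bool₂ (fun a b => !(a && b)) b₃ b₄)))
          ((constTime_const false).pair (b₅.pair b₆))))).pair constTime_snd.snd
  exact hc.compIn (hl.inTime.pair hr)

theorem inTime_drawPairs : InTime (fun _ : Env L × List Bool => True)
    (fun x => drawPairs x.1.walk x.1.pairs x.2) (fun x => x.1.pairs * (x.1.walk + 1)) := by
  have hstep : InTime (fun _ : (Env L × List Bool) × ((Bool × Bool × List PairState) × List Bool) =>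
      True) (fun x => pairStep x.1.1.walk x.2) (fun x => x.1.1.walk) := by
    have hd := inTime_drawPair.comp' (D := fun _ => True)
      (f := fun x : (Env L × List Bool) × ((Bool × Bool × List PairState) × List Bool) =>
      (x.1.1.walk, x.2.2)) (T := fun x => x.1.1.walk)
      ((Env.constTime_walk.comp constTime_fst.fst).pair constTime_snd.snd).inTime
      (BigO.of_le_one fun _ _ => le_rfl)
    have hc : ConstTime (fun x : (Bool × Bool × List PairState) ×
        ((Bool × Bool × PairState) × List Bool) =>
        ((x.1.1 || x.2.1.1, x.1.2.1 ^^ x.2.1.2.1, x.2.1.2.2 :: x.1.2.2), x.2.2)) :=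
      ((ConstTime.bool₂ (fun a b => a || b) constTime_fst.fst constTime_snd.fst.fst).pair
        ((ConstTime.bool₂ (fun a b => a ^^ b) constTime_fst.snd.fst
          constTime_snd.fst.snd.fst).pair (constTime_snd.fst.snd.snd.cons
          constTime_fst.snd.snd))).pair constTime_snd.snd
    exact hc.compIn ((constTime_snd.fst.inTime).pair hd)
  exact InTime.iterate (s := fun x : Env L × List Bool => pairStep x.1.walk)
    (E := fun _ => True) (V := fun x => x.1.1.walk) (B := fun x => x.1.walk) hstep
    (Env.constTime_pairs.comp constTime_fst).inTime
    ((constTime_const _).pair constTime_snd).inTime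
    (fun _ _ _ => True) (fun _ _ => trivial) (fun _ _ _ _ _ => ⟨trivial, trivial, le_rfl⟩)
    (BigO.of_le_one fun _ _ => le_rfl)

/-! ### The sampler -/

def Env.sampleCost (e : Env L) : ℕ := e.pairs * (e.walk + 1) + e.runCost + e.ctx.time

def Env.sample (e : Env L) (row : List Bool) : Bool × Bool := sampler e.ctx.Q e.y row

theorem inTime_sample : InTime (fun _ : Env L × List Bool => True)
    (fun x => x.1.sample x.2) (fun x => x.1.sampleCost) := by
  have hd : InTime (fun _ : Env L × List Bool => True)
      (fun x => drawPairs x.1.walk x.1.pairs x.2) (fun x => x.1.sampleCost) :=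
    inTime_drawPairs.mono (BigO.of_le_one fun x _ => by simp only [Env.sampleCost]; omega)
  have hlen : ∀ x : Env L × List Bool,
      x.1.wordLen = 2 * (drawPairs x.1.walk x.1.pairs x.2).1.2.2.length := by
    intro x
    rw [drawPairs_length]
    simp only [Env.wordLen, Env.pairs]
    ring
  have hrun : InTime (fun _ : Env L × List Bool => True) (fun x =>
      simRun (drawPairs x.1.walk x.1.pairs x.2).1.2.2 x.1.word x.1.n [] []
        (drawPairs x.1.walk x.1.pairs x.2).2) (fun x => x.1.sampleCost) :=
    inTime_simRun.comp (f := fun x : Env L × List Bool =>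
      ((x.1, (drawPairs x.1.walk x.1.pairs x.2).1.2.2), (drawPairs x.1.walk x.1.pairs x.2).2))
      ((constTime_fst.inTime.pair hd.fst.snd.snd).pair hd.snd) (fun x _ => hlen x)
      (BigO.of_le_one fun x _ => by simp only [Env.sampleCost]; omega)
  have hout : InTime (fun _ : Env L × List Bool => True) (fun x => x.1.ctx.Q.outAt
      (simRun (drawPairs x.1.walk x.1.pairs x.2).1.2.2 x.1.word x.1.n [] []
        (drawPairs x.1.walk x.1.pairs x.2).2)) (fun x => x.1.sampleCost) :=
    inTime_outAt.comp (f := fun x : Env L × List Bool => (x.1.ctx,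
      simRun (drawPairs x.1.walk x.1.pairs x.2).1.2.2 x.1.word x.1.n [] []
        (drawPairs x.1.walk x.1.pairs x.2).2))
      ((Env.constTime_ctx.comp constTime_fst).inTime.pair hrun)
      (fun x _ => by
        simp only [simRun_length, List.length_nil, Nat.zero_add]
        rfl)
      (BigO.of_le_one fun x _ => by simp only [Env.sampleCost]; omega)
  have hc : ConstTime (fun x : Bool × Bool => !x.1 && x.2) :=
    ConstTime.bool₂ (fun a b => !a && b) constTime_fst constTime_snd
  exact (hc.compIn (hd.fst.fst.pair hout)).pair hd.fst.snd.fst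

end SamplePrograms

/-! ## Programs for the simulation -/

section SimulationPrograms

variable {L : Prog}

/-! ### Rows -/

theorem foldl_xorRow (a b r : List Bool) :
    (a.foldl (fun (p : List Bool × List Bool) x => bif !p.2.isEmpty then
      ((x ^^ p.2.headD false) :: p.1, p.2.tail) else p) (r, b)).1 = (xorRow a b).reverse ++ r := by
  induction a generalizing b r with
  | nil => simp [xorRow]
  | cons x a ih =>
    cases b with
    | nil =>
      have := ih [] r
      rw [List.foldl_cons]
      simpa [xorRow] using this
    | cons y b =>
      have := ih b ((x ^^ y) :: r)
      rw [List.foldl_cons]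
      simpa [xorRow] using this

theorem inTime_xorRow : InTime (fun _ : List Bool × List Bool => True)
    (fun x => xorRow x.1 x.2) (fun x => x.1.length) := by
  have h1 : ConstTime (fun x : (List Bool × List Bool) × (List Bool × List Bool) × Bool =>
      x.2.1.2) := constTime_snd.fst.snd
  have h2 : ConstTime (fun x : (List Bool × List Bool) × (List Bool × List Bool) × Bool =>
      x.2.1.1) := constTime_snd.fst.fst
  have h := InTime.foldl_const (D := fun _ : List Bool × List Bool => True) (l := fun x => x.1)
    (b₀ := fun x => (([] : List Bool), x.2)) (T := fun x => x.1.length)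
    (s := fun _ p x => bif !p.2.isEmpty then
      ((x ^^ p.2.headD false) :: p.1, p.2.tail) else p)
    ((constTime_isCons.comp h1).cond (((ConstTime.bool₂ (fun a b => a ^^ b) constTime_snd.snd
      (h1.headD false)).cons h2).pair h1.tail) constTime_snd.fst) constTime_fst.inTime
    ((constTime_const _).pair constTime_snd).inTime (BigO.of_le_one fun _ _ => le_rfl)
  have h3 : InTime (fun _ : List Bool × List Bool => True) (fun x => (xorRow x.1 x.2).reverse)
      (fun x => x.1.length) := h.fst.congr fun x _ => by rw [foldl_xorRow, List.append_nil]
  refine (h3.reverse (BigO.of_le_one fun x _ => ?_)).congr fun x _ => List.reverse_reverse _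
  simp [xorRow]

theorem iterate_takeDrop (B : ℕ) (r l : List Bool) :
    (fun (p : List Bool × List Bool) => bif !p.2.isEmpty then
      (p.2.headD false :: p.1, p.2.tail) else p)^[B] (r, l) =
      ((l.take B).reverse ++ r, l.drop B) := by
  induction B generalizing r l with
  | zero => simp
  | succ B ih =>
    rw [Function.iterate_succ_apply]
    cases l with
    | nil => simpa using ih r []
    | cons b l => simpa using ih (b :: r) l

/-- The first row of a list of coins, and the remaining coins. -/
theorem inTime_takeDrop : InTime (fun _ : ℕ × List Bool => True)
    (fun x => (x.2.take x.1, x.2.drop x.1)) (fun x => x.1) := by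
  have h2 : ConstTime (fun x : (ℕ × List Bool) × (List Bool × List Bool) => x.2.2) :=
    constTime_snd.snd
  have h := InTime.iterate (D := fun _ : ℕ × List Bool => True) (m := fun x => x.1)
    (b₀ := fun x => (([] : List Bool), x.2)) (T := fun x => x.1)
    (s := fun _ p => bif !p.2.isEmpty then (p.2.headD false :: p.1, p.2.tail) else p)
    (E := fun _ => True) (V := fun _ => 0) (B := fun _ => 0)
    ((constTime_isCons.comp h2).cond (((h2.headD false).cons constTime_snd.fst).pair h2.tail)
      constTime_snd).inTime constTime_fst.inTime
    ((constTime_const _).pair constTime_snd).inTime (fun _ _ _ => True) (fun _ _ => trivial)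
    (fun _ _ _ _ _ => ⟨trivial, trivial, le_rfl⟩) (BigO.of_le_one fun _ _ => by simp)
  have h3 : InTime (fun _ : ℕ × List Bool => True)
      (fun x => ((x.2.take x.1).reverse, x.2.drop x.1)) (fun x => x.1) :=
    h.congr fun x _ => by rw [iterate_takeDrop, List.append_nil]
  refine ((h3.fst.reverse (BigO.of_le_one fun x _ => ?_)).pair h3.snd).congr fun x _ => by
    rw [List.reverse_reverse]
  simp

theorem inTime_map_xorRow : InTime (fun _ : List Bool × List (List Bool) => True)
    (fun x => x.2.map (xorRow x.1)) (fun x => x.2.length * (x.1.length + 1)) :=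
  InTime.map (γ := List Bool × List (List Bool)) (f := fun x o => xorRow x.1 o)
    (E := fun _ => True) (V := fun x => x.1.1.length) (B := fun x => x.1.length)
    (inTime_xorRow.comp' (f := fun x : (List Bool × List (List Bool)) × List Bool => (x.1.1, x.2))
      (T := fun x => x.1.1.length) (constTime_fst.fst.pair constTime_snd).inTime
      (BigO.of_le_one fun _ _ => le_rfl)) constTime_snd.inTime (fun _ _ _ _ => ⟨trivial, le_rfl⟩)
    (BigO.of_le_one fun _ _ => le_rfl)

/-- A bound for the number of rows. -/
def Env.maxRows (e : Env L) : ℕ := 2 * e.goal + 1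

theorem inTime_doubleRows : InTime (fun x : Env L × List (List Bool) × List Bool =>
      x.2.1.length ≤ x.1.maxRows)
    (fun x => doubleRows x.1.rowLen x.1.goal x.2) (fun x => x.1.maxRows * (x.1.rowLen + 1)) := by
  set D := fun x : Env L × List (List Bool) × List Bool => x.2.1.length ≤ x.1.maxRows
  set T := fun x : Env L × List (List Bool) × List Bool => x.1.maxRows * (x.1.rowLen + 1) with hT
  have hL : InTime D (fun x => x.2.1) T := constTime_snd.fst.inTime
  have hlen : BigO D (fun x => x.2.1.length) T := BigO.of_le_one fun x hx => by
    have : x.2.1.length ≤ x.1.maxRows := hx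
    simp only [hT]; nlinarith [Nat.zero_le x.1.rowLen]
  have hcut : InTime D (fun x => (x.2.2.take x.1.rowLen, x.2.2.drop x.1.rowLen)) T :=
    inTime_takeDrop.comp' (f := fun x : Env L × List (List Bool) × List Bool =>
      (x.1.rowLen, x.2.2)) ((Env.constTime_rowLen.comp constTime_fst).pair constTime_snd.snd).inTime
      (BigO.of_le_one fun x _ => by simp only [hT, Env.maxRows]; nlinarith)
  have hmap : InTime D (fun x => x.2.1.map (xorRow (x.2.2.take x.1.rowLen))) T :=
    inTime_map_xorRow.comp' (f := fun x : Env L × List (List Bool) × List Bool =>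
      (x.2.2.take x.1.rowLen, x.2.1)) (hcut.fst.pair hL) (BigO.of_le_one fun x hx =>
        Nat.mul_le_mul hx (by simp))
  have hlt : InTime D (fun x => decide (x.2.1.length < x.1.goal)) T :=
    (hL.length hlen).lt (Env.constTime_goal.comp constTime_fst).inTime hlen
  exact (hlt.cond' (hL.append hmap hlen) hL).pair hcut.snd

theorem doubleCount_le {m x : ℕ} (h : x ≤ 2 * m + 1) : doubleCount m x ≤ 2 * m + 1 := by
  rw [doubleCount]
  by_cases hx : x < m
  · simp only [hx, decide_true, cond_true]; omega
  · simpa [hx] using h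

theorem inTime_doubleRows_iterate : InTime (fun _ : Env L × List Bool => True)
    (fun x => (doubleRows x.1.rowLen x.1.goal)^[x.1.doubles]
      ([List.replicate x.1.rowLen false], x.2))
    (fun x => (x.1.doubles + 1) * (x.1.maxRows * (x.1.rowLen + 1))) := by
  have hpos : ∀ e : Env L, 1 ≤ e.maxRows := fun e => by rw [Env.maxRows]; omega
  have hzero : InTime (fun _ : Env L × List Bool => True)
      (fun x => List.replicate x.1.rowLen false)
      (fun x => (x.1.doubles + 1) * (x.1.maxRows * (x.1.rowLen + 1))) := by
    have h := (Env.constTime_rowLen.comp (constTime_fst (α := Env L) (β := List Bool))).inTime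
      (D := fun _ => True) (T := fun x => x.1.rowLen)
    have := (h.toList.map_const (f := fun _ _ => false) (constTime_const _)
      (BigO.of_le_one fun x _ => by simp)).congr
      (g := fun x => List.replicate x.1.rowLen false) fun x _ => by simp
    refine this.mono (BigO.of_le_one fun x _ => ?_)
    have := hpos x.1
    calc x.1.rowLen ≤ 1 * (1 * (x.1.rowLen + 1)) := by omega
      _ ≤ _ := Nat.mul_le_mul (by omega) (Nat.mul_le_mul_right _ this)
  have hone : ConstTime (fun l : List Bool => [l]) := constTime_id.cons (constTime_const [])
  refine InTime.iterate (γ := Env L × List Bool) (s := fun x => doubleRows x.1.rowLen x.1.goal)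
    (E := fun x => x.2.1.length ≤ x.1.1.maxRows)
    (V := fun x => x.1.1.maxRows * (x.1.1.rowLen + 1))
    (B := fun x => x.1.maxRows * (x.1.rowLen + 1))
    (inTime_doubleRows.comp (f := fun x : (Env L × List Bool) × List (List Bool) × List Bool =>
      (x.1.1, x.2)) (constTime_fst.fst.pair constTime_snd).inTime (fun _ h => h)
      (BigO.of_le_one fun _ _ => le_rfl))
    (Env.constTime_doubles.comp constTime_fst).inTime
    ((hone.compIn hzero).pair constTime_snd.inTime)
    (fun x _ s => s.1.length ≤ x.1.maxRows) (fun x _ => hpos x.1)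
    (fun x r s _ hs => ⟨?_, hs, le_rfl⟩) (BigO.of_le 2 fun x _ => ?_)
  · rw [doubleRows_length]
    exact doubleCount_le hs
  · have := hpos x.1
    have h1 : 1 ≤ x.1.maxRows * (x.1.rowLen + 1) := Nat.mul_pos this (Nat.succ_pos _)
    nlinarith

/-! ### Trials -/

theorem inTime_tally : InTime (fun _ : (Env L × List Bool) × List (List Bool) => True)
    (fun x => tally x.1.1.sample x.1.2 x.2)
    (fun x => x.2.length * (x.1.1.sampleCost + x.1.2.length + 1)) := by
  have hx : InTime (fun _ : ((Env L × List Bool) × List (List Bool)) × (ℕ × ℕ) × List Bool => True)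
      (fun x => x.1.1.1.sample (xorRow x.1.1.2 x.2.2))
      (fun x => x.1.1.1.sampleCost + x.1.1.2.length) := by
    have h1 : InTime (fun _ : ((Env L × List Bool) × List (List Bool)) × (ℕ × ℕ) × List Bool =>
        True) (fun x => xorRow x.1.1.2 x.2.2) (fun x => x.1.1.1.sampleCost + x.1.1.2.length) :=
      inTime_xorRow.comp' (f := fun x : ((Env L × List Bool) × List (List Bool)) × (ℕ × ℕ) ×
        List Bool => (x.1.1.2, x.2.2)) (constTime_fst.fst.snd.pair constTime_snd.snd).inTime
        (BigO.of_le_one fun x _ => Nat.le_add_left _ _)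
    exact inTime_sample.comp' (f := fun x : ((Env L × List Bool) × List (List Bool)) × (ℕ × ℕ) ×
        List Bool => (x.1.1.1, xorRow x.1.1.2 x.2.2)) (constTime_fst.fst.fst.inTime.pair h1)
        (BigO.of_le_one fun x _ => Nat.le_add_right _ _)
  have hc : ConstTime (fun x : (ℕ × ℕ) × (Bool × Bool) => tallyStep x.1 x.2) :=
    (constTime_snd.fst).cond ((constTime_snd.snd).cond (constTime_fst.fst.pair
      (constTime_fst.snd.succ)) (constTime_fst.fst.succ.pair constTime_fst.snd)) constTime_fst
  exact InTime.foldl (γ := (Env L × List Bool) × List (List Bool))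
    (s := fun x p o => tallyStep p (x.1.1.sample (xorRow x.1.2 o)))
    (E := fun _ => True) (V := fun x => x.1.1.1.sampleCost + x.1.1.2.length)
    (B := fun x => x.1.1.sampleCost + x.1.2.length)
    (hc.compIn (constTime_snd.fst.inTime.pair hx)) constTime_snd.inTime (constTime_const _).inTime
    (fun _ _ _ => True) (fun _ _ => trivial) (fun _ _ _ _ _ _ => ⟨trivial, trivial, le_rfl⟩)
    (BigO.of_le_one fun _ _ => le_rfl)

def Env.trialCost (e : Env L) : ℕ :=
  (e.doubles + 1) * (e.maxRows * (e.sampleCost + e.rowLen + 1))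

theorem inTime_trial : InTime (fun _ : Env L × List Bool => True)
    (fun x => trial x.1.sample x.1.rowLen x.1.goal x.1.doubles x.2) (fun x => x.1.trialCost) := by
  set D := fun _ : Env L × List Bool => True
  set T := fun x : Env L × List Bool => x.1.trialCost with hT
  have hrows : InTime D (fun x => (doubleRows x.1.rowLen x.1.goal)^[x.1.doubles]
      ([List.replicate x.1.rowLen false], x.2)) T :=
    inTime_doubleRows_iterate.mono (BigO.of_le_one fun x _ =>
      Nat.mul_le_mul_left _ (Nat.mul_le_mul_left _ (by omega)))
  have hpos : ∀ e : Env L, 1 ≤ e.maxRows := fun e => by rw [Env.maxRows]; omega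
  have hbig : ∀ e : Env L, e.maxRows * (e.sampleCost + e.rowLen + 1) ≤ e.trialCost := fun e =>
    Nat.le_mul_of_pos_left _ (Nat.succ_pos _)
  have hcut : InTime D (fun x => (((doubleRows x.1.rowLen x.1.goal)^[x.1.doubles]
      ([List.replicate x.1.rowLen false], x.2)).2.take x.1.rowLen,
      ((doubleRows x.1.rowLen x.1.goal)^[x.1.doubles]
      ([List.replicate x.1.rowLen false], x.2)).2.drop x.1.rowLen)) T :=
    inTime_takeDrop.comp' (f := fun x : Env L × List Bool => (x.1.rowLen,
      ((doubleRows x.1.rowLen x.1.goal)^[x.1.doubles]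
      ([List.replicate x.1.rowLen false], x.2)).2))
      ((Env.constTime_rowLen.comp constTime_fst).inTime.pair hrows.snd)
      (BigO.of_le_one fun x _ => by
        refine le_trans ?_ (hbig x.1)
        have := hpos x.1
        nlinarith [Nat.zero_le x.1.sampleCost])
  have hlen : ∀ x : Env L × List Bool, ((doubleRows x.1.rowLen x.1.goal)^[x.1.doubles]
      ([List.replicate x.1.rowLen false], x.2)).1.length ≤ x.1.maxRows := by
    intro x
    rw [doubleRows_iterate_length]
    have : ∀ (j m i : ℕ), i ≤ 2 * m + 1 → (doubleCount m)^[j] i ≤ 2 * m + 1 := by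
      intro j m
      induction j with
      | zero => intro i hi; exact hi
      | succ j ih => intro i hi; rw [Function.iterate_succ_apply]; exact ih _ (doubleCount_le hi)
    exact this _ _ _ (by simp)
  have htally := inTime_tally.comp' (D := D) (T := T) (f := fun x : Env L × List Bool =>
      ((x.1, ((doubleRows x.1.rowLen x.1.goal)^[x.1.doubles]
        ([List.replicate x.1.rowLen false], x.2)).2.take x.1.rowLen),
        ((doubleRows x.1.rowLen x.1.goal)^[x.1.doubles]
        ([List.replicate x.1.rowLen false], x.2)).1))
      ((constTime_fst.inTime.pair hcut.fst).pair hrows.fst)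
      (BigO.of_le_one fun x _ => by
        refine le_trans (Nat.mul_le_mul (hlen x) ?_) (hbig x.1)
        have := List.length_take_le x.1.rowLen ((doubleRows x.1.rowLen x.1.goal)^[x.1.doubles]
          ([List.replicate x.1.rowLen false], x.2)).2
        simp only
        omega)
  refine (htally.fst.sub htally.snd (BigO.of_le_one fun x _ => ?_)).pair hcut.snd
  have h1 := tally_le x.1.sample (((doubleRows x.1.rowLen x.1.goal)^[x.1.doubles]
    ([List.replicate x.1.rowLen false], x.2)).2.take x.1.rowLen)
    ((doubleRows x.1.rowLen x.1.goal)^[x.1.doubles] ([List.replicate x.1.rowLen false], x.2)).1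
  have h2 := hlen x
  have h3 := hbig x.1
  have h4 : x.1.maxRows ≤ x.1.maxRows * (x.1.sampleCost + x.1.rowLen + 1) :=
    Nat.le_mul_of_pos_right _ (Nat.succ_pos _)
  simp only [hT]
  omega

theorem inTime_collect : InTime (fun _ : Env L × List Bool => True)
    (fun x => ((collect (trial x.1.sample x.1.rowLen x.1.goal x.1.doubles))^[x.1.y] ([], x.2)).1)
    (fun x => x.1.y * (x.1.trialCost + 1)) := by
  have hstep : InTime (fun _ : (Env L × List Bool) × List ℕ × List Bool => True)
      (fun x => collect (trial x.1.1.sample x.1.1.rowLen x.1.1.goal x.1.1.doubles) x.2)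
      (fun x => x.1.1.trialCost) := by
    have ht := inTime_trial.comp' (D := fun _ => True) (T := fun x => x.1.1.trialCost)
      (f := fun x : (Env L × List Bool) × List ℕ × List Bool => (x.1.1, x.2.2))
      (constTime_fst.fst.pair constTime_snd.snd).inTime (BigO.of_le_one fun _ _ => le_rfl)
    have hc : ConstTime (fun x : List ℕ × (ℕ × List Bool) => (x.2.1 :: x.1, x.2.2)) :=
      (constTime_snd.fst.cons constTime_fst).pair constTime_snd.snd
    exact hc.compIn (constTime_snd.fst.inTime.pair ht)
  exact (InTime.iterate (γ := Env L × List Bool) (s := fun x =>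
    collect (trial x.1.sample x.1.rowLen x.1.goal x.1.doubles)) (E := fun _ => True)
    (V := fun x => x.1.1.trialCost) (B := fun x => x.1.trialCost) hstep
    (Env.constTime_y.comp constTime_fst).inTime ((constTime_const []).pair constTime_snd).inTime
    (fun _ _ _ => True) (fun _ _ => trivial) (fun _ _ _ _ _ => ⟨trivial, trivial, le_rfl⟩)
    (BigO.of_le_one fun _ _ => le_rfl)).fst

/-! ### The median -/

theorem countPos_le (l : List ℕ) : countPos l ≤ l.length := by
  rw [countPos_eq]; exact List.countP_le_length

theorem inTime_medianStep : InTime (fun x : ℕ × List ℕ × ℕ => x.2.1.length ≤ x.1)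
    (fun x => medianStep x.1 x.2) (fun x => x.1) := by
  set D := fun x : ℕ × List ℕ × ℕ => x.2.1.length ≤ x.1
  set T := fun x : ℕ × List ℕ × ℕ => x.1
  have hl : InTime D (fun x => x.2.1) T := constTime_snd.fst.inTime
  have hlen : BigO D (fun x => x.2.1.length) T := BigO.of_le_one fun x hx => hx
  have hcount : InTime D (fun x => countPos x.2.1) T :=
    InTime.foldl_const (b₀ := fun _ => 0)
      (s := fun (_ : ℕ × List ℕ × ℕ) c a => bif decide (0 < a) then c + 1 else c)
      ((constTime_isPos.comp constTime_snd.snd).cond constTime_snd.fst.succ constTime_snd.fst)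
      hl (constTime_const _).inTime hlen
  have hlt : InTime D (fun x => decide (x.1 < countPos x.2.1 + countPos x.2.1)) T :=
    constTime_fst.inTime.lt (hcount.add hcount
      (BigO.of_le_one fun x hx => (countPos_le _).trans hx))
      (BigO.of_le_one fun _ _ => le_rfl)
  have hmap : InTime D (fun x => x.2.1.map fun a => a - 1) T :=
    hl.map_const (f := fun _ a => a - 1) (constTime_pred.comp constTime_snd) hlen
  exact hlt.cond' (hmap.pair constTime_snd.snd.succ.inTime) constTime_snd.inTime

def Env.medianCost (e : Env L) : ℕ := e.y * (e.trialCost + 1) + e.goal₂ * (e.y + 1)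

theorem inTime_numerator : InTime (fun _ : Env L × List Bool => True)
    (fun x => numerator x.1.ctx.Q x.1.k x.2) (fun x => x.1.medianCost) := by
  have hc : InTime (fun _ : Env L × List Bool => True) _ (fun x => x.1.medianCost) :=
    inTime_collect.mono (BigO.of_le_one fun x _ => Nat.le_add_right _ _)
  have h := InTime.iterate (γ := Env L × List Bool) (D := fun _ => True)
    (T := fun x => x.1.medianCost) (m := fun x => x.1.goal₂) (s := fun x => medianStep x.1.y)
    (E := fun x => x.2.1.length ≤ x.1.1.y) (V := fun x => x.1.1.y) (B := fun x => x.1.y)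
    (inTime_medianStep.comp (f := fun x : (Env L × List Bool) × List ℕ × ℕ => (x.1.1.y, x.2))
      ((Env.constTime_y.comp constTime_fst.fst).pair constTime_snd).inTime (fun _ h => h)
      (BigO.of_le_one fun _ _ => le_rfl))
    (Env.constTime_goal₂.comp constTime_fst).inTime (hc.pair (constTime_const 0).inTime)
    (fun x _ s => s.1.length ≤ x.1.y) (fun x _ => by rw [collect_length]; simp)
    (fun x r s _ hs => ⟨by
      rw [medianStep]
      cases decide (x.1.y < countPos s.1 + countPos s.1)
      · exact hs
      · simpa using hs, hs, le_rfl⟩)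
    (BigO.of_le_one fun x _ => Nat.le_add_left _ _)
  exact h.snd

/-! ### The denominator -/

/-- Division in unary: a counter runs down from 31, and each of its resets adds 9 to the result. -/
theorem iterate_scale (d : ℕ) : (fun p : ℕ × ℕ => bif decide (0 < p.2) then (p.1, p.2 - 1) else
    (p.1 + 1 + 1 + 1 + 1 + 1 + 1 + 1 + 1 + 1, 31))^[d] (0, 31) = (scaleStep d, 31 - d % 32) := by
  induction d with
  | zero => rfl
  | succ d ih =>
    rw [Function.iterate_succ_apply', ih]
    by_cases h : 0 < 31 - d % 32
    · simp only [h, decide_true, cond_true, scaleStep, Prod.mk.injEq]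
      omega
    · simp only [h, decide_false, cond_false, scaleStep, Prod.mk.injEq]
      omega

theorem inTime_scaleStep : InTime (fun _ : ℕ => True) scaleStep (fun d => d) := by
  have hc : ConstTime (fun x : ℕ × (ℕ × ℕ) => bif decide (0 < x.2.2) then (x.2.1, x.2.2 - 1) else
      (x.2.1 + 1 + 1 + 1 + 1 + 1 + 1 + 1 + 1 + 1, 31)) :=
    (constTime_isPos.comp constTime_snd.snd).cond
      (constTime_snd.fst.pair (constTime_pred.comp constTime_snd.snd))
      (constTime_snd.fst.succ.succ.succ.succ.succ.succ.succ.succ.succ.pair (constTime_const 31))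
  have h := InTime.iterate (γ := ℕ) (D := fun _ => True) (T := fun d => d) (m := fun d => d)
    (b₀ := fun _ => (0, 31)) (s := fun _ p => bif decide (0 < p.2) then (p.1, p.2 - 1) else
      (p.1 + 1 + 1 + 1 + 1 + 1 + 1 + 1 + 1 + 1, 31)) (E := fun _ => True) (V := fun _ => 0)
    (B := fun _ => 0) hc.inTime constTime_id.inTime (constTime_const _).inTime
    (fun _ _ _ => True) (fun _ _ => trivial) (fun _ _ _ _ _ => ⟨trivial, trivial, le_rfl⟩)
    (BigO.of_le_one fun _ _ => by simp)
  exact h.fst.congr fun d _ => by rw [iterate_scale]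

def Env.denominatorCost (e : Env L) : ℕ := (e.doubles + e.scalings) * (e.maxRows + 1)

theorem inTime_denominator : InTime (fun _ : Env L => True)
    (fun e => denominator e.ctx.n e.k) (fun e => e.denominatorCost) := by
  have hM : InTime (fun _ : Env L => True) (fun e => sampleNumber e.ctx.n e.k)
      (fun e => e.denominatorCost) := by
    have hstep : InTime (fun x : Env L × ℕ => x.2 ≤ x.1.maxRows)
        (fun x => doubleCount x.1.goal x.2) (fun x => x.1.maxRows) := by
      have h2 : InTime (fun x : Env L × ℕ => x.2 ≤ x.1.maxRows) (fun x => x.2)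
        (fun x => x.1.maxRows) := constTime_snd.inTime
      have hle : BigO (fun x : Env L × ℕ => x.2 ≤ x.1.maxRows) (fun x => x.2)
        (fun x => x.1.maxRows) := BigO.of_le_one fun x hx => hx
      exact (h2.lt (Env.constTime_goal.comp constTime_fst).inTime hle).cond' (h2.add h2 hle) h2
    exact InTime.iterate (γ := Env L) (s := fun e => doubleCount e.goal) (E := fun x =>
      x.2 ≤ x.1.maxRows) (V := fun x => x.1.maxRows) (B := fun e => e.maxRows) hstep
      Env.constTime_doubles.inTime (constTime_const 1).inTime (fun e _ x => x ≤ e.maxRows)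
      (fun e _ => by rw [Env.maxRows]; omega)
      (fun e r x _ hx => ⟨doubleCount_le hx, hx, le_rfl⟩)
      (BigO.of_le_one fun e _ => Nat.mul_le_mul_right _ (Nat.le_add_right _ _))
  have hbound : ∀ e : Env L, sampleNumber e.ctx.n e.k ≤ e.maxRows := by
    intro e
    have : ∀ (j m i : ℕ), i ≤ 2 * m + 1 → (doubleCount m)^[j] i ≤ 2 * m + 1 := by
      intro j m
      induction j with
      | zero => intro i hi; exact hi
      | succ j ih => intro i hi; rw [Function.iterate_succ_apply]; exact ih _ (doubleCount_le hi)
    exact this _ _ _ (by omega)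
  exact InTime.iterate (γ := Env L) (s := fun _ => scaleStep) (E := fun x => x.2 ≤ x.1.maxRows)
    (V := fun x => x.1.maxRows) (B := fun e => e.maxRows)
    (inTime_scaleStep.comp (f := fun x : Env L × ℕ => x.2) constTime_snd.inTime
      (fun _ _ => trivial) (BigO.of_le_one fun x hx => hx))
    Env.constTime_scalings.inTime hM (fun e _ d => d ≤ e.maxRows) (fun e _ => hbound e)
    (fun e r d _ hd => ⟨by
      have : scaleStep d ≤ d := by rw [scaleStep]; omega
      exact this.trans hd, hd, le_rfl⟩)
    (BigO.of_le_one fun e _ => Nat.mul_le_mul_right _ (Nat.le_add_left _ _))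

end SimulationPrograms

/-! ## The simulation program -/

section InputPrograms

variable {L : Prog}

theorem InTime.constMul {α : Type} [Enc α] {D : α → Prop} {a : α → ℕ} {T : α → ℕ} (c : ℕ)
    (ha : InTime D a T) (hT : BigO D a T) : InTime D (fun x => c * a x) T := by
  refine (constTime_const c).inTime.mul ha ?_
  obtain ⟨C, hC⟩ := hT
  refine ⟨c * C + 1, fun x hx => ?_⟩
  have := Nat.mul_le_mul_left c (hC x hx)
  nlinarith [Nat.zero_le (T x)]

/-- The input of the simulation. -/
structure Input (L : Prog) : Type where
  env : Env L
  coins : List Bool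

instance : Enc (Input L) := ⟨fun i => Tree2.cons i.env.ctx.d (Tree2.cons (encNat i.env.ctx.n)
  (Tree2.cons (encNat i.env.k) (Enc.enc i.coins)))⟩

theorem constTime_of_input {β : Type} [Enc β] {g : Tree2 × ℕ × ℕ × List Bool → β}
    (hg : ConstTime g) :
    ConstTime (fun i : Input L => g (i.env.ctx.d, i.env.ctx.n, i.env.k, i.coins)) :=
  hg.recode _ (fun _ => rfl) (fun _ => rfl)

/-- Division by 12 in unary; the count starts at 1 because `blocks` rounds up by one. -/
theorem iterate_blocks (n : ℕ) : (fun p : ℕ × ℕ => bif decide (0 < p.2) then (p.1, p.2 - 1) else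
    (p.1 + 1, 11))^[n] (1, 11) = (blocks n, 11 - n % 12) := by
  induction n with
  | zero => rfl
  | succ n ih =>
    rw [Function.iterate_succ_apply', ih]
    by_cases h : 0 < 11 - n % 12
    · simp only [h, decide_true, cond_true, blocks, Prod.mk.injEq]
      omega
    · simp only [h, decide_false, cond_false, blocks, Prod.mk.injEq]
      omega

def Input.setupCost (i : Input L) : ℕ :=
  i.env.rowLen + 11 * blocks i.env.ctx.n * (i.env.goal + 1)

/-- A quadratic polynomial with large coefficients, used to bound the cost of computing the small
parameters. -/
theorem Env.rowLen_eq (e : Env L) : e.rowLen = 50 * (e.y * e.y) + 482 * e.y + 1086 := by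
  simp only [Env.rowLen, rowLength, walkLength]
  ring

theorem inTime_env : InTime (fun _ : Input L => True) (fun i => i.env) Input.setupCost := by
  set D := fun _ : Input L => True
  have hsmall : ∀ F : Input L → ℕ, (∀ i, F i ≤ 2 * i.env.rowLen) → BigO D F Input.setupCost :=
    fun F hF => ⟨2, fun i _ => by
      have := hF i
      have : i.env.rowLen ≤ i.setupCost := Nat.le_add_right _ _
      omega⟩
  have hny : ∀ i : Input L, i.env.ctx.n ≤ i.env.y := fun i => Nat.le_add_right _ _
  have hky : ∀ i : Input L, i.env.k ≤ i.env.y := fun i => Nat.le_add_left _ _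
  have hd : InTime D (fun i => i.env.ctx.d) Input.setupCost :=
    (constTime_of_input constTime_fst).inTime
  have hn : InTime D (fun i => i.env.ctx.n) Input.setupCost :=
    (constTime_of_input constTime_snd.fst).inTime
  have hk : InTime D (fun i => i.env.k) Input.setupCost :=
    (constTime_of_input constTime_snd.snd.fst).inTime
  have hctx : InTime D (fun i => i.env.ctx) Input.setupCost := by
    obtain ⟨P, c, hP⟩ := hd.pair hn
    exact ⟨P, c, hP⟩
  have hy : InTime D (fun i => i.env.y) Input.setupCost := hn.add hk (hsmall _ fun i => by
    have := hny i
    rw [Env.rowLen_eq]; omega)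
  have hb : InTime D (fun i => blocks i.env.ctx.n) Input.setupCost := by
    have hc : ConstTime (fun x : Input L × (ℕ × ℕ) => bif decide (0 < x.2.2) then
        (x.2.1, x.2.2 - 1) else (x.2.1 + 1, 11)) :=
      (constTime_isPos.comp constTime_snd.snd).cond
        (constTime_snd.fst.pair (constTime_pred.comp constTime_snd.snd))
        (constTime_snd.fst.succ.pair (constTime_const 11))
    have h := InTime.iterate (s := fun (_ : Input L) (p : ℕ × ℕ) => bif decide (0 < p.2) then
      (p.1, p.2 - 1) else (p.1 + 1, 11)) (b₀ := fun _ => (1, 11)) (E := fun _ => True)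
      (V := fun _ => 0) (B := fun _ => 0) hc.inTime hn (constTime_const _).inTime
      (fun _ _ _ => True) (fun _ _ => trivial) (fun _ _ _ _ _ => ⟨trivial, trivial, le_rfl⟩)
      (hsmall _ fun i => by
        have := hny i
        rw [Env.rowLen_eq]; omega)
    exact h.fst.congr fun i _ => by rw [iterate_blocks]
  have hbs : BigO D (fun i => blocks i.env.ctx.n) Input.setupCost := hsmall _ fun i => by
    have := hny i
    rw [Env.rowLen_eq, blocks]; omega
  have hys : BigO D (fun i => i.env.y) Input.setupCost := hsmall _ fun i => by
    rw [Env.rowLen_eq]; omega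
  have hwalk : InTime D (fun i => i.env.walk) Input.setupCost :=
    (hy.constMul 10 hys).add (constTime_const 35).inTime (hsmall _ fun i => by
      rw [Env.rowLen_eq]; omega)
  have hdoubles : InTime D (fun i => i.env.doubles) Input.setupCost :=
    (hy.constMul 3 hys).add (constTime_const 19).inTime (hsmall _ fun i => by
      rw [Env.rowLen_eq]; omega)
  have hrow : InTime D (fun i => i.env.rowLen) Input.setupCost := by
    have h1 : InTime D (fun i => 6 + i.env.walk * 5) Input.setupCost :=
      (constTime_const 6).inTime.add (hwalk.mul (constTime_const 5).inTime (hsmall _ fun i => by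
        rw [Env.rowLen_eq, Env.walk, walkLength]; omega)) (hsmall _ fun i => by
        rw [Env.rowLen_eq]; omega)
    have h2 : InTime D (fun i => i.env.y + 6) Input.setupCost :=
      hy.add (constTime_const 6).inTime hys
    exact (h2.mul h1 (hsmall _ fun i => by
      rw [Env.rowLen_eq, Env.walk, walkLength]; nlinarith)).add hy (hsmall _ fun i => by
      rw [Env.rowLen_eq, Env.walk, walkLength]; nlinarith)
  have hgoal : InTime D (fun i => i.env.goal) Input.setupCost := by
    have h1 : InTime D (fun i => i.env.k * i.env.k) Input.setupCost :=
      hk.mul hk (hsmall _ fun i => by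
        have := hky i
        rw [Env.rowLen_eq]; nlinarith)
    have h2 : InTime D (fun i => 256 * (i.env.k * i.env.k)) Input.setupCost :=
      h1.constMul 256 (hsmall _ fun i => by
        have := hky i
        rw [Env.rowLen_eq]; nlinarith)
    have h3 : InTime D (fun i => 11 * blocks i.env.ctx.n) Input.setupCost := hb.constMul 11 hbs
    have hs : InTime (fun _ : Input L × ℕ => True) (fun x => x.2 + x.2) (fun x => x.2) :=
      constTime_snd.inTime.add constTime_snd.inTime (BigO.of_le_one fun _ _ => le_rfl)
    -- The power of two comes from repeated doubling. By the invariant no intermediate value exceeds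
    -- the goal.
    have h4 := InTime.iterate (s := fun (_ : Input L) (x : ℕ) => x + x) (B := fun i => i.env.goal)
      hs h3 h2 (fun i r x => x * 2 ^ r = i.env.goal) (fun i _ => rfl)
      (fun i r x _ hx => ⟨by rw [← hx, pow_succ]; ring, trivial, by
        rw [← hx]; exact Nat.le_mul_of_pos_right _ (by positivity)⟩)
      (BigO.of_le_one fun i _ => Nat.le_add_left _ _)
    refine h4.congr fun i _ => ?_
    have h5 : ∀ m x : ℕ, (fun x => x + x)^[m] x = x * 2 ^ m := by
      intro m
      induction m with
      | zero => simp
      | succ m ih => intro x; rw [Function.iterate_succ_apply, ih, pow_succ]; ring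
    exact h5 _ _
  have hgoal₂ : InTime D (fun i => i.env.goal₂) Input.setupCost :=
    hgoal.constMul 2 (BigO.of_le_one fun i _ => by
      have : 1 ≤ blocks i.env.ctx.n := by rw [blocks]; omega
      rw [Input.setupCost]
      nlinarith)
  -- The tuple of parameters and the environment are the same tree.
  obtain ⟨P, c, hP⟩ := hctx.pair (hy.pair ((hb.constMul 6 hbs).pair ((hb.constMul 12 hbs).pair
    (hwalk.pair (hrow.pair (hdoubles.pair (hgoal.pair (hgoal₂.pair (hb.constMul 3 hbs)))))))))
  exact ⟨P, c, hP⟩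

def Input.cost (i : Input L) : ℕ := i.setupCost + i.env.medianCost + i.env.denominatorCost

theorem inTime_simulation : InTime (fun _ : Input L => True)
    (fun i => (numerator i.env.ctx.Q i.env.k i.coins, denominator i.env.ctx.n i.env.k))
    Input.cost := by
  have he : InTime (fun _ : Input L => True) (fun i => i.env) Input.cost :=
    inTime_env.mono (BigO.of_le_one fun i _ => by rw [Input.cost]; omega)
  have hc : InTime (fun _ : Input L => True) (fun i => i.coins) Input.cost :=
    (constTime_of_input constTime_snd.snd.snd).inTime
  have h1 := inTime_numerator.comp' (he.pair hc)
    (BigO.of_le_one fun i _ => by simp only [Input.cost]; omega)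
  have h2 := inTime_denominator.comp' he (BigO.of_le_one fun i _ => by rw [Input.cost]; omega)
  exact h1.pair h2

end InputPrograms

/-! ## Polynomial bounds -/

theorem Polynomial.eval_le_eval {p : Polynomial ℕ} {a b : ℕ} (h : a ≤ b) : p.eval a ≤ p.eval b := by
  induction p using Polynomial.induction_on' with
  | add p q hp hq => rw [Polynomial.eval_add, Polynomial.eval_add]; exact Nat.add_le_add hp hq
  | monomial n c =>
    rw [Polynomial.eval_monomial, Polynomial.eval_monomial]
    exact Nat.mul_le_mul_left _ (Nat.pow_le_pow_left h n)

section Bounds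

variable {ι : Type} {sz E : ι → ℕ}

/-- The function is bounded by a polynomial in the size. -/
def PolyBounded (sz F : ι → ℕ) : Prop := ∃ q : Polynomial ℕ, ∀ i, F i ≤ q.eval (sz i)

/-- The function is bounded by `E` times a polynomial in the size. -/
def BoundedBy (sz E F : ι → ℕ) : Prop := ∃ q : Polynomial ℕ, ∀ i, F i ≤ E i * q.eval (sz i)

theorem PolyBounded.const (c : ℕ) : PolyBounded sz (fun _ => c) :=
  ⟨Polynomial.C c, fun _ => by simp⟩

theorem PolyBounded.of_le {F : ι → ℕ} (h : ∀ i, F i ≤ sz i) : PolyBounded sz F :=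
  ⟨Polynomial.X, fun i => by simpa using h i⟩

theorem PolyBounded.add {F G : ι → ℕ} (hF : PolyBounded sz F) (hG : PolyBounded sz G) :
    PolyBounded sz (fun i => F i + G i) := by
  obtain ⟨p, hp⟩ := hF
  obtain ⟨q, hq⟩ := hG
  exact ⟨p + q, fun i => by rw [Polynomial.eval_add]; exact Nat.add_le_add (hp i) (hq i)⟩

theorem PolyBounded.mul {F G : ι → ℕ} (hF : PolyBounded sz F) (hG : PolyBounded sz G) :
    PolyBounded sz (fun i => F i * G i) := by
  obtain ⟨p, hp⟩ := hF
  obtain ⟨q, hq⟩ := hG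
  exact ⟨p * q, fun i => by rw [Polynomial.eval_mul]; exact Nat.mul_le_mul (hp i) (hq i)⟩

theorem PolyBounded.boundedBy {F : ι → ℕ} (hF : PolyBounded sz F) (hE : ∀ i, 1 ≤ E i) :
    BoundedBy sz E F := by
  obtain ⟨p, hp⟩ := hF
  exact ⟨p, fun i => (hp i).trans (Nat.le_mul_of_pos_left _ (hE i))⟩

theorem BoundedBy.add {F G : ι → ℕ} (hF : BoundedBy sz E F) (hG : BoundedBy sz E G) :
    BoundedBy sz E (fun i => F i + G i) := by
  obtain ⟨p, hp⟩ := hF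
  obtain ⟨q, hq⟩ := hG
  exact ⟨p + q, fun i => by
    rw [Polynomial.eval_add, mul_add]; exact Nat.add_le_add (hp i) (hq i)⟩

theorem BoundedBy.mul {F G : ι → ℕ} (hF : BoundedBy sz E F) (hG : PolyBounded sz G) :
    BoundedBy sz E (fun i => F i * G i) := by
  obtain ⟨p, hp⟩ := hF
  obtain ⟨q, hq⟩ := hG
  exact ⟨p * q, fun i => by
    rw [Polynomial.eval_mul, ← mul_assoc]; exact Nat.mul_le_mul (hp i) (hq i)⟩

theorem BoundedBy.mul' {F G : ι → ℕ} (hG : PolyBounded sz G) (hF : BoundedBy sz E F) :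
    BoundedBy sz E (fun i => G i * F i) := by
  simpa only [mul_comm] using hF.mul hG

end Bounds

/-- The inputs for which the classical processing takes time `p n`. -/
abbrev BoundedInput (L : Prog) (p : Polynomial ℕ) : Type :=
  {i : Input L // i.env.ctx.time = p.eval i.env.ctx.n}

/-- Only `goal` is exponential, through its factor `2 ^ (11 * blocks n)`. Every cost is at most
linear in it, with coefficients polynomial in `n + k`. -/
theorem cost_bounded (L : Prog) (p : Polynomial ℕ) :
    BoundedBy (fun i : BoundedInput L p => i.1.env.y) (fun i => 2 ^ (11 * blocks i.1.env.ctx.n))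
      (fun i => i.1.cost + 1) := by
  set sz := fun i : BoundedInput L p => i.1.env.y with hsz
  have hy : PolyBounded sz (fun i => i.1.env.y) := .of_le fun _ => le_rfl
  have hn : PolyBounded sz (fun i => i.1.env.ctx.n) := .of_le fun _ => Nat.le_add_right _ _
  have hn' : PolyBounded sz (fun i => i.1.env.n) := hn
  have hk : PolyBounded sz (fun i => i.1.env.k) := .of_le fun _ => Nat.le_add_left _ _
  have ht : PolyBounded sz (fun i => i.1.env.ctx.time) :=
    ⟨p, fun i => i.2.le.trans (Polynomial.eval_le_eval (Nat.le_add_right _ _))⟩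
  have hb : PolyBounded sz (fun i => blocks i.1.env.ctx.n) := by
    obtain ⟨q, hq⟩ := hn.add (.const 1)
    exact ⟨q, fun i => le_trans (by simp only [blocks]; omega) (hq i)⟩
  have hpairs : PolyBounded sz (fun i => i.1.env.pairs) := (PolyBounded.const 6).mul hb
  have hword : PolyBounded sz (fun i => i.1.env.wordLen) := (PolyBounded.const 12).mul hb
  have hscal : PolyBounded sz (fun i => i.1.env.scalings) := (PolyBounded.const 3).mul hb
  have hwalk : PolyBounded sz (fun i => i.1.env.walk) :=
    ((PolyBounded.const 10).mul hy).add (.const 35)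
  have hdoub : PolyBounded sz (fun i => i.1.env.doubles) :=
    ((PolyBounded.const 3).mul hy).add (.const 19)
  have hrow : PolyBounded sz (fun i => i.1.env.rowLen) :=
    ((hy.add (.const 6)).mul ((PolyBounded.const 6).add (hwalk.mul (.const 5)))).add hy
  have hstep : PolyBounded sz (fun i => i.1.env.stepCost) :=
    (ht.add ((hn'.add (.const 1)).mul (hword.add (.const 1)))).add hn'
  have hrun : PolyBounded sz (fun i => i.1.env.runCost) := hn'.mul (hstep.add (.const 1))
  have hsample : PolyBounded sz (fun i => i.1.env.sampleCost) :=
    ((hpairs.mul (hwalk.add (.const 1))).add hrun).add ht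
  have hE : ∀ i : BoundedInput L p, 1 ≤ 2 ^ (11 * blocks i.1.env.ctx.n) := fun _ =>
    Nat.one_le_two_pow
  have hgoal : BoundedBy sz (fun i => 2 ^ (11 * blocks i.1.env.ctx.n)) (fun i => i.1.env.goal) := by
    obtain ⟨q, hq⟩ := (PolyBounded.const 256).mul (hk.mul hk)
    exact ⟨q, fun i => by
      simp only [Env.goal, sampleGoal]
      rw [mul_comm]
      exact Nat.mul_le_mul_left _ (hq i)⟩
  have hone : BoundedBy sz (fun i => 2 ^ (11 * blocks i.1.env.ctx.n)) (fun _ => 1) :=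
    (PolyBounded.const 1).boundedBy hE
  have hmax : BoundedBy sz (fun i => 2 ^ (11 * blocks i.1.env.ctx.n))
      (fun i => i.1.env.maxRows) := (BoundedBy.mul' (.const 2) hgoal).add hone
  have hgoal₂ : BoundedBy sz (fun i => 2 ^ (11 * blocks i.1.env.ctx.n))
      (fun i => i.1.env.goal₂) := BoundedBy.mul' (.const 2) hgoal
  have htrial : BoundedBy sz (fun i => 2 ^ (11 * blocks i.1.env.ctx.n))
      (fun i => i.1.env.trialCost) :=
    BoundedBy.mul' (hdoub.add (.const 1)) (hmax.mul ((hsample.add hrow).add (.const 1)))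
  have hmed : BoundedBy sz (fun i => 2 ^ (11 * blocks i.1.env.ctx.n))
      (fun i => i.1.env.medianCost) :=
    (BoundedBy.mul' hy (htrial.add hone)).add (hgoal₂.mul (hy.add (.const 1)))
  have hden : BoundedBy sz (fun i => 2 ^ (11 * blocks i.1.env.ctx.n))
      (fun i => i.1.env.denominatorCost) := BoundedBy.mul' (hdoub.add hscal) (hmax.add hone)
  have hset : BoundedBy sz (fun i => 2 ^ (11 * blocks i.1.env.ctx.n))
      (fun i => i.1.setupCost) :=
    (hrow.boundedBy hE).add (BoundedBy.mul' ((PolyBounded.const 11).mul hb) (hgoal.add hone))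
  exact ((hset.add hmed).add hden).add hone

/-- The comparison `2 ^ 11 = 2048 ≤ 2401 = 7 ^ 4` for each full block of twelve qubits; the
additional block costs the constant 2048. -/
theorem two_pow_blocks_le (n : ℕ) :
    (2 : ℝ) ^ (11 * blocks n) ≤ 2048 * 2 ^ (Real.logb 2 7 / 3 * (n : ℝ)) := by
  have h1 : (2 : ℝ) ^ (Real.logb 2 7 / 3 * (n : ℝ)) = 7 ^ ((n : ℝ) / 3) := by
    rw [show Real.logb 2 7 / 3 * (n : ℝ) = Real.logb 2 7 * ((n : ℝ) / 3) by ring,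
      Real.rpow_mul (by norm_num), Real.rpow_logb (by norm_num) (by norm_num) (by norm_num)]
  have h2 : ((4 * (n / 12) : ℕ) : ℝ) ≤ (n : ℝ) / 3 := by
    have : 12 * (n / 12) ≤ n := Nat.mul_div_le n 12
    have h : ((12 * (n / 12) : ℕ) : ℝ) ≤ n := by exact_mod_cast this
    push_cast at h ⊢
    linarith
  have h3 : (7 : ℝ) ^ (4 * (n / 12)) ≤ 7 ^ ((n : ℝ) / 3) := by
    rw [← Real.rpow_natCast]
    exact Real.rpow_le_rpow_of_exponent_le (by norm_num) h2
  rw [h1, blocks, show 11 * (n / 12 + 1) = 11 + 11 * (n / 12) by ring, pow_add]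
  have h4 : (2 : ℝ) ^ (11 * (n / 12)) ≤ 7 ^ (4 * (n / 12)) := by
    rw [pow_mul, pow_mul]
    exact pow_le_pow_left₀ (by norm_num) (by norm_num) _
  have h5 : (2 : ℝ) ^ 11 = 2048 := by norm_num
  rw [h5]
  exact mul_le_mul_of_nonneg_left (h4.trans h3) (by norm_num)

theorem enc_nat_pair (a b : ℕ) : Enc.enc (a, b) = Tree2.cons (encNat a) (encNat b) := rfl

theorem exists_simulation (L : Prog) : ∃ (S : Prog) (r : Polynomial ℕ), ∀ p : Polynomial ℕ,
    ∃ q : Polynomial ℕ, ∀ (n : ℕ) (Q : PBC n) (d : Tree2), ComputesLabels L d Q (p.eval n) →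
      ∀ k : ℕ, 1 ≤ k → Simulates S d Q k (r.eval (n + k))
        ((2 : ℝ) ^ (Real.logb 2 7 / 3 * (n : ℝ)) * ((q.eval (n + k) : ℕ) : ℝ)) := by
  obtain ⟨S, c, hS⟩ := inTime_simulation (L := L)
  obtain ⟨r, hr⟩ : ∃ r : Polynomial ℕ, ∀ y, r.eval y = coinNumber y := by
    refine ⟨.X * ((3 * .X + 19 + 1) * ((.X + 6) * (6 + (10 * .X + 35) * 5) + .X)), fun y => ?_⟩
    simp [coinNumber, doublings, rowLength, walkLength]
  refine ⟨S, r, fun p => ?_⟩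
  obtain ⟨q, hq⟩ := cost_bounded L p
  refine ⟨.C (2048 * c) * q, fun n Q d hL k hk => ?_⟩
  rw [hr]
  have key : ∀ w : Fin (coinNumber (n + k)) → Bool, ∃ s : ℕ,
      (s : ℝ) ≤ (2 : ℝ) ^ (Real.logb 2 7 / 3 * (n : ℝ)) *
        (((Polynomial.C (2048 * c) * q).eval (n + k) : ℕ) : ℝ) ∧
      Runs S (simInput d n k w) (Tree2.cons (encNat (numerator Q k (List.ofFn w)))
        (encNat (denominator n k))) s := by
    intro w
    -- The program and the constant `c` were obtained from `L` alone; the polynomial `p` enters only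
    -- here, as the time bound stored in the context.
    let i : Input L := ⟨⟨⟨n, Q, d, p.eval n, hL⟩, k⟩, List.ofFn w⟩
    obtain ⟨s, hs, hrun⟩ := hS i trivial
    refine ⟨s, ?_, ?_⟩
    · have h1 : s ≤ c * (2 ^ (11 * blocks n) * q.eval (n + k)) :=
        hs.trans (Nat.mul_le_mul_left _ (hq ⟨i, rfl⟩))
      have h2 : (s : ℝ) ≤ c * (2 ^ (11 * blocks n) * (q.eval (n + k) : ℕ)) := by
        exact_mod_cast h1
      refine h2.trans ?_
      rw [Polynomial.eval_mul, Polynomial.eval_C]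
      push_cast
      have h3 := two_pow_blocks_le n
      have h4 : (0 : ℝ) ≤ c * ((q.eval (n + k) : ℕ) : ℝ) := by positivity
      calc (c : ℝ) * (2 ^ (11 * blocks n) * (q.eval (n + k) : ℕ)) =
          2 ^ (11 * blocks n) * (c * (q.eval (n + k) : ℕ)) := by ring
        _ ≤ _ := mul_le_mul_of_nonneg_right h3 h4
        _ = _ := by ring
    · have e : Enc.enc i = simInput d n k w := by
        show Tree2.cons d (Tree2.cons (encNat n) (Tree2.cons (encNat k)
          (Enc.enc (List.ofFn w)))) = _
        rw [enc_ofFn_bits]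
        rfl
      rw [e, enc_nat_pair] at hrun
      exact hrun
  refine ⟨fun w => ?_, (simulation_accurate Q k hk).trans ?_⟩
  · obtain ⟨s, hs, hrun⟩ := key w
    exact ⟨_, s, hs, hrun⟩
  · refine div_le_div_of_nonneg_right ?_ (by positivity)
    refine Nat.cast_le.2 (Nat.card_le_card_of_injective (Subtype.map id fun w hw => ?_)
      (Subtype.map_injective _ Function.injective_id))
    obtain ⟨s, _, hrun⟩ := key w
    exact ⟨_, _, s, hw.1, hrun, hw.2⟩

/-! ## The stabilizer rank of six magic states -/

section Rays

variable {n : ℕ}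

/-- The integer vector is a multiple of a stabilizer state. -/
def IsStabilizerRay (g : (Fin n → Fin 2) → ℤ) : Prop :=
  ∃ (c : ℂ) (φ : QVec n), IsStabilizerState φ ∧ ∀ x, (g x : ℂ) = c * φ x

/-- Integer vectors make explicit values decidable. Two unnormalized Hadamard gates on a qubit
produce a factor 2, which has to be divided out. -/
theorem IsStabilizerRay.of_mul {g : (Fin n → Fin 2) → ℤ} {m : ℤ} (hm : m ≠ 0)
    (h : IsStabilizerRay fun x => m * g x) : IsStabilizerRay g := by
  obtain ⟨c, φ, hφ, hc⟩ := h
  refine ⟨c / m, φ, hφ, fun x => ?_⟩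
  have h1 := hc x
  have h2 : (m : ℂ) ≠ 0 := by exact_mod_cast hm
  push_cast at h1
  rw [div_mul_eq_mul_div, ← h1]
  field_simp

theorem fin_two_cases (a : Fin 2) : a = 0 ∨ a = 1 := by
  fin_cases a <;> simp

theorem IsStabilizerRay.hadamard {g : (Fin n → Fin 2) → ℤ} (h : IsStabilizerRay g) (i : Fin n) :
    IsStabilizerRay fun x => g (Function.update x i 0) +
      (if x i = 0 then 1 else -1) * g (Function.update x i 1) := by
  obtain ⟨c, φ, hφ, hc⟩ := h
  refine ⟨c * (Real.sqrt 2 : ℝ), _, hφ.hadamard i, fun x => ?_⟩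
  have h2 : ((Real.sqrt 2 : ℝ) : ℂ) ≠ 0 := by
    rw [Complex.ofReal_ne_zero]; positivity
  simp only [hadamardGate, Fin.sum_univ_two]
  push_cast
  rw [hc, hc]
  rcases fin_two_cases (x i) with h | h <;> rw [h] <;> simp <;> field_simp

theorem IsStabilizerRay.cnot {g : (Fin n → Fin 2) → ℤ} (h : IsStabilizerRay g) {i j : Fin n}
    (hij : i ≠ j) : IsStabilizerRay fun x => g (Function.update x j (x j + x i)) := by
  obtain ⟨c, φ, hφ, hc⟩ := h
  exact ⟨c, _, hφ.cnot i j hij, fun x => hc _⟩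

theorem IsStabilizerRay.pauliZ {g : (Fin n → Fin 2) → ℤ} (h : IsStabilizerRay g) (i : Fin n) :
    IsStabilizerRay fun x => (if x i = 0 then 1 else -1) * g x := by
  obtain ⟨c, φ, hφ, hc⟩ := h
  refine ⟨c, _, (hφ.phase i).phase i, fun x => ?_⟩
  simp only [phaseGate]
  push_cast
  rw [hc]
  rcases fin_two_cases (x i) with h | h
  · simp [h]
  · simp only [h, if_true, one_ne_zero, if_false]
    linear_combination (-c * φ x) * Complex.I_mul_I

/-- `X = H Z H`, up to the factor 2 from the missing normalization. -/
theorem IsStabilizerRay.pauliX {g : (Fin n → Fin 2) → ℤ} (h : IsStabilizerRay g) (i : Fin n) :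
    IsStabilizerRay fun x => g (Function.update x i (x i + 1)) := by
  refine .of_mul (m := 2) (by norm_num) ?_
  have h1 := ((h.hadamard i).pauliZ i).hadamard i
  convert h1 using 2 with x
  simp only [Function.update_self, Function.update_idem]
  rcases fin_two_cases (x i) with h | h <;> rw [h] <;> simp <;> ring

/-- CNOT conjugated by Hadamard gates on the target. -/
theorem IsStabilizerRay.controlledZ {g : (Fin n → Fin 2) → ℤ} (h : IsStabilizerRay g)
    {i j : Fin n} (hij : i ≠ j) :
    IsStabilizerRay fun x => (if x i = 1 ∧ x j = 1 then -1 else 1) * g x := by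
  refine .of_mul (m := 2) (by norm_num) ?_
  have h1 := ((h.hadamard j).cnot hij).hadamard j
  convert h1 using 2 with x
  simp only [Function.update_self, Function.update_idem, Function.update_of_ne hij]
  rcases fin_two_cases (x i) with h | h <;> rcases fin_two_cases (x j) with h' | h'
  all_goals
    have e := Function.update_eq_self j x
    rw [h'] at e
    simp [h, h', e]
    try ring

/-- The bits in `S` are zero. -/
theorem isStabilizerRay_subcube (S : Finset (Fin n)) :
    IsStabilizerRay fun x => if ∀ j ∈ S, x j = 0 then 1 else 0 := by
  induction h : (Finset.univ \ S).card generalizing S with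
  | zero =>
    have hS : S = Finset.univ := by
      rw [Finset.card_eq_zero, Finset.sdiff_eq_empty_iff_subset] at h
      exact Finset.univ_subset_iff.1 h
    refine ⟨1, _, .zero, fun x => ?_⟩
    subst hS
    by_cases hx : x = 0
    · simp [hx, zeroState]
    · have : ¬ ∀ j, x j = 0 := fun hj => hx (funext hj)
      simp [zeroState, hx, this]
  | succ m ih =>
    -- A Hadamard gate on a qubit fixed at `0` makes this bit free; the induction is on the number
    -- of free bits.
    obtain ⟨i, hi⟩ := Finset.card_pos.1 (by omega : 0 < (Finset.univ \ S).card)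
    have hiS : i ∉ S := (Finset.mem_sdiff.1 hi).2
    have h1 := (ih (insert i S) (by
      rw [Finset.sdiff_insert, Finset.card_erase_of_mem hi, h]; rfl)).hadamard i
    convert h1 using 2 with x
    have e0 : (∀ j ∈ insert i S, Function.update x i 0 j = 0) ↔ ∀ j ∈ S, x j = 0 := by
      constructor
      · intro hj j hjS
        have := hj j (Finset.mem_insert_of_mem hjS)
        rwa [Function.update_of_ne (ne_of_mem_of_not_mem hjS hiS)] at this
      · intro hj j hjS
        rcases Finset.mem_insert.1 hjS with rfl | hjS
        · simp
        · rw [Function.update_of_ne (ne_of_mem_of_not_mem hjS hiS)]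
          exact hj j hjS
    have e1 : ¬ ∀ j ∈ insert i S, Function.update x i 1 j = 0 := by
      intro hj
      have := hj i (Finset.mem_insert_self _ _)
      simp at this
    rw [if_neg e1]
    simp only [e0, mul_zero, add_zero]

/-- Signs from quadratic terms. -/
def quadraticSigns (l : List (Fin n × Fin n)) (g : (Fin n → Fin 2) → ℤ) : (Fin n → Fin 2) → ℤ :=
  l.foldr (fun p g x => (if x p.1 = 1 ∧ x p.2 = 1 then -1 else 1) * g x) g

theorem IsStabilizerRay.quadraticSigns {g : (Fin n → Fin 2) → ℤ} (h : IsStabilizerRay g)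
    {l : List (Fin n × Fin n)} (hl : ∀ p ∈ l, p.1 ≠ p.2) :
    IsStabilizerRay (_root_.quadraticSigns l g) := by
  induction l with
  | nil => exact h
  | cons p l ih =>
    exact (ih fun q hq => hl q (List.mem_cons_of_mem _ hq)).controlledZ (hl p List.mem_cons_self)

/-- Signs from linear terms. -/
def linearSigns (l : List (Fin n)) (g : (Fin n → Fin 2) → ℤ) : (Fin n → Fin 2) → ℤ :=
  l.foldr (fun i g x => (if x i = 0 then 1 else -1) * g x) g

theorem IsStabilizerRay.linearSigns {g : (Fin n → Fin 2) → ℤ} (h : IsStabilizerRay g)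
    (l : List (Fin n)) : IsStabilizerRay (_root_.linearSigns l g) := by
  induction l with
  | nil => exact h
  | cons i l ih => exact ih.pauliZ i

/-- Bit flips. -/
def flips (l : List (Fin n)) (g : (Fin n → Fin 2) → ℤ) : (Fin n → Fin 2) → ℤ :=
  l.foldr (fun i g x => g (Function.update x i (x i + 1))) g

theorem IsStabilizerRay.flips {g : (Fin n → Fin 2) → ℤ} (h : IsStabilizerRay g)
    (l : List (Fin n)) : IsStabilizerRay (_root_.flips l g) := by
  induction l with
  | nil => exact h
  | cons i l ih => exact ih.pauliX i

/-- Addition of the bits in a list to the bit `j`. -/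
def addBits (j : Fin n) (l : List (Fin n)) (g : (Fin n → Fin 2) → ℤ) : (Fin n → Fin 2) → ℤ :=
  l.foldr (fun i g x => g (Function.update x j (x j + x i))) g

theorem IsStabilizerRay.addBits {g : (Fin n → Fin 2) → ℤ} (h : IsStabilizerRay g) {j : Fin n}
    {l : List (Fin n)} (hl : ∀ i ∈ l, i ≠ j) : IsStabilizerRay (_root_.addBits j l g) := by
  induction l with
  | nil => exact h
  | cons i l ih =>
    exact (ih fun k hk => hl k (List.mem_cons_of_mem _ hk)).cnot (hl i List.mem_cons_self)

end Rays

/-! ### Seven stabilizer vectors on six qubits -/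

/-- The vectors of bit strings of even weight. -/
def evenVector : (Fin 6 → Fin 2) → ℤ :=
  addBits 5 [0, 1, 2, 3, 4] fun x => if ∀ j ∈ ({5} : Finset (Fin 6)), x j = 0 then 1 else 0

def oddVector : (Fin 6 → Fin 2) → ℤ := flips [5] evenVector

def allPairs : List (Fin 6 × Fin 6) :=
  [(0, 1), (0, 2), (0, 3), (0, 4), (0, 5), (1, 2), (1, 3), (1, 4), (1, 5), (2, 3), (2, 4), (2, 5),
    (3, 4), (3, 5), (4, 5)]

/-- The complete graph contributes `(-1) ^ (w (w - 1) / 2)` at weight `w`; with the linear signs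
this becomes `(-1) ^ (w (w + 1) / 2)`. -/
def cliqueVector : (Fin 6 → Fin 2) → ℤ :=
  linearSigns [0, 1, 2, 3, 4, 5] (quadraticSigns allPairs
    fun x => if ∀ j ∈ (∅ : Finset (Fin 6)), x j = 0 then 1 else 0)

def zeroVector : (Fin 6 → Fin 2) → ℤ :=
  fun x => if ∀ j ∈ (Finset.univ : Finset (Fin 6)), x j = 0 then 1 else 0

def oneVector : (Fin 6 → Fin 2) → ℤ := flips [0, 1, 2, 3, 4, 5] zeroVector

/-- Pentagon and pentagram are complementary graphs on five vertices. Neither sign pattern is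
symmetric, but on odd strings their sum depends only on the weight: it is `2`, `0`, `-2` at weights
`1`, `3`, `5`. -/
def pentagonVector : (Fin 6 → Fin 2) → ℤ :=
  quadraticSigns [(0, 1), (1, 2), (2, 3), (3, 4), (4, 0)] oddVector

def pentagramVector : (Fin 6 → Fin 2) → ℤ :=
  quadraticSigns [(0, 2), (2, 4), (4, 1), (1, 3), (3, 0)] oddVector

def hammingWeight (x : Fin 6 → Fin 2) : ℕ := ∑ i, (x i : ℕ)

/-- The values of the seven vectors, up to the sum of the last two. -/
def weightTable (w : ℕ) : ℤ × ℤ × ℤ × ℤ × ℤ × ℤ :=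
  [(1, 0, 1, 1, 0, 0), (0, 1, -1, 0, 0, 2), (1, 0, -1, 0, 0, 0), (0, 1, 1, 0, 0, 0),
    (1, 0, 1, 0, 0, 0), (0, 1, -1, 0, 0, -2), (1, 0, -1, 0, 1, 0)].getD w (0, 0, 0, 0, 0, 0)

theorem vector_values (x : Fin 6 → Fin 2) :
    (evenVector x, oddVector x, cliqueVector x, zeroVector x, oneVector x,
      pentagonVector x + pentagramVector x) = weightTable (hammingWeight x) ∧
      hammingWeight x ≤ 6 := by
  revert x
  decide +kernel

/-- Here `c = cos (π/8)` and `t = tan (π/8)`; the equation of `t` expresses `tan (π/4) = 1`. -/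
theorem exists_magicState_eq : ∃ c t : ℂ, t ^ 2 + 2 * t - 1 = 0 ∧
    ∀ x, magicState 6 x = c ^ 6 * t ^ hammingWeight x := by
  have hc : Real.cos (Real.pi / 8) ≠ 0 := by
    refine (Real.cos_pos_of_mem_Ioo ⟨?_, ?_⟩).ne' <;> linarith [Real.pi_pos]
  set c := Real.cos (Real.pi / 8) with hcd
  set s := Real.sin (Real.pi / 8) with hsd
  have h1 : 2 * s * c = c ^ 2 - s ^ 2 := by
    have h2 : Real.pi / 4 = 2 * (Real.pi / 8) := by ring
    have h3 := Real.sin_pi_div_four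
    have h4 := Real.cos_pi_div_four
    rw [h2, Real.sin_two_mul] at h3
    rw [h2, Real.cos_two_mul'] at h4
    rw [h3, h4]
  have h5 : (s / c) ^ 2 + 2 * (s / c) - 1 = 0 := by
    field_simp
    linarith only [h1]
  refine ⟨c, ((s / c : ℝ) : ℂ), by exact_mod_cast h5, fun x => ?_⟩
  have h6 : ∀ i, ((![c, s] (x i) : ℝ) : ℂ) = (c : ℂ) * ((s / c : ℝ) : ℂ) ^ (x i : ℕ) := by
    intro i
    have hc' : (c : ℂ) ≠ 0 := by exact_mod_cast hc
    rcases fin_two_cases (x i) with h | h <;> rw [h]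
    · simp
    · push_cast
      simp
      field_simp
  rw [magicState, hammingWeight, ← Finset.prod_pow_eq_pow_sum]
  simp only [← hcd, ← hsd]
  rw [Finset.prod_congr rfl fun i _ => h6 i, Finset.prod_mul_distrib]
  simp

/-- By symmetry there is one equation for each weight. Weights `0` and `6` are adjusted by the zero
and the one vector, and the quadratic equation makes the other five equations compatible: `t ^ 4 + 2
t ^ 3 = t ^ 2` for even weights, `t ^ 4 - 6 t ^ 2 + 1 = 0` for weights `1` and `5`. -/
theorem pow_hammingWeight {t : ℂ} (ht : t ^ 2 + 2 * t - 1 = 0) (x : Fin 6 → Fin 2) :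
    t ^ hammingWeight x = (t ^ 2 + t ^ 4) / 2 * evenVector x + 2 * t ^ 3 * oddVector x +
      -t ^ 3 * cliqueVector x + (1 - (t ^ 2 + t ^ 4) / 2 + t ^ 3) * zeroVector x +
      (t ^ 6 - (t ^ 2 + t ^ 4) / 2 - t ^ 3) * oneVector x +
      (t - t ^ 5) / 4 * pentagonVector x + (t - t ^ 5) / 4 * pentagramVector x := by
  obtain ⟨h, hw⟩ := vector_values x
  generalize hammingWeight x = w at *
  have hp : (pentagonVector x : ℂ) =
      ((weightTable w).2.2.2.2.2 : ℂ) - pentagramVector x := by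
    rw [← h]; push_cast; ring
  have h1 := congrArg (·.1) h
  have h2 := congrArg (·.2.1) h
  have h3 := congrArg (·.2.2.1) h
  have h4 := congrArg (·.2.2.2.1) h
  have h5 := congrArg (·.2.2.2.2.1) h
  simp only at h1 h2 h3 h4 h5
  rw [hp, h1, h2, h3, h4, h5]
  clear h h1 h2 h3 h4 h5 hp
  interval_cases w <;> simp only [weightTable, List.getD_cons_zero, List.getD_cons_succ] <;>
    push_cast
  · ring
  · linear_combination t / 2 * (t ^ 2 - 2 * t - 1) * ht
  · linear_combination -t ^ 2 / 2 * ht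
  · ring
  · linear_combination t ^ 2 / 2 * ht
  · linear_combination t / 2 * (t ^ 2 - 2 * t - 1) * ht
  · ring

theorem isStabilizerRay_evenVector : IsStabilizerRay evenVector :=
  (isStabilizerRay_subcube {5}).addBits (by decide)

theorem isStabilizerRay_oddVector : IsStabilizerRay oddVector :=
  isStabilizerRay_evenVector.flips _

theorem isStabilizerRay_cliqueVector : IsStabilizerRay cliqueVector :=
  ((isStabilizerRay_subcube ∅).quadraticSigns (by decide)).linearSigns _

theorem isStabilizerRay_zeroVector : IsStabilizerRay zeroVector :=
  isStabilizerRay_subcube Finset.univ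

theorem isStabilizerRay_oneVector : IsStabilizerRay oneVector :=
  isStabilizerRay_zeroVector.flips _

theorem isStabilizerRay_pentagonVector : IsStabilizerRay pentagonVector :=
  isStabilizerRay_oddVector.quadraticSigns (by decide)

theorem isStabilizerRay_pentagramVector : IsStabilizerRay pentagramVector :=
  isStabilizerRay_oddVector.quadraticSigns (by decide)

theorem hasStabilizerDecomposition_of_rays {n m : ℕ} {ψ : QVec n}
    {g : Fin m → (Fin n → Fin 2) → ℤ} (hg : ∀ a, IsStabilizerRay (g a)) (k : Fin m → ℂ)
    (h : ∀ x, ψ x = ∑ a, k a * g a x) : HasStabilizerDecomposition ψ m := by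
  choose c φ hφ hc using hg
  refine ⟨fun a => k a * c a, φ, hφ, funext fun x => ?_⟩
  rw [h, Finset.sum_apply]
  exact Finset.sum_congr rfl fun a _ => by rw [hc, Pi.smul_apply, smul_eq_mul, mul_assoc]

theorem hasStabilizerDecomposition_magicState_six :
    HasStabilizerDecomposition (magicState 6) 7 := by
  obtain ⟨c, t, ht, h⟩ := exists_magicState_eq
  refine hasStabilizerDecomposition_of_rays
    (g := ![evenVector, oddVector, cliqueVector, zeroVector, oneVector, pentagonVector,
      pentagramVector]) ?_
    (fun a => c ^ 6 * ![(t ^ 2 + t ^ 4) / 2, 2 * t ^ 3, -t ^ 3, 1 - (t ^ 2 + t ^ 4) / 2 + t ^ 3,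
      t ^ 6 - (t ^ 2 + t ^ 4) / 2 - t ^ 3, (t - t ^ 5) / 4, (t - t ^ 5) / 4] a) fun x => ?_
  · intro a
    fin_cases a
    exacts [isStabilizerRay_evenVector, isStabilizerRay_oddVector, isStabilizerRay_cliqueVector,
      isStabilizerRay_zeroVector, isStabilizerRay_oneVector, isStabilizerRay_pentagonVector,
      isStabilizerRay_pentagramVector]
  · rw [h, pow_hammingWeight ht]
    simp [Fin.sum_univ_succ]
    ring

theorem theorem4 :
    stabilizerRank (magicState 6) ≤ 7 ∧
    ∀ L : Prog, ∃ (S : Prog) (r : Polynomial ℕ), ∀ p : Polynomial ℕ, ∃ q : Polynomial ℕ,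
      ∀ (n : ℕ) (Q : PBC n) (d : Tree2), ComputesLabels L d Q (p.eval n) →
        ∀ k : ℕ, 1 ≤ k →
          Simulates S d Q k (r.eval (n + k))
            ((2 : ℝ) ^ (Real.logb 2 7 / 3 * (n : ℝ)) * ((q.eval (n + k) : ℕ) : ℝ)) :=
  ⟨iInf₂_le 7 hasStabilizerDecomposition_magicState_six, exists_simulation⟩
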